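/- **Setting.** Let $(G,K,\theta,B)$ be a reductive Lie group (in Knapp's sense) with Lie algebra $\mathfrak g=\mathfrak k\oplus\mathfrak p$, and let $(G,H)$ be a symmetric pair: $\sigma$ is an involutive automorphism of $G$, $(G^\sigma)_0\le H\le G^\sigma$, $HG_0H=G$; the differential of $\sigma$ (again written $\sigma$) commutes with $\theta$ and preserves $B$. Put $\mathfrak h=\mathfrak g^\sigma=\mathrm{Lie}(H)$ and $\mathfrak g^{-\sigma}=\{X\mid\sigma X=-X\}$. Fix a maximal commutative $\mathfrak t\le\mathfrak k^{-\sigma}$ and a maximal commutative $\mathfrak c=\mathfrak t\oplus\mathfrak a$ of $\mathfrak g^{-\sigma}$ with $\mathfrak a\le\mathfrak p$. Let $C'=\exp(\mathfrak c')t$ be a standard Cartan subset, i.e. $t\in\exp(\mathfrak t)$, $\mathfrak c'\le\mathfrak g^{-\sigma}\cap\mathrm{Ad}(t)(\mathfrak g^{-\sigma})$ is commutative, $\mathfrak c'=\mathfrak t'\oplus\mathfrak a'$ with $\mathfrak t'\le\mathfrak t$ and $\mathfrak a\le\mathfrak a'\le\mathfrak p$, and $\dim\mathfrak c'=\dim\mathfrak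 c$. For $\alpha\in(\mathfrak c'_{\mathbb C})^*$ let $\mathfrak g_\alpha=\{X\in\mathfrak g_{\mathbb C}\mid [Z,X]=\alpha(Z)X\ \forall Z\in\mathfrak c'\}$, $n_\alpha=\dim\mathfrak g_\alpha$, and let $\Sigma$ be the (finite) set of $\alpha\neq0$ with $\mathfrak g_\alpha\ne0$. Put $\mathfrak m'=Z_{\mathfrak h}(\mathfrak c')$. Let $G_{rs}$ be the set of $g\in G$ for which $\sigma\,\mathrm{Ad}(g)\,\sigma\,\mathrm{Ad}(g)^{-1}$ is semisimple and $\mathfrak g^{-\sigma}\cap\mathrm{Ad}(g)(\mathfrak g^{-\sigma})$ is commutative. Enveloping and symmetric algebras are those of the complexifications. **Technical condition.** $\mathrm{Ad}(t)\mathfrak c'\subseteq\mathfrak c'$, and there are an involution $\phi\in O(\mathfrak g_{\mathbb C},B)$ commuting with $\sigma$ and $\epsilon_\alpha\in\mathbb C^\times$ such that $\mathrm{Ad}(t)X=\epsilon_\alpha\phi(X)$ for all $X\in\mathfrak g_\alpha$, for every $\alpha$ (including $\alpha=0$) with $\mathfrak g_\alpha\neq0$. Write $t\alpha=\alpha\circ\mathrm{Ad}(t)|_{\mathfrak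 c'}$ and $x^\alpha=\epsilon_\alpha e^{\alpha(X)}$ for $x=\exp(X)t$. **The decompositions.** Let $U(\mathfrak h)\otimes_{U(\mathfrak m')}U(\mathfrak h)$ be the quotient of $U(\mathfrak h)\otimes U(\mathfrak h)$ by the relations $u\,\mathrm{Ad}(t)(m)\otimes v=u\otimes mv$ ($m\in U(\mathfrak m')$). For $q\in U(\mathfrak g)$, $\Pi(q)$ and $\widetilde\Pi(q)$ denote elements $\sum_i f_i\otimes p_i\otimes u_i\otimes v_i$ and $\sum_j\tilde f_j\otimes\tilde p_j\otimes\tilde u_j\otimes\tilde v_j$ of $$C^\infty(C'\cap G_{rs})\otimes S(\mathfrak c')\otimes\big(U(\mathfrak h)\otimes_{U(\mathfrak m')}U(\mathfrak h)\big)$$ such that for all $x\in C'\cap G_{rs}$ $$q=\sum_i f_i(x)\,\mathrm{Ad}(x^{-1})(u_ip_i)\,v_i=\sum_j\tilde f_j(x)\,\tilde u_j\tilde p_j\,\mathrm{Ad}(x)(\tilde v_j).$$ **Notation for the formula.** $\Omega_{\mathfrak g},\Omega_{\mathfrak c'},\Omega_{\mathfrak m'}$ are the quadratic Casimir elements $\sum_i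 b_ib^i$ ($B$-dual bases); $C_\alpha\in\mathfrak c'_{\mathbb C}$ is determined by $B(C_\alpha,Y)=\alpha(Y)$ for $Y\in\mathfrak c'$; $A_\alpha=\sum_i(X_i+\sigma X_i)\otimes(X_i+\sigma X_i)\in\mathfrak h_{\mathbb C}\otimes\mathfrak h_{\mathbb C}\subseteq U(\mathfrak h)\otimes U(\mathfrak h)$ for a basis $X_i$ of $\mathfrak g_\alpha$ that is orthonormal for $B_\sigma(X,Y)=-B(X,\sigma Y)$; $m$ is multiplication in $U(\mathfrak h)$; and $$\coth_\alpha(x)=\frac{x^\alpha+x^{-\alpha}}{x^\alpha-x^{-\alpha}},\qquad \operatorname{csch}_\alpha(x)=\frac{2}{x^\alpha-x^{-\alpha}},\qquad \operatorname{csch}^2_{\alpha/2}(x)=\frac{4}{x^\alpha+x^{-\alpha}-2}.$$ **Theorem.** Under the technical condition, for $\alpha\in\Sigma$ and $x\in C'\cap G_{rs}$ one has $x^\alpha\neq x^{-\alpha}$, the functions $\coth_\alpha,\operatorname{csch}_\alpha,\operatorname{csch}^2_{\alpha/2}$ are well defined and smooth on $C'\cap G_{rs}$, and $\Pi(\Omega_{\mathfrak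 g})$ and $\widetilde\Pi(\Omega_{\mathfrak g})$ exist, are unique, and are given by $$\begin{aligned}\Pi(\Omega_{\mathfrak g})=\widetilde\Pi(\Omega_{\mathfrak g})={}&\Omega_{\mathfrak c'}+\sum_{\alpha\in\Sigma}\frac{n_\alpha}2\coth_\alpha C_\alpha+\Omega_{\mathfrak m'}\\&+\sum_{\alpha\in\Sigma}\frac{\operatorname{csch}_\alpha^2}{4}\big(m(A_\alpha)\otimes1+1\otimes m(A_{t\alpha})+2(1\otimes\phi)A_\alpha\big)-\sum_{\alpha\in\Sigma}\frac{\operatorname{csch}^2_{\alpha/2}}{4}(1\otimes\phi)A_\alpha.\end{aligned}$$ In particular, if $\mathrm{Ad}(t)=1$, the same holds with $\phi=1$, $t\alpha=\alpha$ and, for $x=\exp(X)t\in C'\cap G_{rs}$, $\coth_\alpha(x)=\coth(\alpha(X))$, $\operatorname{csch}_\alpha(x)=1/\sinh(\alpha(X))$, $\operatorname{csch}^2_{\alpha/2}(x)=1/\sinh^2(\alpha(X)/2)$. -/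

import Mathlib

open scoped Manifold ContDiff TensorProduct

namespace CasimirRadial

noncomputable section

/-! ### Complexified Lie algebras -/

section Algebra

attribute [local instance 100] LieRing.ofAssociativeRing

variable {L : Type*} [LieRing L] [LieAlgebra ℝ L]

/-- The complexification `𝔤_ℂ` of a real Lie algebra. -/
abbrev Cx (L : Type*) [LieRing L] [LieAlgebra ℝ L] : Type _ := ℂ ⊗[ℝ] L

/-- The complex-linear extension of a homomorphism of real Lie algebras. -/
def homC (f : L →ₗ⁅ℝ⁆ L) : Cx L →ₗ⁅ℂ⁆ Cx L :=
  { (f : L →ₗ[ℝ] L).baseChange ℂ with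
    map_lie' := fun {x y} =>
      LieHom.map_lie (LieAlgebra.ExtendScalars.map (AlgHom.id ℝ ℂ) f) x y }

@[simp]
theorem homC_tmul (f : L →ₗ⁅ℝ⁆ L) (z : ℂ) (X : L) : homC f (z ⊗ₜ[ℝ] X) = z ⊗ₜ[ℝ] f X := rfl

/-- The complexification of a subalgebra, inside the complexification of the Lie algebra. -/
def complexify (S : LieSubalgebra ℝ L) : LieSubalgebra ℂ (Cx L) :=
  { S.toSubmodule.baseChange ℂ with
    lie_mem' := by
      intro x y hx hy
      change x ∈ S.toSubmodule.baseChange ℂ at hx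
      change y ∈ S.toSubmodule.baseChange ℂ at hy
      change ⁅x, y⁆ ∈ S.toSubmodule.baseChange ℂ
      rw [Submodule.baseChange_eq_span] at hx hy
      induction hx, hy using Submodule.span_induction₂ with
      | mem_mem x y hx hy =>
        obtain ⟨x, hx, rfl⟩ := hx
        obtain ⟨y, hy, rfl⟩ := hy
        simp only [TensorProduct.mk_apply, LieAlgebra.ExtendScalars.bracket_tmul]
        exact Submodule.tmul_mem_baseChange_of_mem _ (S.lie_mem hx hy)
      | zero_left y hy => 
        have h : ⁅(0 : Cx L), y⁆ = 0 := zero_lie y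
        rw [h]; exact zero_mem _
      | zero_right x hx => 
        have h : ⁅x, (0 : Cx L)⁆ = 0 := lie_zero x
        rw [h]; exact zero_mem _
      | add_left x y z _ _ _ h₁ h₂ => rw [add_lie]; exact add_mem h₁ h₂
      | add_right x y z _ _ _ h₁ h₂ => exact (lie_add x y z : ⁅x, y + z⁆ = _) ▸ add_mem h₁ h₂
      | smul_left r x y _ _ h => rw [smul_lie]; exact Submodule.smul_mem _ _ h
      | smul_right r x y _ _ h => exact (lie_smul r x y : ⁅x, r • y⁆ = _) ▸ Submodule.smul_mem _ _ h }

theorem tmul_mem_complexify (S : LieSubalgebra ℝ L) (z : ℂ) {X : L} (hX : X ∈ S) :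
    z ⊗ₜ[ℝ] X ∈ complexify S :=
  Submodule.tmul_mem_baseChange_of_mem _ hX

theorem complexify_mono {S T : LieSubalgebra ℝ L} (h : S ≤ T) : complexify S ≤ complexify T :=
  fun _ hx => Submodule.baseChange_mono (A := ℂ) (p := S.toSubmodule) (q := T.toSubmodule) h hx

/-- The fixed subalgebra `𝔤^σ`. -/
def fixedSubalgebra (σ : L →ₗ⁅ℝ⁆ L) : LieSubalgebra ℝ L where
  carrier := {X | σ X = X}
  add_mem' {x y} hx hy := by
    simp only [Set.mem_ofPred_eq] at *
    rw [map_add, hx, hy]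
  zero_mem' := map_zero σ
  smul_mem' r x hx := by
    simp only [Set.mem_ofPred_eq] at *
    rw [map_smul, hx]
  lie_mem' {x y} hx hy := by
    change σ ⁅x, y⁆ = ⁅x, y⁆
    rw [LieHom.map_lie, show σ x = x from hx, show σ y = y from hy]

/-- The `(-1)`-eigenspace `𝔤^{-σ}`. -/
def antiFixed (σ : L →ₗ⁅ℝ⁆ L) : Submodule ℝ L :=
  LinearMap.ker ((σ : L →ₗ[ℝ] L) + LinearMap.id)

/-- `𝔪' = Z_𝔥(𝔠')`, the centraliser of `𝔠'` in `𝔥 = 𝔤^σ`. -/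
def centralizerInFixed (σ : L →ₗ⁅ℝ⁆ L) (c : LieSubalgebra ℝ L) : LieSubalgebra ℝ L where
  carrier := {X | σ X = X ∧ ∀ Z ∈ c, ⁅Z, X⁆ = 0}
  add_mem' {x y} hx hy :=
    ⟨(fixedSubalgebra σ).add_mem hx.1 hy.1, fun Z hZ => by
      rw [lie_add, hx.2 Z hZ, hy.2 Z hZ, add_zero]⟩
  zero_mem' := ⟨map_zero σ, fun Z _ => lie_zero Z⟩
  smul_mem' r x hx :=
    ⟨(fixedSubalgebra σ).smul_mem r hx.1, fun Z hZ => by rw [lie_smul, hx.2 Z hZ, smul_zero]⟩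
  lie_mem' {x y} hx hy :=
    ⟨(fixedSubalgebra σ).lie_mem hx.1 hy.1, fun Z hZ => by
      rw [leibniz_lie, hx.2 Z hZ, hy.2 Z hZ, zero_lie, lie_zero, add_zero]⟩

/-- `𝔥_ℂ`, where `𝔥 = 𝔤^σ`. -/
abbrev hC (σ : L →ₗ⁅ℝ⁆ L) : LieSubalgebra ℂ (Cx L) := complexify (fixedSubalgebra σ)

/-- `𝔪'_ℂ`. -/
abbrev mC (σ : L →ₗ⁅ℝ⁆ L) (c : LieSubalgebra ℝ L) : LieSubalgebra ℂ (Cx L) :=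
  complexify (centralizerInFixed σ c)

theorem mC_le_hC (σ : L →ₗ⁅ℝ⁆ L) (c : LieSubalgebra ℝ L) : mC σ c ≤ hC σ :=
  complexify_mono fun _ hX => hX.1

theorem add_homC_mem_hC {σ : L →ₗ⁅ℝ⁆ L} (hσ : ∀ X, σ (σ X) = X) (X : Cx L) :
    X + homC σ X ∈ hC σ := by
  induction X using TensorProduct.induction_on with
  | zero => simp
  | tmul z Y =>
    rw [homC_tmul, ← TensorProduct.tmul_add]
    refine tmul_mem_complexify _ z ?_
    change σ (Y + σ Y) = Y + σ Y
    rw [map_add, hσ, add_comm]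
  | add x y hx hy =>
    rw [map_add, add_add_add_comm]
    exact add_mem hx hy

theorem mem_hC_iff {σ : L →ₗ⁅ℝ⁆ L} (hσ : ∀ X, σ (σ X) = X) (X : Cx L) :
    X ∈ hC σ ↔ homC σ X = X := by
  constructor
  · intro hX
    change X ∈ (fixedSubalgebra σ).toSubmodule.baseChange ℂ at hX
    rw [Submodule.baseChange_eq_span] at hX
    induction hX using Submodule.span_induction with
    | mem x hx =>
      obtain ⟨y, hy, rfl⟩ := hx
      rw [TensorProduct.mk_apply, homC_tmul, show σ y = y from hy]
    | zero => simp
    | add x y _ _ hx hy => rw [map_add, hx, hy]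
    | smul r x _ hx => rw [map_smul, hx]
  · intro hX
    have h := (hC σ).smul_mem (1 / 2 : ℂ) (add_homC_mem_hC hσ X)
    rw [hX, ← two_smul ℂ X, smul_smul] at h
    simpa using h

/-! ### Root spaces

The complex dual `(𝔠'_ℂ)^*` is identified with the space of real-linear maps `𝔠' → ℂ`. -/

/-- `𝔤_α = {X ∈ 𝔤_ℂ | ad(Z)(X) = α(Z) X for all Z}`. -/
def rootSpace (c : LieSubalgebra ℝ L) (α : c →ₗ[ℝ] ℂ) : Submodule ℂ (Cx L) where
  carrier := {X | ∀ Z : c, LieAlgebra.ad ℂ (Cx L) ((1 : ℂ) ⊗ₜ[ℝ] (Z : L)) X = α Z • X}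
  add_mem' {x y} hx hy Z := by rw [map_add, hx Z, hy Z, smul_add]
  zero_mem' Z := by rw [map_zero, smul_zero]
  smul_mem' r x hx Z := by rw [map_smul, hx Z, smul_comm]

/-- The roots of `𝔤` with respect to `𝔠'`: the nonzero `α` with `𝔤_α ≠ 0`. -/
def roots (c : LieSubalgebra ℝ L) : Set (c →ₗ[ℝ] ℂ) := {α | α ≠ 0 ∧ rootSpace c α ≠ ⊥}

theorem finite_roots [Module.Finite ℝ L] (c : LieSubalgebra ℝ L)
    (hc : ∀ X ∈ c, ∀ Y ∈ c, ⁅X, Y⁆ = 0) : (roots c).Finite := by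
  let f : c → Module.End ℂ (Cx L) := fun Z => LieAlgebra.ad ℂ (Cx L) ((1 : ℂ) ⊗ₜ[ℝ] (Z : L))
  have hcomm : ∀ i j : c, Commute (f i) (f j) := by
    intro i j
    have h : ⁅(1 : ℂ) ⊗ₜ[ℝ] (i : L), (1 : ℂ) ⊗ₜ[ℝ] (j : L)⁆ = 0 := by
      rw [LieAlgebra.ExtendScalars.bracket_tmul, hc _ i.2 _ j.2, TensorProduct.tmul_zero]
    refine LinearMap.ext fun X => ?_
    have h2 := leibniz_lie ((1 : ℂ) ⊗ₜ[ℝ] (i : L)) ((1 : ℂ) ⊗ₜ[ℝ] (j : L)) X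
    have h3 : ⁅⁅(1 : ℂ) ⊗ₜ[ℝ] (i : L), (1 : ℂ) ⊗ₜ[ℝ] (j : L)⁆, X⁆ = 0 := by
      rw [h]; exact zero_lie X
    exact h2.trans (by rw [h3, zero_add]; rfl)
  have hind := Module.End.independent_iInf_maxGenEigenspace_of_forall_mapsTo f
    (fun i j φ => Module.End.mapsTo_maxGenEigenspace_of_comm (hcomm j i) φ)
  have hfin := WellFoundedGT.finite_ne_bot_of_iSupIndep hind
  refine Set.Finite.of_finite_image (f := fun α : c →ₗ[ℝ] ℂ => (α : c → ℂ))
    (hfin.subset ?_) (fun _ _ _ _ h => DFunLike.coe_injective h)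
  rintro _ ⟨α, hα, rfl⟩
  intro hbot
  refine hα.2 (eq_bot_iff.mpr (le_trans ?_ hbot.le))
  refine le_iInf fun Z X hX => ?_
  refine (Module.End.mem_maxGenEigenspace _ _ _).mpr ⟨1, ?_⟩
  have := hX Z
  simp only [pow_one, LinearMap.sub_apply, LinearMap.smul_apply, Module.End.one_apply]
  exact sub_eq_zero.mpr this

/-! ### Quadratic elements attached to bilinear forms -/

open Classical in
/-- The tensor `∑ bᵢ ⊗ bⁱ` for a basis `b` and its dual basis with respect to a nondegenerate
form (`0` for a degenerate form). -/
def canonicalTensor {V : Type*} [AddCommGroup V] [Module ℂ V] [Module.Finite ℂ V]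
    (β : LinearMap.BilinForm ℂ V) : V ⊗[ℂ] V :=
  if h : β.Nondegenerate then
    ∑ i, Module.finBasis ℂ V i ⊗ₜ[ℂ] β.dualBasis h (Module.finBasis ℂ V) i
  else 0

/-- For an orthonormal basis, `canonicalTensor` is `∑ eᵢ ⊗ eᵢ`. -/
theorem canonicalTensor_eq_sum {V : Type*} [AddCommGroup V] [Module ℂ V] [Module.Finite ℂ V]
    (β : LinearMap.BilinForm ℂ V) {ι : Type*} [Fintype ι] [DecidableEq ι]
    (e : Module.Basis ι ℂ V) (he : ∀ i j, β (e i) (e j) = if i = j then 1 else 0) :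
    canonicalTensor β = ∑ i, e i ⊗ₜ[ℂ] e i := by
  have hrepr : ∀ (v : V) (j : ι), e.repr v j = β v (e j) := by
    intro v j
    have h : e.coord j = β.flip (e j) := e.ext fun i => by
      simp [he, Finsupp.single_apply]
    exact LinearMap.congr_fun h v
  have hrepr' : ∀ (v : V) (j : ι), e.repr v j = β (e j) v := by
    intro v j
    have h : e.coord j = β (e j) := e.ext fun i => by
      simp [he, Finsupp.single_apply, eq_comm]
    exact LinearMap.congr_fun h v
  have hnd : β.Nondegenerate := by
    refine ⟨fun x hx => ?_, fun y hy => ?_⟩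
    · exact e.ext_elem fun i => by rw [hrepr, hx]; simp
    · exact e.ext_elem fun i => by rw [hrepr', hy]; simp
  rw [canonicalTensor, dif_pos hnd]
  set b := Module.finBasis ℂ V
  set d := β.dualBasis hnd b
  have h1 : ∀ i, b i = ∑ j, β (e j) (b i) • e j := fun i => by
    conv_lhs => rw [← e.sum_repr (b i)]
    simp only [hrepr']
  have h2 : ∀ j, ∑ i, β (e j) (b i) • d i = e j := fun j => by
    conv_rhs => rw [← d.sum_repr (e j)]
    exact Finset.sum_congr rfl fun i _ => by rw [LinearMap.BilinForm.dualBasis_repr_apply]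
  calc ∑ i, b i ⊗ₜ[ℂ] d i = ∑ i, ∑ j, e j ⊗ₜ[ℂ] (β (e j) (b i) • d i) := by
        refine Finset.sum_congr rfl fun i _ => ?_
        conv_lhs => rw [h1 i]
        rw [TensorProduct.sum_tmul]
        exact Finset.sum_congr rfl fun j _ => TensorProduct.smul_tmul _ _ _
    _ = ∑ j, e j ⊗ₜ[ℂ] e j := by
        rw [Finset.sum_comm]
        exact Finset.sum_congr rfl fun j _ => by rw [← TensorProduct.tmul_sum, h2]

/-- The image in an algebra `A` of `∑ bᵢ bⁱ`, along a linear map `f : V → A`. -/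
def quadraticElement {V A : Type*} [AddCommGroup V] [Module ℂ V] [Module.Finite ℂ V]
    [Ring A] [Algebra ℂ A] (β : LinearMap.BilinForm ℂ V) (f : V →ₗ[ℂ] A) : A :=
  LinearMap.mul' ℂ A (TensorProduct.map f f (canonicalTensor β))

/-- The complex-bilinear extension of a real bilinear form. -/
abbrev formC (B : LinearMap.BilinForm ℝ L) : LinearMap.BilinForm ℂ (Cx L) :=
  LinearMap.BilinForm.baseChange ℂ B

/-- `B_σ(X, Y) = -B(X, σ(Y))` on `𝔤_ℂ`. -/
def formSigma (B : LinearMap.BilinForm ℝ L) (σ : L →ₗ⁅ℝ⁆ L) : LinearMap.BilinForm ℂ (Cx L) :=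
  -(formC B).compRight (homC σ : Cx L →ₗ[ℂ] Cx L)

/-! ### The elements entering the formula -/

/-- `U(𝔤_ℂ)`. -/
abbrev Ug (L : Type*) [LieRing L] [LieAlgebra ℝ L] : Type _ := UniversalEnvelopingAlgebra ℂ (Cx L)

/-- `U(𝔥_ℂ)`. -/
abbrev Uh (σ : L →ₗ⁅ℝ⁆ L) : Type _ := UniversalEnvelopingAlgebra ℂ (hC σ)

/-- `S(𝔠')`, realised as the enveloping algebra of the commutative Lie algebra `𝔠'_ℂ`. -/
abbrev Sc (c : LieSubalgebra ℝ L) : Type _ := UniversalEnvelopingAlgebra ℂ (complexify c)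

/-- The algebra homomorphism `U(S) → U(𝔤_ℂ)` extending the inclusion of a subalgebra. -/
def inclU (S : LieSubalgebra ℂ (Cx L)) : UniversalEnvelopingAlgebra ℂ S →ₐ[ℂ] Ug L :=
  UniversalEnvelopingAlgebra.lift ℂ ((UniversalEnvelopingAlgebra.ι ℂ).comp S.incl)

/-- The algebra endomorphism of `U(𝔤_ℂ)` extending an endomorphism of the Lie algebra `𝔤`. -/
def mapU (f : L →ₗ⁅ℝ⁆ L) : Ug L →ₐ[ℂ] Ug L :=
  UniversalEnvelopingAlgebra.lift ℂ ((UniversalEnvelopingAlgebra.ι ℂ).comp (homC f))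

/-- The embedding `𝔥_ℂ → U(𝔥_ℂ)` as a linear map. -/
abbrev ιh (σ : L →ₗ⁅ℝ⁆ L) : hC σ →ₗ[ℂ] Uh σ :=
  (UniversalEnvelopingAlgebra.ι ℂ : hC σ →ₗ⁅ℂ⁆ Uh σ)

/-- The embedding `𝔪'_ℂ → U(𝔥_ℂ)` as a linear map. -/
def ιm (σ : L →ₗ⁅ℝ⁆ L) (c : LieSubalgebra ℝ L) : mC σ c →ₗ[ℂ] Uh σ :=
  ιh σ ∘ₗ Submodule.inclusion (p := (mC σ c).toSubmodule) (p' := (hC σ).toSubmodule) (mC_le_hC σ c)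

section Elements

variable [Module.Finite ℝ L]

/-- The quadratic Casimir element `Ω_𝔤 ∈ U(𝔤_ℂ)`. -/
def casimir (B : LinearMap.BilinForm ℝ L) : Ug L :=
  quadraticElement (formC B) (UniversalEnvelopingAlgebra.ι ℂ : Cx L →ₗ⁅ℂ⁆ Ug L)

/-- `Ω_{𝔠'} ∈ S(𝔠')`. -/
def casimirC (B : LinearMap.BilinForm ℝ L) (c : LieSubalgebra ℝ L) : Sc c :=
  quadraticElement ((formC B).restrict (complexify c).toSubmodule)
    (UniversalEnvelopingAlgebra.ι ℂ : complexify c →ₗ⁅ℂ⁆ Sc c)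

/-- `Ω_{𝔪'} ∈ U(𝔪'_ℂ)`, viewed in `U(𝔥_ℂ)`. -/
def casimirM (σ : L →ₗ⁅ℝ⁆ L) (B : LinearMap.BilinForm ℝ L) (c : LieSubalgebra ℝ L) : Uh σ :=
  quadraticElement ((formC B).restrict (mC σ c).toSubmodule) (ιm σ c)

open Classical in
/-- `C_α ∈ 𝔠'_ℂ`, the element with `α(Y) = B(C_α, Y)` for all `Y ∈ 𝔠'`. (It exists and is unique
when `B` is nondegenerate on `𝔠'`.) -/
def coroot (B : LinearMap.BilinForm ℝ L) (c : LieSubalgebra ℝ L) (α : c →ₗ[ℝ] ℂ) : complexify c :=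
  if h : ∃ C : complexify c, ∀ Y : c, formC B (C : Cx L) ((1 : ℂ) ⊗ₜ[ℝ] (Y : L)) = α Y then
    h.choose
  else 0

/-- The map `𝔤_α → 𝔥_ℂ`, `X ↦ X + σ(X)`. -/
def symmetrize {σ : L →ₗ⁅ℝ⁆ L} (hσ : ∀ X, σ (σ X) = X) (c : LieSubalgebra ℝ L)
    (α : c →ₗ[ℝ] ℂ) : rootSpace c α →ₗ[ℂ] hC σ :=
  LinearMap.codRestrict (hC σ).toSubmodule
    ((LinearMap.id + (homC σ : Cx L →ₗ[ℂ] Cx L)) ∘ₗ (rootSpace c α).subtype)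
    (fun X => add_homC_mem_hC hσ X)

/-- `A_α = ∑ (Xᵢ + σ(Xᵢ)) ⊗ (Xᵢ + σ(Xᵢ)) ∈ 𝔥_ℂ ⊗ 𝔥_ℂ`, for a `B_σ`-orthonormal basis `Xᵢ` of
`𝔤_α`. -/
def tensorA {σ : L →ₗ⁅ℝ⁆ L} (hσ : ∀ X, σ (σ X) = X) (B : LinearMap.BilinForm ℝ L)
    (c : LieSubalgebra ℝ L) (α : c →ₗ[ℝ] ℂ) : hC σ ⊗[ℂ] hC σ :=
  TensorProduct.map (symmetrize hσ c α) (symmetrize hσ c α)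
    (canonicalTensor ((formSigma B σ).restrict (rootSpace c α)))

theorem tensorA_eq_sum {σ : L →ₗ⁅ℝ⁆ L} (hσ : ∀ X, σ (σ X) = X) (B : LinearMap.BilinForm ℝ L)
    (c : LieSubalgebra ℝ L) (α : c →ₗ[ℝ] ℂ) {ι : Type*} [Fintype ι] [DecidableEq ι]
    (X : Module.Basis ι ℂ (rootSpace c α))
    (hX : ∀ i j, formSigma B σ (X i : Cx L) (X j : Cx L) = if i = j then 1 else 0) :
    tensorA hσ B c α = ∑ i, symmetrize hσ c α (X i) ⊗ₜ[ℂ] symmetrize hσ c α (X i) := by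
  rw [tensorA, canonicalTensor_eq_sum _ X hX, map_sum]
  exact Finset.sum_congr rfl fun i _ => TensorProduct.map_tmul _ _ _ _

end Elements

/-! ### The target of the decompositions -/

/-- The relations `u Ad(t)(Y) ⊗ v = u ⊗ Y v` (`Y ∈ 𝔪'`) defining the balanced tensor product. As
`U(𝔪')` is generated by `𝔪'`, they imply `u Ad(t)(m) ⊗ v = u ⊗ m v` for all `m ∈ U(𝔪')`. -/
def balanceRelations (σ : L →ₗ⁅ℝ⁆ L) (c : LieSubalgebra ℝ L) (T : L →ₗ⁅ℝ⁆ L) :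
    Submodule ℂ (Uh σ ⊗[ℂ] Uh σ) :=
  Submodule.span ℂ {w | ∃ (u v : Uh σ) (Y Y' : mC σ c), (Y' : Cx L) = homC T (Y : Cx L) ∧
    w = (u * ιm σ c Y') ⊗ₜ[ℂ] v - u ⊗ₜ[ℂ] (ιm σ c Y * v)}

/-- `U(𝔥) ⊗_{U(𝔪')} U(𝔥)`, where the right action of `U(𝔪')` on the first factor is twisted by
`T = Ad(t)`. -/
abbrev BalancedTensor (σ : L →ₗ⁅ℝ⁆ L) (c : LieSubalgebra ℝ L) (T : L →ₗ⁅ℝ⁆ L) : Type _ :=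
  (Uh σ ⊗[ℂ] Uh σ) ⧸ balanceRelations σ c T

/-- `R ⊗ S(𝔠') ⊗ (U(𝔥) ⊗ U(𝔥))`. -/
abbrev FreeRadial (R : Type*) [CommRing R] [Algebra ℂ R] (σ : L →ₗ⁅ℝ⁆ L)
    (c : LieSubalgebra ℝ L) : Type _ :=
  R ⊗[ℂ] (Sc c ⊗[ℂ] (Uh σ ⊗[ℂ] Uh σ))

/-- `R ⊗ S(𝔠') ⊗ (U(𝔥) ⊗_{U(𝔪')} U(𝔥))`. -/
abbrev Radial (R : Type*) [CommRing R] [Algebra ℂ R] (σ : L →ₗ⁅ℝ⁆ L) (c : LieSubalgebra ℝ L)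
    (T : L →ₗ⁅ℝ⁆ L) : Type _ :=
  R ⊗[ℂ] (Sc c ⊗[ℂ] BalancedTensor σ c T)

/-- The quotient map. -/
def Radial.mk (R : Type*) [CommRing R] [Algebra ℂ R] (σ : L →ₗ⁅ℝ⁆ L) (c : LieSubalgebra ℝ L)
    (T : L →ₗ⁅ℝ⁆ L) : FreeRadial R σ c →ₗ[ℂ] Radial R σ c T :=
  TensorProduct.map LinearMap.id
    (TensorProduct.map LinearMap.id (balanceRelations σ c T).mkQ)

/-- The linear map `p ⊗ u ⊗ v ↦ A₁(u p) A₂(v)` with values in `U(𝔤_ℂ)`. -/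
def multiplyOut (σ : L →ₗ⁅ℝ⁆ L) (c : LieSubalgebra ℝ L) (A₁ A₂ : Ug L →ₐ[ℂ] Ug L) :
    Sc c ⊗[ℂ] (Uh σ ⊗[ℂ] Uh σ) →ₗ[ℂ] Ug L :=
  LinearMap.mul' ℂ (Ug L) ∘ₗ
    TensorProduct.map
      (A₁.toLinearMap ∘ₗ LinearMap.mul' ℂ (Ug L) ∘ₗ
        TensorProduct.map (inclU (hC σ)).toLinearMap (inclU (complexify c)).toLinearMap ∘ₗ
          (TensorProduct.comm ℂ (Sc c) (Uh σ)).toLinearMap)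
      (A₂.toLinearMap ∘ₗ (inclU (hC σ)).toLinearMap) ∘ₗ
    (TensorProduct.assoc ℂ (Sc c) (Uh σ) (Uh σ)).symm.toLinearMap

theorem multiplyOut_tmul (σ : L →ₗ⁅ℝ⁆ L) (c : LieSubalgebra ℝ L) (A₁ A₂ : Ug L →ₐ[ℂ] Ug L)
    (p : Sc c) (u v : Uh σ) :
    multiplyOut σ c A₁ A₂ (p ⊗ₜ[ℂ] (u ⊗ₜ[ℂ] v)) =
      A₁ (inclU (hC σ) u * inclU (complexify c) p) * A₂ (inclU (hC σ) v) := by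
  simp [multiplyOut]

/-- The linear map `f ⊗ p ⊗ u ⊗ v ↦ f(x) A₁(u p) A₂(v)`, where `f ↦ f(x)` is the given evaluation
homomorphism. -/
def evalRadial {R : Type*} [CommRing R] [Algebra ℂ R] (σ : L →ₗ⁅ℝ⁆ L) (c : LieSubalgebra ℝ L)
    (A₁ A₂ : Ug L →ₐ[ℂ] Ug L) (evx : R →ₐ[ℂ] ℂ) : FreeRadial R σ c →ₗ[ℂ] Ug L :=
  (TensorProduct.lid ℂ (Ug L)).toLinearMap ∘ₗ
    TensorProduct.map evx.toLinearMap (multiplyOut σ c A₁ A₂)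

theorem evalRadial_tmul {R : Type*} [CommRing R] [Algebra ℂ R] (σ : L →ₗ⁅ℝ⁆ L)
    (c : LieSubalgebra ℝ L) (A₁ A₂ : Ug L →ₐ[ℂ] Ug L) (evx : R →ₐ[ℂ] ℂ)
    (f : R) (p : Sc c) (u v : Uh σ) :
    evalRadial σ c A₁ A₂ evx (f ⊗ₜ[ℂ] (p ⊗ₜ[ℂ] (u ⊗ₜ[ℂ] v))) =
      evx f • (A₁ (inclU (hC σ) u * inclU (complexify c) p) * A₂ (inclU (hC σ) v)) := by
  simp [evalRadial, multiplyOut_tmul]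

/-- The class of `f ⊗ p ⊗ w`. -/
def Radial.term {R : Type*} [CommRing R] [Algebra ℂ R] {σ : L →ₗ⁅ℝ⁆ L} {c : LieSubalgebra ℝ L}
    (T : L →ₗ⁅ℝ⁆ L) (f : R) (p : Sc c) (w : Uh σ ⊗[ℂ] Uh σ) : Radial R σ c T :=
  Radial.mk R σ c T (f ⊗ₜ[ℂ] (p ⊗ₜ[ℂ] w))

/-- The element
`Ω_{𝔠'} + ∑ (n_α/2) coth_α C_α + Ω_{𝔪'}
  + ∑ (csch_α²/4) (m(A_α) ⊗ 1 + 1 ⊗ m(A_{τα}) + 2 (1 ⊗ φ) A_α) - ∑ (csch_{α/2}²/4) (1 ⊗ φ) A_α`,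
with sums over all roots `α` and `n_α = dim 𝔤_α`. The arguments `coth`, `csch`, `cschHalfSq` are the
functions `coth_α`, `csch_α`, `csch_{α/2}²`. -/
def casimirFormula [Module.Finite ℝ L] {R : Type*} [CommRing R] [Algebra ℂ R] {σ : L →ₗ⁅ℝ⁆ L}
    (hσ : ∀ X, σ (σ X) = X) (B : LinearMap.BilinForm ℝ L) (c : LieSubalgebra ℝ L)
    (T : L →ₗ⁅ℝ⁆ L) (φ : hC σ →ₗ[ℂ] hC σ) (τ : (c →ₗ[ℝ] ℂ) → (c →ₗ[ℝ] ℂ))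
    (coth csch cschHalfSq : (c →ₗ[ℝ] ℂ) → R) : Radial R σ c T :=
  let A : (c →ₗ[ℝ] ℂ) → Uh σ ⊗[ℂ] Uh σ := fun α =>
    TensorProduct.map (ιh σ) (ιh σ) (tensorA hσ B c α)
  let φA : (c →ₗ[ℝ] ℂ) → Uh σ ⊗[ℂ] Uh σ := fun α =>
    TensorProduct.map (ιh σ) (ιh σ ∘ₗ φ) (tensorA hσ B c α)
  let m : Uh σ ⊗[ℂ] Uh σ →ₗ[ℂ] Uh σ := LinearMap.mul' ℂ (Uh σ)
  Radial.term T 1 (casimirC B c) (1 ⊗ₜ[ℂ] 1)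
  + ∑ᶠ α ∈ roots c, ((Module.finrank ℂ (rootSpace c α) : ℂ) / 2) •
      Radial.term T (coth α) (UniversalEnvelopingAlgebra.ι ℂ (coroot B c α)) (1 ⊗ₜ[ℂ] 1)
  + Radial.term T 1 1 (casimirM σ B c ⊗ₜ[ℂ] 1)
  + ∑ᶠ α ∈ roots c, (1 / 4 : ℂ) •
      Radial.term T (csch α ^ 2) 1
        (m (A α) ⊗ₜ[ℂ] 1 + 1 ⊗ₜ[ℂ] m (A (τ α)) + (2 : ℂ) • φA α)
  - ∑ᶠ α ∈ roots c, (1 / 4 : ℂ) • Radial.term T (cschHalfSq α) 1 (φA α)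

/-- The technical condition on `T = Ad(t)`: it leaves `𝔠'` invariant, and there is an involution
`φ ∈ O(𝔤_ℂ, B)` commuting with `σ` with `Ad(t)(X) = ε_α φ(X)` on each `𝔤_α` (including `α = 0`;
the values of `ε` outside the set of weights play no role). -/
structure TechnicalCondition (σ : L →ₗ⁅ℝ⁆ L) (B : LinearMap.BilinForm ℝ L)
    (c : LieSubalgebra ℝ L) (T : L →ₗ⁅ℝ⁆ L) (φ : Cx L →ₗ[ℂ] Cx L)
    (ε : (c →ₗ[ℝ] ℂ) → ℂˣ) : Prop where
  mapsTo : ∀ X ∈ c, T X ∈ c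
  involutive : ∀ X, φ (φ X) = X
  orthogonal : ∀ X Y, formC B (φ X) (φ Y) = formC B X Y
  commutes : ∀ X, φ (homC σ X) = homC σ (φ X)
  eq_smul : ∀ α : c →ₗ[ℝ] ℂ, ∀ X ∈ rootSpace c α, homC T X = (ε α : ℂ) • φ X

/-- The action `α ↦ tα = α ∘ Ad(t)` on `(𝔠'_ℂ)^*` (recall that `Ad(t)` is an involution of `𝔠'`). -/
def TechnicalCondition.dualAction {σ : L →ₗ⁅ℝ⁆ L} {B : LinearMap.BilinForm ℝ L}
    {c : LieSubalgebra ℝ L} {T : L →ₗ⁅ℝ⁆ L} {φ : Cx L →ₗ[ℂ] Cx L} {ε : (c →ₗ[ℝ] ℂ) → ℂˣ}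
    (h : TechnicalCondition σ B c T φ ε) (α : c →ₗ[ℝ] ℂ) : c →ₗ[ℝ] ℂ :=
  α ∘ₗ (T : L →ₗ[ℝ] L).restrict (p := c.toSubmodule) (q := c.toSubmodule) h.mapsTo

/-- The restriction of `φ` to `𝔥_ℂ`. -/
def TechnicalCondition.restrictPhi {σ : L →ₗ⁅ℝ⁆ L} {B : LinearMap.BilinForm ℝ L}
    {c : LieSubalgebra ℝ L} {T : L →ₗ⁅ℝ⁆ L} {φ : Cx L →ₗ[ℂ] Cx L} {ε : (c →ₗ[ℝ] ℂ) → ℂˣ}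
    (h : TechnicalCondition σ B c T φ ε) (hσ : ∀ X, σ (σ X) = X) : hC σ →ₗ[ℂ] hC σ :=
  φ.restrict (p := (hC σ).toSubmodule) (q := (hC σ).toSubmodule) fun X hX =>
    (mem_hC_iff hσ _).mpr (by rw [← h.commutes, (mem_hC_iff hσ X).mp hX])

end Algebra

/-! ### Lie groups -/

section LieGroups

open VectorField

instance : ENat.LEInfty (minSmoothness ℝ 3) := ⟨by
  rw [minSmoothness_of_isRCLikeNormedField]; exact ENat.LEInfty.out⟩

/-- Automorphisms of the Lie group `G`. -/
structure SmoothAut (n : ℕ) (G : Type*) [TopologicalSpace G]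
    [ChartedSpace (EuclideanSpace ℝ (Fin n)) G] [Group G] extends G ≃* G where
  contMDiff_toFun : ContMDiff (𝓡 n) (𝓡 n) ∞ toFun
  contMDiff_invFun : ContMDiff (𝓡 n) (𝓡 n) ∞ invFun

theorem SmoothAut.isInvertible_mfderiv {n : ℕ} {G : Type*} [TopologicalSpace G]
    [ChartedSpace (EuclideanSpace ℝ (Fin n)) G] [Group G] (f : SmoothAut n G) (g : G) :
    (mfderiv (𝓡 n) (𝓡 n) f.toMulEquiv g).IsInvertible := by
  let Φ : G ≃ₘ^∞⟮𝓡 n, 𝓡 n⟯ G :=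
    { toEquiv := f.toMulEquiv.toEquiv
      contMDiff_toFun := f.contMDiff_toFun
      contMDiff_invFun := f.contMDiff_invFun }
  exact ⟨Φ.mfderivToContinuousLinearEquiv (by simp) (x := g), rfl⟩

variable {n : ℕ} {G : Type*} [TopologicalSpace G] [ChartedSpace (EuclideanSpace ℝ (Fin n)) G]
  [Group G] [LieGroup (𝓡 n) ∞ G]

/-- The Lie algebra of `G`. -/
abbrev LieAlg (n : ℕ) (G : Type*) [TopologicalSpace G]
    [ChartedSpace (EuclideanSpace ℝ (Fin n)) G] [Group G] : Type := GroupLieAlgebra (𝓡 n) G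

instance : Module.Finite ℝ (LieAlg n G) :=
  inferInstanceAs (Module.Finite ℝ (EuclideanSpace ℝ (Fin n)))

/-- An automorphism relates the left-invariant fields of `X` and of its image. -/
theorem SmoothAut.mpullback_eq (f : SmoothAut n G) (X : LieAlg n G) :
    mpullback (𝓡 n) (𝓡 n) f.toMulEquiv (mulInvariantVectorField (I := 𝓡 n) (G := G)
      (mfderiv (𝓡 n) (𝓡 n) f.toMulEquiv (1 : G) X : EuclideanSpace ℝ (Fin n))) =
    mulInvariantVectorField (I := 𝓡 n) (G := G) X := by
  have hf : MDifferentiable (𝓡 n) (𝓡 n) f.toMulEquiv :=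
    f.contMDiff_toFun.mdifferentiable (by simp)
  have hL : ∀ a : G, MDifferentiable (𝓡 n) (𝓡 n) (fun b : G => a * b) := fun a =>
    (contMDiff_mul_left (I := 𝓡 n) (n := ∞)).mdifferentiable (by simp)
  let D : (G → G) → G → EuclideanSpace ℝ (Fin n) → EuclideanSpace ℝ (Fin n) :=
    fun F x v => mfderiv (𝓡 n) (𝓡 n) F x v
  funext g
  have e1 : (fun b => f.toMulEquiv g * b) ∘ f.toMulEquiv =
      f.toMulEquiv ∘ (fun b => g * b) := by
    funext b; simp
  have e2 : D ((fun b => f.toMulEquiv g * b) ∘ f.toMulEquiv) 1 X =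
      D (f.toMulEquiv ∘ (fun b => g * b)) 1 X := by rw [e1]
  have e3 : D ((fun b => f.toMulEquiv g * b) ∘ f.toMulEquiv) 1 X =
      D (fun b => f.toMulEquiv g * b) (f.toMulEquiv 1) (D f.toMulEquiv 1 X) :=
    mfderiv_comp_apply (I' := 𝓡 n) 1 (hL _ _) (hf _) X
  have e4 : D (f.toMulEquiv ∘ (fun b => g * b)) 1 X =
      D f.toMulEquiv (g * 1) (D (fun b => g * b) 1 X) :=
    mfderiv_comp_apply (I' := 𝓡 n) 1 (hf _) (hL _ _) X
  rw [e3, e4, map_one, mul_one] at e2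
  have e5 : (mfderiv (𝓡 n) (𝓡 n) f.toMulEquiv g).inverse
      (mfderiv (𝓡 n) (𝓡 n) f.toMulEquiv g (mfderiv (𝓡 n) (𝓡 n) (fun b => g * b) (1 : G) X)) =
      mfderiv (𝓡 n) (𝓡 n) (fun b => g * b) (1 : G) X :=
    (f.isInvertible_mfderiv g).inverse_apply_eq.mpr rfl
  exact (congrArg (mfderiv (𝓡 n) (𝓡 n) f.toMulEquiv g).inverse e2).trans e5

/-- The differential at `1` of an automorphism of `G`. -/
def SmoothAut.differential (f : SmoothAut n G) : LieAlg n G →ₗ⁅ℝ⁆ LieAlg n G :=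
  { toFun := fun X => (mfderiv (𝓡 n) (𝓡 n) f.toMulEquiv (1 : G) X : EuclideanSpace ℝ (Fin n))
    map_add' := fun X Y => map_add (mfderiv (𝓡 n) (𝓡 n) f.toMulEquiv (1 : G)) X Y
    map_smul' := fun r X => map_smul (mfderiv (𝓡 n) (𝓡 n) f.toMulEquiv (1 : G)) r X
    map_lie' := by
      intro X Y
      let X' : LieAlg n G := (mfderiv (𝓡 n) (𝓡 n) f.toMulEquiv (1 : G) X : EuclideanSpace ℝ (Fin n))
      let Y' : LieAlg n G := (mfderiv (𝓡 n) (𝓡 n) f.toMulEquiv (1 : G) Y : EuclideanSpace ℝ (Fin n))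
      let Z : G → EuclideanSpace ℝ (Fin n) := fun x => mlieBracket (𝓡 n)
        (mulInvariantVectorField (I := 𝓡 n) (G := G) X')
        (mulInvariantVectorField (I := 𝓡 n) (G := G) Y') x
      have h1 := mpullback_mlieBracket (I := 𝓡 n) (I' := 𝓡 n) (n := ∞) (x₀ := (1 : G))
        (f := f.toMulEquiv)
        (V := mulInvariantVectorField (I := 𝓡 n) (G := G) X')
        (W := mulInvariantVectorField (I := 𝓡 n) (G := G) Y')
        (mdifferentiableAt_mulInvariantVectorField X')
        (mdifferentiableAt_mulInvariantVectorField Y')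
        (f.contMDiff_toFun 1)
        (by rw [minSmoothness_of_isRCLikeNormedField]; exact ENat.LEInfty.out)
      rw [f.mpullback_eq X, f.mpullback_eq Y] at h1
      have h2 : mfderiv (𝓡 n) (𝓡 n) f.toMulEquiv (1 : G) ⁅X, Y⁆ = Z (f.toMulEquiv 1) :=
        ((f.isInvertible_mfderiv 1).inverse_apply_eq.mp h1).symm
      refine h2.trans ?_
      rw [map_one]
      rfl }

/-- Conjugation by `g`. -/
def conjAut (n : ℕ) {G : Type*} [TopologicalSpace G]
    [ChartedSpace (EuclideanSpace ℝ (Fin n)) G] [Group G] [LieGroup (𝓡 n) ∞ G] (g : G) :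
    SmoothAut n G where
  toMulEquiv := MulAut.conj g
  contMDiff_toFun := by
    change ContMDiff (𝓡 n) (𝓡 n) ∞ fun h => g * h * g⁻¹
    exact (contMDiff_const.mul contMDiff_id).mul contMDiff_const
  contMDiff_invFun := by
    change ContMDiff (𝓡 n) (𝓡 n) ∞ fun h => g⁻¹ * h * g
    exact (contMDiff_const.mul contMDiff_id).mul contMDiff_const

/-- The adjoint representation. -/
def Ad (n : ℕ) {G : Type*} [TopologicalSpace G]
    [ChartedSpace (EuclideanSpace ℝ (Fin n)) G] [Group G] [LieGroup (𝓡 n) ∞ G] (g : G) :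
    LieAlg n G →ₗ⁅ℝ⁆ LieAlg n G :=
  (conjAut n g).differential

/-- `γ` is a one-parameter subgroup of `G` with initial velocity `X`. -/
def IsOneParameterSubgroup (γ : ℝ → G) (X : LieAlg n G) : Prop :=
  (∀ r s, γ (r + s) = γ r * γ s) ∧ ContMDiff 𝓘(ℝ, ℝ) (𝓡 n) ∞ γ ∧
    (mfderiv 𝓘(ℝ, ℝ) (𝓡 n) γ 0 (1 : ℝ) : EuclideanSpace ℝ (Fin n)) = X

open Classical in
/-- The exponential map: `exp X = γ 1` for the one-parameter subgroup `γ` with initial velocity `X`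
(which always exists and is unique). -/
def lieExp (X : LieAlg n G) : G :=
  if h : ∃ γ : ℝ → G, IsOneParameterSubgroup γ X then h.choose 1 else 1

/-- The exponential of an endomorphism of a finite-dimensional complex vector space. -/
def expEnd {V : Type*} [AddCommGroup V] [Module ℂ V] [Module.Finite ℂ V] (f : Module.End ℂ V) :
    Module.End ℂ V :=
  let b := Module.finBasis ℂ V
  Matrix.toLin b b (NormedSpace.exp (LinearMap.toMatrix b b f))

/-- `Int(𝔤_ℂ)`: the group generated by the `exp(ad X)`, `X ∈ 𝔤_ℂ`. -/
def innerAutomorphisms (L : Type*) [LieRing L] [LieAlgebra ℝ L] [Module.Finite ℝ L] :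
    Submonoid (Module.End ℂ (Cx L)) :=
  Submonoid.closure (Set.range fun X : Cx L => expEnd (LieAlgebra.ad ℂ (Cx L) X))

/-- `(G, K, θ, B)` is a reductive Lie group: `K` is a compact subgroup, `θ` is an involution of
`𝔤`, and `B` is a nondegenerate symmetric bilinear form on `𝔤`, invariant under `Ad(G)` and `θ`, with
the following properties. -/
structure IsReductiveLieGroup (K : Subgroup G) (θ : LieAlg n G →ₗ⁅ℝ⁆ LieAlg n G)
    (B : LinearMap.BilinForm ℝ (LieAlg n G)) : Prop where
  isCompact : IsCompact (K : Set G)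
  theta_involutive : ∀ X, θ (θ X) = X
  symm : B.IsSymm
  nondegenerate : B.Nondegenerate
  ad_invariant : ∀ (g : G) X Y, B (Ad n g X) (Ad n g Y) = B X Y
  theta_invariant : ∀ X Y, B (θ X) (θ Y) = B X Y
  /-- `𝔤` is reductive: every ideal has a complementary ideal. -/
  reductive : ComplementedLattice (LieIdeal ℝ (LieAlg n G))
  /-- The `+1`-eigenspace `𝔨` of `θ` is the Lie algebra of `K`. -/
  mem_k_iff : ∀ X, θ X = X ↔ ∀ s : ℝ, lieExp (s • X) ∈ K
  /-- `𝔨` and the `-1`-eigenspace `𝔭` of `θ` are orthogonal. -/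
  orthogonal : ∀ X Y, θ X = X → θ Y = -Y → B X Y = 0
  pos_def : ∀ X, θ X = -X → X ≠ 0 → 0 < B X X
  neg_def : ∀ X, θ X = X → X ≠ 0 → B X X < 0
  /-- `K × 𝔭 → G`, `(k, X) ↦ k exp(X)` is a diffeomorphism, with inverse `g ↦ (κ g, ξ g)`. -/
  cartan : ∃ (κ : G → G) (ξ : G → EuclideanSpace ℝ (Fin n)),
    ContMDiff (𝓡 n) (𝓡 n) ∞ κ ∧ ContMDiff (𝓡 n) 𝓘(ℝ, EuclideanSpace ℝ (Fin n)) ∞ ξ ∧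
    (∀ g, κ g ∈ K ∧ θ (ξ g : LieAlg n G) = -(ξ g : LieAlg n G) ∧
      κ g * lieExp (ξ g : LieAlg n G) = g) ∧
    (∀ k ∈ K, ∀ X : LieAlg n G, θ X = -X → κ (k * lieExp X) = k ∧ ξ (k * lieExp X) = X)
  /-- Every `Ad(g)` acts on `𝔤_ℂ` by an inner automorphism. -/
  inner : ∀ g : G, (homC (Ad n g) : Module.End ℂ (Cx (LieAlg n G))) ∈
    innerAutomorphisms (LieAlg n G)

/-- `(G, H)` is a symmetric pair with respect to the involution `σ`: `(G^σ)_0 ≤ H ≤ G^σ` and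
`H G_0 H = G`. The Lie algebra of `H` is then `𝔥 = 𝔤^σ`. -/
structure IsSymmetricPair (σ : SmoothAut n G) (H : Subgroup G) : Prop where
  involutive : ∀ g, σ.toMulEquiv (σ.toMulEquiv g) = g
  le_fixed : ∀ h ∈ H, σ.toMulEquiv h = h
  component_le : connectedComponentIn {g : G | σ.toMulEquiv g = g} 1 ⊆ (H : Set G)
  double_coset : ∀ g : G, ∃ h ∈ H, ∃ g₀ ∈ connectedComponent (1 : G), ∃ h' ∈ H, g = h * g₀ * h'

theorem IsSymmetricPair.differential_involutive {σ : SmoothAut n G} {H : Subgroup G}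
    (h : IsSymmetricPair σ H) (X : LieAlg n G) : σ.differential (σ.differential X) = X := by
  let D : (G → G) → G → EuclideanSpace ℝ (Fin n) → EuclideanSpace ℝ (Fin n) :=
    fun F x v => mfderiv (𝓡 n) (𝓡 n) F x v
  have hf : MDifferentiable (𝓡 n) (𝓡 n) σ.toMulEquiv :=
    σ.contMDiff_toFun.mdifferentiable (by simp)
  have e1 : D (σ.toMulEquiv ∘ σ.toMulEquiv) 1 X =
      D σ.toMulEquiv (σ.toMulEquiv 1) (D σ.toMulEquiv 1 X) :=
    mfderiv_comp_apply (I' := 𝓡 n) 1 (hf _) (hf _) X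
  have e2 : σ.toMulEquiv ∘ σ.toMulEquiv = id := funext h.involutive
  have e3 : D id 1 X = X := by
    change mfderiv (𝓡 n) (𝓡 n) id (1 : G) X = X
    rw [mfderiv_id]; rfl
  rw [e2, e3, map_one] at e1
  exact e1.symm

/-- A subspace is commutative. -/
def IsCommSubspace {L : Type*} [LieRing L] [LieAlgebra ℝ L] (V : Submodule ℝ L) : Prop :=
  ∀ X ∈ V, ∀ Y ∈ V, ⁅X, Y⁆ = 0

/-- `𝔱` is maximal commutative in `𝔨^{-σ}`, and `𝔠 = 𝔱 ⊕ 𝔞` with `𝔞 ≤ 𝔭` is maximal commutative in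
`𝔤^{-σ}`. (Any maximal commutative subspace of `𝔤^{-σ}` containing `𝔱` is of this form.) These data
define the fundamental Cartan subset `exp(𝔠) = exp(𝔞) T`, `T = exp(𝔱)`. -/
structure IsFundamentalCartan {L : Type*} [LieRing L] [LieAlgebra ℝ L] (θ σ : L →ₗ⁅ℝ⁆ L)
    (t a : Submodule ℝ L) : Prop where
  maximal_t : Maximal (fun V => V ≤ LinearMap.ker ((θ : L →ₗ[ℝ] L) - LinearMap.id) ⊓ antiFixed σ ∧
    IsCommSubspace V) t
  le_p : a ≤ antiFixed θ
  maximal_c : Maximal (fun V => V ≤ antiFixed σ ∧ IsCommSubspace V) (t ⊔ a)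

/-- `exp(𝔠') t₀` is a standard Cartan subset with respect to the fundamental Cartan subset given by
`𝔱`, `𝔞`. -/
structure IsStandardCartan (θ σ : LieAlg n G →ₗ⁅ℝ⁆ LieAlg n G) (t a : Submodule ℝ (LieAlg n G))
    (c' : LieSubalgebra ℝ (LieAlg n G)) (t₀ : G) : Prop where
  mem_T : ∃ X ∈ t, lieExp X = t₀
  le_inf : c'.toSubmodule ≤ antiFixed σ ⊓
    (antiFixed σ).map (Ad n t₀ : LieAlg n G →ₗ[ℝ] LieAlg n G)
  comm : IsCommSubspace c'.toSubmodule
  decomposition : ∃ t' a' : Submodule ℝ (LieAlg n G),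
    t' ≤ t ∧ a ≤ a' ∧ a' ≤ antiFixed θ ∧ c'.toSubmodule = t' ⊔ a'
  finrank_eq : Module.finrank ℝ c' = Module.finrank ℝ (t ⊔ a : Submodule ℝ (LieAlg n G))

/-- The set `G_rs` of regular semisimple elements: `σ Ad(g) σ Ad(g)⁻¹` is semisimple and
`𝔤^{-σ} ∩ Ad(g)(𝔤^{-σ})` is commutative. -/
def regularSemisimple (σ : LieAlg n G →ₗ⁅ℝ⁆ LieAlg n G) : Set G :=
  {g | Module.End.IsSemisimple
      (((σ.comp (Ad n g)).comp (σ.comp (Ad n g⁻¹)) : LieAlg n G →ₗ⁅ℝ⁆ LieAlg n G) :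
        Module.End ℝ (LieAlg n G)) ∧
    IsCommSubspace (antiFixed σ ⊓
      (antiFixed σ).map (Ad n g : LieAlg n G →ₗ[ℝ] LieAlg n G))}

/-- `C' ∩ G_rs`, where `C' = exp(𝔠') t₀`. -/
def regularPart (σ : LieAlg n G →ₗ⁅ℝ⁆ LieAlg n G) (c' : LieSubalgebra ℝ (LieAlg n G)) (t₀ : G) :
    Set G :=
  {x | (∃ X ∈ c', lieExp X * t₀ = x) ∧ x ∈ regularSemisimple σ}

theorem mem_regularPart {σ : LieAlg n G →ₗ⁅ℝ⁆ LieAlg n G} {c' : LieSubalgebra ℝ (LieAlg n G)}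
    {t₀ : G} (X : c') (hX : lieExp (X : LieAlg n G) * t₀ ∈ regularSemisimple σ) :
    lieExp (X : LieAlg n G) * t₀ ∈ regularPart σ c' t₀ :=
  ⟨⟨X, X.2, rfl⟩, hX⟩

/-- The point of `𝔠'` with coordinates `y` in some basis. -/
def coordPoint (c' : LieSubalgebra ℝ (LieAlg n G)) (y : Fin (Module.finrank ℝ c') → ℝ) : c' :=
  (Module.finBasis ℝ c').equivFun.symm y

/-- `C^∞(C' ∩ G_rs)`: the complex functions `f` on `C' ∩ G_rs` for which `X ↦ f(exp(X) t₀)` is smooth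
on the set of all `X ∈ 𝔠'` (in linear coordinates) with `exp(X) t₀ ∈ G_rs`. -/
def smoothFunctions (σ : LieAlg n G →ₗ⁅ℝ⁆ LieAlg n G) (c' : LieSubalgebra ℝ (LieAlg n G))
    (t₀ : G) : Subalgebra ℂ (regularPart σ c' t₀ → ℂ) where
  carrier := {f | ∃ F : (Fin (Module.finrank ℝ c') → ℝ) → ℂ,
    ContDiffOn ℝ ∞ F {y | lieExp (coordPoint c' y : LieAlg n G) * t₀ ∈ regularSemisimple σ} ∧
    ∀ y (hy : lieExp (coordPoint c' y : LieAlg n G) * t₀ ∈ regularSemisimple σ),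
      F y = f ⟨_, mem_regularPart (coordPoint c' y) hy⟩}
  mul_mem' := by
    rintro f g ⟨F, hF, hF'⟩ ⟨F₂, hF₂, hF₂'⟩
    exact ⟨F * F₂, hF.mul hF₂, fun y hy => by simp [hF' y hy, hF₂' y hy]⟩
  add_mem' := by
    rintro f g ⟨F, hF, hF'⟩ ⟨F₂, hF₂, hF₂'⟩
    exact ⟨F + F₂, hF.add hF₂, fun y hy => by simp [hF' y hy, hF₂' y hy]⟩
  algebraMap_mem' r := ⟨fun _ => r, contDiffOn_const, fun _ _ => rfl⟩

/-- Evaluation at a point `x`. -/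
def evalAt {σ : LieAlg n G →ₗ⁅ℝ⁆ LieAlg n G} {c' : LieSubalgebra ℝ (LieAlg n G)} {t₀ : G}
    (x : regularPart σ c' t₀) : smoothFunctions σ c' t₀ →ₐ[ℂ] ℂ :=
  (Pi.evalAlgHom ℂ (fun _ : regularPart σ c' t₀ => ℂ) x).comp (smoothFunctions σ c' t₀).val

/-- `C^∞(C' ∩ G_rs) ⊗ S(𝔠') ⊗ (U(𝔥) ⊗_{U(𝔪')} U(𝔥))`. -/
abbrev RadialSpace (σ : LieAlg n G →ₗ⁅ℝ⁆ LieAlg n G) (c' : LieSubalgebra ℝ (LieAlg n G))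
    (t₀ : G) : Type _ :=
  Radial (smoothFunctions σ c' t₀) σ c' (Ad n t₀)

/-- `F = Π(q)`: whenever `F = ∑ fᵢ ⊗ pᵢ ⊗ uᵢ ⊗ vᵢ`, one has `q = ∑ fᵢ(x) Ad(x⁻¹)(uᵢ pᵢ) vᵢ` for all
`x ∈ C' ∩ G_rs`. -/
def IsPi {σ : LieAlg n G →ₗ⁅ℝ⁆ LieAlg n G} {c' : LieSubalgebra ℝ (LieAlg n G)} {t₀ : G}
    (q : Ug (LieAlg n G)) (F : RadialSpace σ c' t₀) : Prop :=
  ∀ F' : FreeRadial (smoothFunctions σ c' t₀) σ c',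
    Radial.mk (smoothFunctions σ c' t₀) σ c' (Ad n t₀) F' = F →
    ∀ x : regularPart σ c' t₀,
      evalRadial σ c' (mapU (Ad n (x : G)⁻¹)) (AlgHom.id ℂ _) (evalAt x) F' = q

/-- `F = Π̃(q)`: whenever `F = ∑ fᵢ ⊗ pᵢ ⊗ uᵢ ⊗ vᵢ`, one has `q = ∑ fᵢ(x) uᵢ pᵢ Ad(x)(vᵢ)` for all
`x ∈ C' ∩ G_rs`. -/
def IsPiTilde {σ : LieAlg n G →ₗ⁅ℝ⁆ LieAlg n G} {c' : LieSubalgebra ℝ (LieAlg n G)} {t₀ : G}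
    (q : Ug (LieAlg n G)) (F : RadialSpace σ c' t₀) : Prop :=
  ∀ F' : FreeRadial (smoothFunctions σ c' t₀) σ c',
    Radial.mk (smoothFunctions σ c' t₀) σ c' (Ad n t₀) F' = F →
    ∀ x : regularPart σ c' t₀,
      evalRadial σ c' (AlgHom.id ℂ _) (mapU (Ad n (x : G))) (evalAt x) F' = q

/-- `x^α = ε_α exp(α(X))` for `x = exp(X) t₀`. -/
def rootPower {L : Type*} [LieRing L] [LieAlgebra ℝ L] {c' : LieSubalgebra ℝ L}
    (ε : (c' →ₗ[ℝ] ℂ) → ℂˣ) (α : c' →ₗ[ℝ] ℂ) (X : c') : ℂ :=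
  ε α * Complex.exp (α X)

end LieGroups

end

end CasimirRadial

open CasimirRadial

/-!
The formula for the radial part of the Casimir element holds for an algebraic reason at each point
`x = exp(X) t` of `C' ∩ G_rs`, and it determines the radial part by the Poincaré–Birkhoff–Witt theorem.

*Structure of `𝔤_ℂ`.* The elements of `𝔠'` act semisimply, since `𝔠' = 𝔱' ⊕ 𝔞'` with `𝔱' ≤ 𝔨` and
`𝔞' ≤ 𝔭`, so `𝔤_ℂ` is the sum of its root spaces (`iSup_rootSpace_eq_top`). The existence of
one-parameter subgroups and `d/ds Ad(exp(sX)) = Ad(exp(sX)) ad X` show that `Ad(exp X)` acts on `𝔤_α` by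
`exp(α(X))` (`homC_Ad_lieExp`), and `t ∈ exp(𝔱)` gives `Ad(t) σ Ad(t) = σ`. Therefore `Ad(x) φ` acts on
`𝔤_α` by `x^α` (`RadialData.point_phi`). As `𝔤^{-σ} ∩ Ad(x) 𝔤^{-σ}` is commutative and contains `𝔠'`,
`x^α ≠ x^{-α}` for every root (`RadialData.rootPower_ne`).

*`𝔠'` is its own centraliser in `𝔤^{-σ}`* if `C' ∩ G_rs` is not empty (`mem_of_centralizes`). The
centraliser is commutative, as it lies in `𝔤^{-σ} ∩ Ad(x) 𝔤^{-σ}`, and `θ`-stable. In the compact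
dual Lie algebra `𝔨 ⊕ i𝔭` it is a flat subspace, and the fundamental Cartan subspace is a maximal flat
subspace, so a conjugacy argument with a compact group bounds the dimension (`finrank_flat_le`). Hence
`𝔤_0 = 𝔠'_ℂ ⊕ 𝔪'_ℂ`.

*Evaluation of the formula.* The tensor of the form `B` splits into those of `𝔠'` and `𝔪'` and
`-∑ Xᵢ ⊗ σ Xᵢ` over orthonormal bases of the root spaces (`RadialData.canonicalTensor_eq`). For
`Y = X + σ X` and `Z = Ad(x) φ Y = x^α X + x^{-α} σ X` the product `X · σ X` is a combination of `Y²`,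
`Z²`, `Y Z` and `[X, σ X]` (`neg_mul_eq`), with the hyperbolic functions as coefficients, and
`∑ [Xᵢ, σ Xᵢ] = -n_α C_α`. This is `RadialData.radialEval_casimirFormula`. As `Ad(x)` fixes the Casimir
element (`mapU_casimir`), it has the same radial part for both multiplication maps.

*Uniqueness.* If `𝔮` is a complement of `𝔪'_ℂ` in `𝔥_ℂ`, then `𝔥_ℂ`, `𝔠'_ℂ` and `Ad(x) 𝔮` are linearly
independent (`RadialData.mem_mC_of_point_mem`). By Poincaré–Birkhoff–Witt a basis of
`S(𝔠') ⊗ (U(𝔥) ⊗_{U(𝔪')} U(𝔥))` is mapped to linearly independent ordered monomials at every regular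
point, so an element is determined by its values (`eq_zero_of_eval_eq_zero`). The independence of
monomials (`linearIndependent_monomials`) is only needed for Lie algebras whose centre meets the
derived algebra trivially. These have a faithful action by derivations of a polynomial ring, and the
monomials are separated by their action on powers of a single polynomial.
-/

namespace CasimirRadial

noncomputable section

attribute [local instance 100] LieRing.ofAssociativeRing

/-! ### Linear independence of ordered monomials in an enveloping algebra -/

section PBW

variable {k : Type*} [Field k]

/-- Derivations lower the adic filtration of an ideal by one. -/
theorem derivation_mem_pow {R : Type*} [CommRing R] [Algebra k R] (I : Ideal R)
    (D : Derivation k R R) (m : ℕ) {w : R} (hw : w ∈ I ^ (m + 1)) : D w ∈ I ^ m := by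
  induction m generalizing w with
  | zero => simp
  | succ m ih =>
    rw [pow_succ] at hw
    refine Submodule.mul_induction_on hw (fun a ha b hb => ?_) (fun a b ha hb => ?_)
    · rw [Derivation.leibniz, smul_eq_mul, smul_eq_mul]
      refine add_mem (Ideal.mul_mem_right _ _ ha) ?_
      rw [mul_comm, pow_succ]
      exact Ideal.mul_mem_mul (ih ha) hb
    · rw [map_add]; exact add_mem ha hb

/-- A product of `r` derivations applied to `f ^ (m + r)`, for `f` in the kernel of a character:
only the term in which every derivation hits a different factor `f` is of lowest order. -/
theorem derivations_pow_sub_mem {R : Type*} [CommRing R] [Algebra k R] (ev : R →ₐ[k] k)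
    {f : R} (hf : ev f = 0) (l : List (Derivation k R R)) (m : ℕ) :
    (l.map fun D => (D : R →ₗ[k] R)).foldr (fun D w => D w) (f ^ (m + l.length)) -
      algebraMap k R (((m + l.length).descFactorial l.length : k) * (l.map fun D => ev (D f)).prod) *
        f ^ m ∈ RingHom.ker ev ^ (m + 1) := by
  have hfI : f ∈ RingHom.ker ev := hf
  induction l generalizing m with
  | nil => simp
  | cons D l ih =>
    have h := derivation_mem_pow _ D _ (ih (m + 1))
    set w := (l.map fun D => (D : R →ₗ[k] R)).foldr (fun D w => D w) (f ^ (m + 1 + l.length)) with hw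
    set P := (l.map fun D => ev (D f)).prod with hP
    have e1 : m + (D :: l).length = m + 1 + l.length := by simp; ring
    have e2 : ((D :: l).map fun D => (D : R →ₗ[k] R)).foldr (fun D w => D w)
        (f ^ (m + (D :: l).length)) = D w := by rw [e1]; rfl
    rw [e2]
    rw [map_sub, Derivation.leibniz, Derivation.map_algebraMap, smul_zero, add_zero,
      Derivation.leibniz_pow] at h
    have e3 : (D :: l).length = l.length + 1 := rfl
    have e4 : (m + 1 + l.length) - l.length = m + 1 := by omega
    rw [e1, e3, Nat.descFactorial_succ, e4, List.map_cons, List.prod_cons, ← hP]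
    have h2 : algebraMap k R (((m + 1 + l.length).descFactorial l.length : k) * P) *
        (((m + 1 : ℕ) : R) * (f ^ m * (D f - algebraMap k R (ev (D f))))) ∈
        RingHom.ker ev ^ (m + 1) := by
      refine Ideal.mul_mem_left _ _ (Ideal.mul_mem_left _ _ ?_)
      rw [pow_succ]
      refine Ideal.mul_mem_mul (Ideal.pow_mem_pow hfI m) ?_
      rw [RingHom.mem_ker, map_sub, AlgHom.commutes]
      simp
    have := add_mem h h2
    convert this using 1
    simp only [smul_eq_mul, nsmul_eq_mul, map_mul, Nat.cast_mul, map_natCast, Nat.add_sub_cancel]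
    push_cast
    ring

variable {g : Type*} [LieRing g] [LieAlgebra k g]

/-- The action of `U(g)` on a commutative algebra on which `g` acts by derivations. -/
def derivationAction {R : Type*} [CommRing R] [Algebra k R] (ρ : g →ₗ⁅k⁆ Derivation k R R) :
    UniversalEnvelopingAlgebra k g →ₐ[k] Module.End k R :=
  UniversalEnvelopingAlgebra.lift k
    { toFun := fun X => (ρ X : R →ₗ[k] R)
      map_add' := fun X Y => by rw [map_add]; rfl
      map_smul' := fun r X => by rw [map_smul]; rfl
      map_lie' := fun {X Y} => by
        rw [LieHom.map_lie, Derivation.commutator_coe_linear_map] }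

/-- A monomial acts by applying the derivations of its factors from right to left. -/
theorem derivationAction_prod {R : Type*} [CommRing R] [Algebra k R]
    (ρ : g →ₗ⁅k⁆ Derivation k R R) (l : List g) (f : R) :
    derivationAction ρ (l.map (UniversalEnvelopingAlgebra.ι k)).prod f =
      ((l.map ρ).map fun D => (D : R →ₗ[k] R)).foldr (fun D w => D w) f := by
  induction l with
  | nil => simp
  | cons X l ih =>
    simp only [List.map_cons, List.prod_cons, map_mul, Module.End.mul_apply, ih]
    rw [derivationAction, UniversalEnvelopingAlgebra.lift_ι_apply]
    rfl

/-- The symbol of a product of `r` elements of `g`, evaluated at the functional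
`X ↦ ev (ρ X f)`, is read off from the action on `f ^ r`. -/
theorem ev_derivationAction_prod {R : Type*} [CommRing R] [Algebra k R]
    (ρ : g →ₗ⁅k⁆ Derivation k R R) (ev : R →ₐ[k] k) {f : R} (hf : ev f = 0) (l : List g) (N : ℕ)
    (hN : l.length ≤ N) :
    ev (derivationAction ρ (l.map (UniversalEnvelopingAlgebra.ι k)).prod (f ^ N)) =
      if l.length = N then (N.factorial : k) * (l.map fun X => ev (ρ X f)).prod else 0 := by
  obtain ⟨m, rfl⟩ := Nat.exists_eq_add_of_le' hN
  have h := derivations_pow_sub_mem ev hf (l.map ρ) m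
  have h1 : ∀ w ∈ RingHom.ker ev ^ (m + 1), ev w = 0 := fun w hw =>
    (RingHom.mem_ker).mp (Ideal.pow_le_self (by omega) hw)
  have h2 := h1 _ h
  rw [derivationAction_prod]
  rw [List.length_map] at h2
  rw [map_sub, sub_eq_zero, map_mul, AlgHom.commutes, map_pow, hf] at h2
  rw [h2]
  rcases Nat.eq_zero_or_pos m with rfl | hm
  · simp [Nat.descFactorial_self, Function.comp_def]
  · rw [if_neg (by omega), zero_pow (by omega), mul_zero]

/-- Whenever `g` acts by derivations on a commutative algebra in such a way that the vector fields
of `g` separate the elements of `g` at some point, the ordered monomials in a linearly independent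
family are linearly independent in the enveloping algebra. -/
theorem linearIndependent_monomials_of_derivations [CharZero k] {R : Type*} [CommRing R]
    [Algebra k R]
    (ρ : g →ₗ⁅k⁆ Derivation k R R) (ev : R →ₐ[k] k)
    (hsep : ∀ X : g, (∀ f, ev (ρ X f) = 0) → X = 0)
    {κ : Type*} [Fintype κ] (b : κ → g) (hb : LinearIndependent k b)
    (l : (κ →₀ ℕ) → List κ) (hl : ∀ a, (l a : Multiset κ) = Finsupp.toMultiset a) :
    LinearIndependent k fun a =>
      ((l a).map fun i => UniversalEnvelopingAlgebra.ι k (b i)).prod := by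
  classical
  -- every value of the coordinates `X ↦ ev (ρ X f)` on the family is attained
  have hsurj : ∀ c : κ → k, ∃ f : R, ev f = 0 ∧ ∀ i, ev (ρ (b i) f) = c i := by
    let Φ : R →ₗ[k] (κ → k) := LinearMap.pi fun i => ev.toLinearMap ∘ₗ (ρ (b i) : R →ₗ[k] R)
    have htop : LinearMap.range Φ = ⊤ := by
      by_contra hne
      obtain ⟨F, hF0, hF⟩ := Submodule.exists_le_ker_of_lt_top _ (lt_top_iff_ne_top.mpr hne)
      refine hF0 (LinearMap.pi_ext' fun i => LinearMap.ext_ring ?_)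
      have hF' : ∑ i, F (Pi.single i 1) • b i = 0 := by
        refine hsep _ fun f => ?_
        have h1 : F (Φ f) = 0 := hF ⟨f, rfl⟩
        rw [LinearMap.pi_apply_eq_sum_univ F (Φ f)] at h1
        let E : g →ₗ[k] k :=
          { toFun := fun X => ev (ρ X f)
            map_add' := fun X Y => by rw [map_add, Derivation.add_apply, map_add]
            map_smul' := fun r X => by rw [map_smul, Derivation.smul_apply, map_smul]; rfl }
        change E _ = 0
        rw [← h1, map_sum]
        refine Finset.sum_congr rfl fun i _ => ?_
        rw [map_smul, smul_eq_mul, smul_eq_mul, mul_comm]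
        congr 2
        ext j
        simp [Pi.single_apply, eq_comm]
      have := Fintype.linearIndependent_iff.mp hb _ hF' i
      simpa using this
    intro c
    obtain ⟨f, hf⟩ := LinearMap.range_eq_top.mp htop c
    refine ⟨f - algebraMap k R (ev f), by simp, fun i => ?_⟩
    rw [map_sub, Derivation.map_algebraMap, sub_zero, ← hf]
    rfl
  rw [linearIndependent_iff]
  intro c hc
  by_contra hne
  have hsupp : c.support.Nonempty := Finsupp.support_nonempty_iff.mpr hne
  have hlen : ∀ a, (l a).length = a.degree := fun a => by
    have := congrArg Multiset.card (hl a)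
    rw [Multiset.coe_card, Finsupp.card_toMultiset] at this
    rw [this]; rfl
  -- `N` is the largest degree that occurs; the part of degree `N` is a polynomial that vanishes
  obtain ⟨a₀, ha₀, hmax⟩ := Finset.exists_max_image c.support (fun a => a.degree) hsupp
  set N := a₀.degree with hN
  let p : MvPolynomial κ k := ∑ a ∈ c.support.filter (fun a => a.degree = N),
    MvPolynomial.monomial a (c a)
  have hp : p = 0 := by
    refine MvPolynomial.funext fun s => ?_
    obtain ⟨f, hf, hfs⟩ := hsurj s
    have h0 : ev (derivationAction ρ (Finsupp.linearCombination k (fun a =>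
      ((l a).map fun i => UniversalEnvelopingAlgebra.ι k (b i)).prod) c) (f ^ N)) = 0 := by
      rw [hc]; simp
    rw [Finsupp.linearCombination_apply, Finsupp.sum, map_sum, LinearMap.sum_apply, map_sum] at h0
    have h1 : ∀ a ∈ c.support, ev (derivationAction ρ (c a •
        ((l a).map fun i => UniversalEnvelopingAlgebra.ι k (b i)).prod) (f ^ N)) =
        if a.degree = N then c a * (N.factorial * (a.prod fun i e => s i ^ e)) else 0 := by
      intro a ha
      have h2 := ev_derivationAction_prod ρ ev hf ((l a).map b) N
        (by rw [List.length_map, hlen]; exact hmax a ha)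
      rw [List.length_map, hlen] at h2
      rw [map_smul, LinearMap.smul_apply, map_smul]
      simp only [List.map_map, Function.comp_def] at h2
      rw [h2]
      split_ifs with h3
      · rw [smul_eq_mul]
        congr 2
        simp only [hfs]
        rw [← Multiset.prod_coe, ← Multiset.map_coe, hl, Finsupp.toMultiset_map, Finsupp.prod_toMultiset,
          Finsupp.prod_mapDomain_index (by simp) (by intros; rw [pow_add])]
      · simp
    rw [Finset.sum_congr rfl h1, ← Finset.sum_filter] at h0
    have h2 : (N.factorial : k) * MvPolynomial.eval s p = 0 := by
      rw [← h0, map_sum, Finset.mul_sum]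
      refine Finset.sum_congr rfl fun a _ => ?_
      rw [MvPolynomial.eval_monomial]; ring
    rw [map_zero]
    exact (mul_eq_zero.mp h2).resolve_left (Nat.cast_ne_zero.mpr (Nat.factorial_ne_zero N))
  have h3 : MvPolynomial.coeff a₀ p = c a₀ := by
    simp only [p, MvPolynomial.coeff_sum, MvPolynomial.coeff_monomial]
    have h4 : a₀ ∈ c.support.filter (fun a => a.degree = N) := Finset.mem_filter.mpr ⟨ha₀, hN.symm⟩
    exact (Finset.sum_ite_eq' _ _ _).trans (if_pos h4)
  rw [hp, MvPolynomial.coeff_zero] at h3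
  exact Finsupp.mem_support_iff.mp ha₀ h3.symm

/-- The derivations of the polynomial ring in the entries of a generic matrix `x` and further
variables `y` given by `x ↦ x M`, `y ↦ v`. -/
def genericDerivation {κ μ : Type*} [Fintype κ] (M : Matrix κ κ k) (v : μ → k) :
    Derivation k (MvPolynomial ((κ × κ) ⊕ μ) k) (MvPolynomial ((κ × κ) ⊕ μ) k) :=
  MvPolynomial.mkDerivation k (Sum.elim
    (fun p => ∑ j, M j p.2 • MvPolynomial.X (Sum.inl (p.1, j))) (fun i => MvPolynomial.C (v i)))

theorem genericDerivation_inl {κ μ : Type*} [Fintype κ] (M : Matrix κ κ k) (v : μ → k) (p : κ × κ) :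
    genericDerivation M v (MvPolynomial.X (Sum.inl p)) =
      ∑ j, M j p.2 • MvPolynomial.X (Sum.inl (p.1, j)) := by
  simp [genericDerivation, MvPolynomial.mkDerivation_X]

theorem genericDerivation_inr {κ μ : Type*} [Fintype κ] (M : Matrix κ κ k) (v : μ → k) (i : μ) :
    genericDerivation M v (MvPolynomial.X (Sum.inr i)) = MvPolynomial.C (v i) := by
  simp [genericDerivation, MvPolynomial.mkDerivation_X]

/-- The Lie algebra homomorphism into derivations given by a matrix representation `M` and linear
functionals `v` that vanish on brackets. -/
def genericAction {κ μ : Type*} [Fintype κ] (M : g →ₗ[k] Matrix κ κ k)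
    (hM : ∀ X Y, M ⁅X, Y⁆ = M X * M Y - M Y * M X) (v : g →ₗ[k] (μ → k))
    (hv : ∀ X Y : g, v ⁅X, Y⁆ = 0) :
    g →ₗ⁅k⁆ Derivation k (MvPolynomial ((κ × κ) ⊕ μ) k) (MvPolynomial ((κ × κ) ⊕ μ) k) where
  toFun X := genericDerivation (M X) (v X)
  map_add' X Y := by
    refine MvPolynomial.derivation_ext ?_
    rintro (p | i)
    · simp [genericDerivation_inl, add_smul, Finset.sum_add_distrib]
    · simp [genericDerivation_inr]
  map_smul' r X := by
    refine MvPolynomial.derivation_ext ?_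
    rintro (p | i)
    · simp [genericDerivation_inl, mul_smul, Finset.smul_sum]
    · simp [genericDerivation_inr, MvPolynomial.smul_eq_C_mul]
  map_lie' {X Y} := by
    refine MvPolynomial.derivation_ext ?_
    rintro (p | i)
    · rw [Derivation.commutator_apply]
      simp only [genericDerivation_inl, map_sum, hM, Matrix.sub_apply, Matrix.mul_apply,
        sub_smul, Finset.sum_sub_distrib, Finset.sum_smul]
      congr 1 <;>
      · rw [Finset.sum_comm]
        refine Finset.sum_congr rfl fun i _ => ?_
        rw [Derivation.map_smul, genericDerivation_inl, Finset.smul_sum]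
        refine Finset.sum_congr rfl fun j _ => ?_
        rw [smul_smul, mul_comm]
    · rw [Derivation.commutator_apply]
      simp [genericDerivation_inr, hv, MvPolynomial.derivation_C]

/-- The linear-independence half of the Poincaré–Birkhoff–Witt theorem, for a finite-dimensional Lie
algebra whose centre meets the derived algebra trivially. The adjoint representation together with
the functionals that vanish on the derived algebra then gives a faithful action by derivations. -/
theorem linearIndependent_monomials [CharZero k] [Module.Finite k g]
    (hg : ∀ X : g, (∀ Y : g, ⁅X, Y⁆ = 0) → X ∈ Submodule.span k {Z : g | ∃ U V : g, ⁅U, V⁆ = Z} →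
      X = 0)
    {κ : Type*} [Fintype κ] (b : κ → g) (hb : LinearIndependent k b)
    (l : (κ →₀ ℕ) → List κ) (hl : ∀ a, (l a : Multiset κ) = Finsupp.toMultiset a) :
    LinearIndependent k fun a =>
      ((l a).map fun i => UniversalEnvelopingAlgebra.ι k (b i)).prod := by
  classical
  let S : Submodule k g := Submodule.span k {Z : g | ∃ U V : g, ⁅U, V⁆ = Z}
  let e := Module.finBasis k g
  let M : g →ₗ[k] Matrix (Fin (Module.finrank k g)) (Fin (Module.finrank k g)) k :=
    (LinearMap.toMatrix e e).toLinearMap ∘ₗ (LieAlgebra.ad k g : g →ₗ[k] Module.End k g)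
  let v : g →ₗ[k] (Fin (Module.finrank k (g ⧸ S)) → k) :=
    (Module.finBasis k (g ⧸ S)).equivFun.toLinearMap ∘ₗ S.mkQ
  have hM : ∀ X Y, M ⁅X, Y⁆ = M X * M Y - M Y * M X := fun X Y => by
    change LinearMap.toMatrix e e (LieAlgebra.ad k g ⁅X, Y⁆) = _
    rw [LieHom.map_lie, LieRing.of_associative_ring_bracket, map_sub, LinearMap.toMatrix_mul,
      LinearMap.toMatrix_mul]
    rfl
  have hv : ∀ X Y : g, v ⁅X, Y⁆ = 0 := fun X Y => by
    have : S.mkQ ⁅X, Y⁆ = 0 := by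
      rw [Submodule.mkQ_apply, Submodule.Quotient.mk_eq_zero]
      exact Submodule.subset_span ⟨X, Y, rfl⟩
    change (Module.finBasis k (g ⧸ S)).equivFun (S.mkQ ⁅X, Y⁆) = 0
    rw [this, map_zero]
  refine linearIndependent_monomials_of_derivations (genericAction M hM v hv)
    (MvPolynomial.aeval (Sum.elim (fun p => if p.1 = p.2 then 1 else 0) fun _ => 0)) ?_ b hb l hl
  intro X hX
  have h1 : M X = 0 := by
    ext i j
    have := hX (MvPolynomial.X (Sum.inl (i, j)))
    change MvPolynomial.aeval _ (genericDerivation (M X) (v X) _) = 0 at this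
    rw [genericDerivation_inl] at this
    simpa using this
  have h2 : v X = 0 := by
    ext i
    have := hX (MvPolynomial.X (Sum.inr i))
    change MvPolynomial.aeval _ (genericDerivation (M X) (v X) _) = 0 at this
    rw [genericDerivation_inr] at this
    simpa using this
  refine hg X (fun Y => ?_) ?_
  · have h3 : LieAlgebra.ad k g X = 0 := (LinearMap.toMatrix e e).injective (h1.trans (map_zero _).symm)
    exact LinearMap.congr_fun h3 Y
  · have h3 : S.mkQ X = 0 := (Module.finBasis k (g ⧸ S)).equivFun.injective
      (h2.trans (map_zero _).symm)
    rwa [Submodule.mkQ_apply, Submodule.Quotient.mk_eq_zero] at h3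

/-- The elements of a Lie algebra generate its enveloping algebra. -/
theorem adjoin_range_ι :
    Algebra.adjoin k (Set.range (UniversalEnvelopingAlgebra.ι k : g →ₗ⁅k⁆ _)) = ⊤ := by
  set A := Algebra.adjoin k (Set.range (UniversalEnvelopingAlgebra.ι k : g →ₗ⁅k⁆ _)) with hA
  let f : g →ₗ⁅k⁆ A :=
    { toFun := fun X => ⟨UniversalEnvelopingAlgebra.ι k X, Algebra.subset_adjoin ⟨X, rfl⟩⟩
      map_add' := fun X Y => Subtype.ext (map_add _ X Y)
      map_smul' := fun r X => Subtype.ext (map_smul _ r X)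
      map_lie' := fun {X Y} => Subtype.ext (LieHom.map_lie _ X Y) }
  have h : A.val.comp (UniversalEnvelopingAlgebra.lift k f) = AlgHom.id k _ := by
    refine UniversalEnvelopingAlgebra.hom_ext _ (LieHom.ext fun X => ?_)
    change (UniversalEnvelopingAlgebra.lift k f (UniversalEnvelopingAlgebra.ι k X)).val = _
    rw [UniversalEnvelopingAlgebra.lift_ι_apply]
    rfl
  rw [eq_top_iff]
  intro u _
  have := AlgHom.congr_fun h u
  rw [AlgHom.id_apply] at this
  rw [← this]
  exact Subtype.property _

/-- The spanning half of the Poincaré–Birkhoff–Witt theorem, for an arbitrary choice of the order of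
the factors in each monomial. -/
theorem span_monomials {κ : Type*} (b : κ → g)
    (hb : Submodule.span k (Set.range b) = ⊤)
    (l : (κ →₀ ℕ) → List κ) (hl : ∀ a, (l a : Multiset κ) = Finsupp.toMultiset a) :
    Submodule.span k (Set.range fun a =>
      ((l a).map fun i => UniversalEnvelopingAlgebra.ι k (b i)).prod) = ⊤ := by
  classical
  let P : List κ → UniversalEnvelopingAlgebra k g := fun w =>
    (w.map fun i => UniversalEnvelopingAlgebra.ι k (b i)).prod
  have hP : ∀ i w, P (i :: w) = UniversalEnvelopingAlgebra.ι k (b i) * P w := fun i w => by simp [P]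
  let F : ℕ → Submodule k (UniversalEnvelopingAlgebra k g) := fun N =>
    Submodule.span k (P '' {w | w.length < N})
  have hmulF : ∀ X N u, u ∈ F N → UniversalEnvelopingAlgebra.ι k X * u ∈ F (N + 1) := by
    intro X N u hu
    have hX : X ∈ Submodule.span k (Set.range b) := hb ▸ Submodule.mem_top
    induction hX using Submodule.span_induction with
    | mem X hX =>
      obtain ⟨i, rfl⟩ := hX
      induction hu using Submodule.span_induction with
      | mem u hu =>
        obtain ⟨w, hw, rfl⟩ := hu
        exact Submodule.subset_span ⟨i :: w, Nat.succ_lt_succ hw, hP i w⟩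
      | zero => simp
      | add u v _ _ hu hv => rw [mul_add]; exact add_mem hu hv
      | smul r u _ hu => rw [mul_smul_comm]; exact Submodule.smul_mem _ _ hu
    | zero => simp
    | add X Y _ _ hX hY => rw [map_add, add_mul]; exact add_mem hX hY
    | smul r X _ hX => rw [map_smul, smul_mul_assoc]; exact Submodule.smul_mem _ _ hX
  -- permuting the factors changes a product only by shorter products
  have hperm : ∀ w w' : List κ, w.Perm w' → P w - P w' ∈ F w.length := by
    intro w w' h
    induction h with
    | nil => simp
    | cons i _ ih =>
      rw [hP, hP, ← mul_sub]
      exact hmulF _ _ _ ih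
    | swap i j w =>
      have : P (j :: i :: w) - P (i :: j :: w) =
          UniversalEnvelopingAlgebra.ι k ⁅b j, b i⁆ * P w := by
        simp only [hP, LieHom.map_lie, LieRing.of_associative_ring_bracket]
        noncomm_ring
      rw [this]
      exact hmulF _ _ _ (Submodule.subset_span ⟨w, by simp, rfl⟩)
    | trans h₁ _ ih₁ ih₂ =>
      have := add_mem ih₁ (h₁.length_eq ▸ ih₂)
      rwa [sub_add_sub_cancel] at this
  have key : ∀ N, ∀ w : List κ, w.length < N → P w ∈ Submodule.span k (Set.range fun a => P (l a)) := by
    intro N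
    induction N with
    | zero => intro w hw; omega
    | succ N ih =>
      intro w hw
      have hF : F N ≤ Submodule.span k (Set.range fun a => P (l a)) := by
        refine Submodule.span_le.mpr ?_
        rintro _ ⟨w, hw, rfl⟩
        exact ih w hw
      have hw' : w.Perm (l (Multiset.toFinsupp (w : Multiset κ))) := by
        rw [← Multiset.coe_eq_coe, hl, Multiset.toFinsupp_toMultiset]
      have h1 : F w.length ≤ F N := Submodule.span_mono (Set.image_mono fun v hv =>
        lt_of_lt_of_le hv (Nat.lt_succ_iff.mp hw))
      have h2 := hF (h1 (hperm _ _ hw'))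
      have h3 := add_mem h2 (Submodule.subset_span ⟨_, rfl⟩ :
        P (l (Multiset.toFinsupp (w : Multiset κ))) ∈ Submodule.span k (Set.range fun a => P (l a)))
      rwa [sub_add_cancel] at h3
  rw [eq_top_iff]
  intro u _
  have hu : u ∈ Algebra.adjoin k (Set.range (UniversalEnvelopingAlgebra.ι k : g →ₗ⁅k⁆ _)) := by
    rw [adjoin_range_ι]; trivial
  rw [← Subalgebra.mem_toSubmodule, Algebra.adjoin_eq_span] at hu
  have hle : Submodule.span k (Submonoid.closure
      (Set.range (UniversalEnvelopingAlgebra.ι k : g →ₗ⁅k⁆ _)) :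
        Set (UniversalEnvelopingAlgebra k g)) ≤
      Submodule.span k (Set.range fun a => P (l a)) := by
    refine Submodule.span_le.mpr fun u hu => ?_
    have : ∃ N, u ∈ F N := by
      refine Submonoid.closure_induction_left (motive := fun u _ => ∃ N, u ∈ F N) ?_ ?_ hu
      · exact ⟨1, Submodule.subset_span ⟨[], by simp, by simp [P]⟩⟩
      · rintro _ ⟨X, rfl⟩ u _ ⟨N, hN⟩
        exact ⟨N + 1, hmulF X N u hN⟩
    obtain ⟨N, hN⟩ := this
    refine (Submodule.span_le.mpr ?_ : F N ≤ _) hN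
    rintro _ ⟨w, hw, rfl⟩
    exact key N w hw
  exact hle hu

end PBW

end

end CasimirRadial

namespace CasimirRadial

noncomputable section

/-! ### The adjoint representation in coordinates -/

section LieGroups

open VectorField

variable {n : ℕ} {G : Type*} [TopologicalSpace G] [ChartedSpace (EuclideanSpace ℝ (Fin n)) G]
  [Group G] [LieGroup (𝓡 n) ∞ G]

/-- The differential in the preferred charts, as a map between Euclidean spaces. -/
theorem mfderiv_apply_eq_fderiv {F : G → G} {g : G}
    (hF : MDifferentiableAt (𝓡 n) (𝓡 n) F g) (v : EuclideanSpace ℝ (Fin n)) :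
    (mfderiv (𝓡 n) (𝓡 n) F g v : EuclideanSpace ℝ (Fin n)) =
      fderiv ℝ (extChartAt (𝓡 n) (F g) ∘ F ∘ (extChartAt (𝓡 n) g).symm) (extChartAt (𝓡 n) g g) v := by
  let A : EuclideanSpace ℝ (Fin n) →L[ℝ] EuclideanSpace ℝ (Fin n) := mfderiv (𝓡 n) (𝓡 n) F g
  have h : HasFDerivWithinAt (extChartAt (𝓡 n) (F g) ∘ F ∘ (extChartAt (𝓡 n) g).symm) A
      (Set.range (𝓡 n)) (extChartAt (𝓡 n) g g) := hF.hasMFDerivAt.2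
  rw [ModelWithCorners.range_eq_univ, hasFDerivWithinAt_univ] at h
  rw [h.fderiv]
  rfl

theorem mdifferentiable_conj (g : G) : MDifferentiable (𝓡 n) (𝓡 n) fun h : G => g * h * g⁻¹ :=
  ((contMDiff_const.mul contMDiff_id).mul contMDiff_const :
    ContMDiff (𝓡 n) (𝓡 n) ∞ fun h : G => g * h * g⁻¹).mdifferentiable (by simp)

theorem Ad_apply_eq_mfderiv (g : G) (Y : LieAlg n G) :
    Ad n g Y = (mfderiv (𝓡 n) (𝓡 n) (fun h : G => g * h * g⁻¹) 1 Y : EuclideanSpace ℝ (Fin n)) :=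
  rfl

theorem Ad_one (Y : LieAlg n G) : Ad n (1 : G) Y = Y := by
  rw [Ad_apply_eq_mfderiv]
  have : (fun h : G => 1 * h * 1⁻¹) = id := by funext h; simp
  rw [this, mfderiv_id]
  rfl

theorem Ad_mul (g h : G) (Y : LieAlg n G) : Ad n (g * h) Y = Ad n g (Ad n h Y) := by
  let D : (G → G) → G → EuclideanSpace ℝ (Fin n) → EuclideanSpace ℝ (Fin n) :=
    fun F x v => mfderiv (𝓡 n) (𝓡 n) F x v
  change D (fun b => g * h * b * (g * h)⁻¹) 1 Y =
    D (fun b => g * b * g⁻¹) 1 (D (fun b => h * b * h⁻¹) 1 Y)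
  have e1 : (fun b => g * h * b * (g * h)⁻¹) = (fun b => g * b * g⁻¹) ∘ fun b => h * b * h⁻¹ := by
    funext b; simp [mul_assoc]
  have e2 : D ((fun b => g * b * g⁻¹) ∘ fun b => h * b * h⁻¹) 1 Y =
      D (fun b => g * b * g⁻¹) (h * 1 * h⁻¹) (D (fun b => h * b * h⁻¹) 1 Y) :=
    mfderiv_comp_apply (I' := 𝓡 n) 1 (mdifferentiable_conj g _) (mdifferentiable_conj h _) Y
  rw [e1, e2, mul_one, mul_inv_cancel]

theorem Ad_eq_fderiv (g : G) (Y : LieAlg n G) :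
    Ad n g Y = (fderiv ℝ (fun y => extChartAt (𝓡 n) (1 : G)
      (g * (extChartAt (𝓡 n) (1 : G)).symm y * g⁻¹)) (extChartAt (𝓡 n) (1 : G) 1) Y :
        EuclideanSpace ℝ (Fin n)) := by
  refine (mfderiv_apply_eq_fderiv (mdifferentiable_conj g 1) Y).trans ?_
  have : g * 1 * g⁻¹ = 1 := by simp
  rw [this]
  rfl

/-- The multiplication of `G` in the preferred chart at `1`. -/
def chartMul (n : ℕ) (G : Type*) [TopologicalSpace G] [ChartedSpace (EuclideanSpace ℝ (Fin n)) G]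
    [Group G] (p : EuclideanSpace ℝ (Fin n) × EuclideanSpace ℝ (Fin n)) :
    EuclideanSpace ℝ (Fin n) :=
  extChartAt (𝓡 n) (1 : G) ((extChartAt (𝓡 n) (1 : G)).symm p.1 *
    (extChartAt (𝓡 n) (1 : G)).symm p.2)

/-- The conjugation `(g, h) ↦ g h g⁻¹` of `G` in the preferred chart at `1`. -/
def chartConj (n : ℕ) (G : Type*) [TopologicalSpace G] [ChartedSpace (EuclideanSpace ℝ (Fin n)) G]
    [Group G] (p : EuclideanSpace ℝ (Fin n) × EuclideanSpace ℝ (Fin n)) :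
    EuclideanSpace ℝ (Fin n) :=
  extChartAt (𝓡 n) (1 : G) ((extChartAt (𝓡 n) (1 : G)).symm p.1 *
    (extChartAt (𝓡 n) (1 : G)).symm p.2 * ((extChartAt (𝓡 n) (1 : G)).symm p.1)⁻¹)

variable (n G) in
/-- The coordinates of `1` in the preferred chart. -/
def chartOne : EuclideanSpace ℝ (Fin n) := extChartAt (𝓡 n) (1 : G) 1

theorem symm_chartOne : (extChartAt (𝓡 n) (1 : G)).symm (chartOne n G) = 1 :=
  extChartAt_to_inv 1

theorem contMDiffAt_chart_symm : ContMDiffAt 𝓘(ℝ, EuclideanSpace ℝ (Fin n)) (𝓡 n) ∞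
    (extChartAt (𝓡 n) (1 : G)).symm (chartOne n G) :=
  have : IsManifold (𝓡 n) ∞ G := inferInstance
  (contMDiffOn_extChartAt_symm (1 : G)).contMDiffAt (extChartAt_target_mem_nhds (1 : G))

theorem contMDiffAt_chart_symm_comp {F : Type*} [NormedAddCommGroup F] [NormedSpace ℝ F]
    {f : F → EuclideanSpace ℝ (Fin n)} {p : F} (hf : ContDiffAt ℝ ∞ f p)
    (hp : f p = chartOne n G) :
    ContMDiffAt 𝓘(ℝ, F) (𝓡 n) ∞ (fun q => (extChartAt (𝓡 n) (1 : G)).symm (f q)) p :=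
  ContMDiffAt.comp (I' := 𝓘(ℝ, EuclideanSpace ℝ (Fin n))) p (hp ▸ contMDiffAt_chart_symm)
    hf.contMDiffAt

theorem contDiffAt_chart_comp {F : Type*} [NormedAddCommGroup F] [NormedSpace ℝ F]
    {f : F → G} {p : F} (hf : ContMDiffAt 𝓘(ℝ, F) (𝓡 n) ∞ f p) (hp : f p = 1) :
    ContDiffAt ℝ ∞ (fun q => extChartAt (𝓡 n) (1 : G) (f q)) p := by
  have : IsManifold (𝓡 n) ∞ G := inferInstance
  rw [← contMDiffAt_iff_contDiffAt]
  refine ContMDiffAt.comp (I' := 𝓡 n) p ?_ hf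
  rw [hp]
  exact contMDiffAt_extChartAt

theorem contDiffAt_chartMul : ContDiffAt ℝ ∞ (chartMul n G) (chartOne n G, chartOne n G) := by
  refine contDiffAt_chart_comp ((contMDiffAt_chart_symm_comp contDiffAt_fst rfl).mul
    (contMDiffAt_chart_symm_comp contDiffAt_snd rfl)) ?_
  simp only [symm_chartOne, mul_one]

theorem contDiffAt_chartConj : ContDiffAt ℝ ∞ (chartConj n G) (chartOne n G, chartOne n G) := by
  have h1 := contMDiffAt_chart_symm_comp (G := G) (contDiffAt_fst (𝕜 := ℝ) (n := ∞)
    (p := (chartOne n G, chartOne n G))) rfl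
  refine contDiffAt_chart_comp ((h1.mul (contMDiffAt_chart_symm_comp contDiffAt_snd rfl)).mul h1.inv)
    ?_
  simp only [symm_chartOne, mul_one, inv_one]

open Filter Topology in
/-- `(g h g⁻¹) g = g h` in the chart. -/
theorem chartMul_chartConj : ∀ᶠ p in 𝓝 (chartOne n G, chartOne n G),
    chartMul n G (chartConj n G p, p.1) = chartMul n G p := by
  have h1 : ContinuousAt (fun p : EuclideanSpace ℝ (Fin n) × EuclideanSpace ℝ (Fin n) =>
      (extChartAt (𝓡 n) (1 : G)).symm p.1 * (extChartAt (𝓡 n) (1 : G)).symm p.2 *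
        ((extChartAt (𝓡 n) (1 : G)).symm p.1)⁻¹) (chartOne n G, chartOne n G) := by
    have h1 := contMDiffAt_chart_symm_comp (G := G) (contDiffAt_fst (𝕜 := ℝ) (n := ∞)
      (p := (chartOne n G, chartOne n G))) rfl
    exact ((h1.mul (contMDiffAt_chart_symm_comp contDiffAt_snd rfl)).mul h1.inv).continuousAt
  have h2 := h1.preimage_mem_nhds (t := (extChartAt (𝓡 n) (1 : G)).source) (by
    simp only [symm_chartOne, mul_one, inv_one]
    exact extChartAt_source_mem_nhds 1)
  filter_upwards [h2] with p hp
  simp only [chartMul, chartConj]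
  rw [(extChartAt (𝓡 n) (1 : G)).left_inv hp, inv_mul_cancel_right]

open Filter Topology in
/-- The derivative of `(g h g⁻¹) g = g h` in `h` at `1`: the left-invariant field with value `Y` is
the right-invariant field with value `Ad(g) Y` at the point `g`. -/
theorem eventually_chartConj_fderiv : ∀ᶠ x in 𝓝 (chartOne n G), ∀ Y,
    fderiv ℝ (chartMul n G) (chartOne n G, x)
      (fderiv ℝ (fun y => chartConj n G (x, y)) (chartOne n G) Y, 0) =
    fderiv ℝ (chartMul n G) (x, chartOne n G) (0, Y) := by
  set e := chartOne n G with he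
  have hpair : Tendsto (fun x => (x, e)) (𝓝 e) (𝓝 (e, e)) :=
    (continuous_id.prodMk continuous_const).tendsto e
  have hpair' : Tendsto (fun x => (e, x)) (𝓝 e) (𝓝 (e, e)) :=
    (continuous_const.prodMk continuous_id).tendsto e
  have hm : ∀ᶠ p in 𝓝 (e, e), DifferentiableAt ℝ (chartMul n G) p :=
    ((contDiffAt_chartMul.of_le (m := 1) ENat.LEInfty.out).eventually (by simp)).mono
      fun p hp => hp.differentiableAt (by simp)
  have hc : ∀ᶠ p in 𝓝 (e, e), DifferentiableAt ℝ (chartConj n G) p :=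
    ((contDiffAt_chartConj.of_le (m := 1) ENat.LEInfty.out).eventually (by simp)).mono
      fun p hp => hp.differentiableAt (by simp)
  filter_upwards [hpair.eventually (eventually_eventually_nhds.mpr chartMul_chartConj),
    hpair.eventually hm, hpair'.eventually hm, hpair.eventually hc] with x h1 h2 h3 h4 Y
  have hce : chartConj n G (x, e) = e := by
    simp only [chartConj, he, symm_chartOne, mul_one, mul_inv_cancel]; rfl
  have hsnd : HasFDerivAt (fun y => (x, y)) (ContinuousLinearMap.inr ℝ (EuclideanSpace ℝ (Fin n))
      (EuclideanSpace ℝ (Fin n))) e := hasFDerivAt_prodMk_right x e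
  have hcy : HasFDerivAt (fun y => chartConj n G (x, y))
      (fderiv ℝ (fun y => chartConj n G (x, y)) e) e :=
    (h4.hasFDerivAt.comp e hsnd).differentiableAt.hasFDerivAt
  have hL : HasFDerivAt (fun y => chartMul n G (chartConj n G (x, y), x))
      ((fderiv ℝ (chartMul n G) (e, x)).comp
        ((fderiv ℝ (fun y => chartConj n G (x, y)) e).prod 0)) e := by
    have h5 : HasFDerivAt (chartMul n G) (fderiv ℝ (chartMul n G) (e, x))
        (chartConj n G (x, e), x) := by rw [hce]; exact h3.hasFDerivAt
    exact h5.comp e (hcy.prodMk (hasFDerivAt_const x e))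
  have hR : HasFDerivAt (fun y => chartMul n G (x, y)) ((fderiv ℝ (chartMul n G) (x, e)).comp
      (ContinuousLinearMap.inr ℝ _ _)) e := h2.hasFDerivAt.comp e hsnd
  have hev : (fun y => chartMul n G (chartConj n G (x, y), x)) =ᶠ[𝓝 e]
      fun y => chartMul n G (x, y) :=
    (continuous_const.prodMk continuous_id).continuousAt.eventually h1
  have := hL.unique (hR.congr_of_eventuallyEq hev)
  exact congrArg (fun A => A Y) this

/-- The second derivative of the multiplication at `(1, 1)` in the chart. -/
def chartHess (n : ℕ) (G : Type*) [TopologicalSpace G]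
    [ChartedSpace (EuclideanSpace ℝ (Fin n)) G] [Group G] (X Y : EuclideanSpace ℝ (Fin n)) :
    EuclideanSpace ℝ (Fin n) :=
  fderiv ℝ (fderiv ℝ (chartMul n G)) (chartOne n G, chartOne n G) (X, 0) (0, Y)

theorem hasFDerivAt_fderiv_chartMul : HasFDerivAt (fderiv ℝ (chartMul n G))
    (fderiv ℝ (fderiv ℝ (chartMul n G)) (chartOne n G, chartOne n G))
    (chartOne n G, chartOne n G) :=
  ((contDiffAt_chartMul.fderiv_right (m := 1) (by norm_cast)).differentiableAt
    (by simp)).hasFDerivAt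

/-- Symmetry of the second derivative of the multiplication. -/
theorem fderiv_fderiv_chartMul_symm (X Y : EuclideanSpace ℝ (Fin n)) :
    fderiv ℝ (fderiv ℝ (chartMul n G)) (chartOne n G, chartOne n G) (0, X) (Y, 0) =
      chartHess n G Y X :=
  (contDiffAt_chartMul (n := n) (G := G)).isSymmSndFDerivAt (by simpa using ENat.LEInfty.out) _ _

/-- The derivative of `x ↦ ∂₂ m(x, 1) Y`. -/
theorem hasFDerivAt_chartField (Y : EuclideanSpace ℝ (Fin n)) :
    HasFDerivAt (fun x => fderiv ℝ (chartMul n G) (x, chartOne n G) (0, Y))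
      (((fderiv ℝ (fderiv ℝ (chartMul n G)) (chartOne n G, chartOne n G)).comp
        (ContinuousLinearMap.inl ℝ _ _)).flip (0, Y)) (chartOne n G) := by
  have h1 : HasFDerivAt (fun x => fderiv ℝ (chartMul n G) (x, chartOne n G)) _ (chartOne n G) :=
    HasFDerivAt.comp (f := fun x => (x, chartOne n G)) (chartOne n G) hasFDerivAt_fderiv_chartMul
      (hasFDerivAt_prodMk_left _ _)
  have h2 := h1.clm_apply (hasFDerivAt_const ((0 : EuclideanSpace ℝ (Fin n)), Y) _)
  rw [ContinuousLinearMap.comp_zero, zero_add] at h2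
  exact h2

theorem chartMul_chartOne_left : ∀ᶠ x in nhds (chartOne n G), chartMul n G (chartOne n G, x) = x := by
  filter_upwards [extChartAt_target_mem_nhds (I := 𝓡 n) (1 : G)] with x hx
  simp only [chartMul, symm_chartOne, one_mul]
  exact (extChartAt (𝓡 n) (1 : G)).right_inv hx

theorem chartMul_chartOne_right : ∀ᶠ x in nhds (chartOne n G), chartMul n G (x, chartOne n G) = x := by
  filter_upwards [extChartAt_target_mem_nhds (I := 𝓡 n) (1 : G)] with x hx
  simp only [chartMul, symm_chartOne, mul_one]
  exact (extChartAt (𝓡 n) (1 : G)).right_inv hx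

theorem hasFDerivAt_chartMul : HasFDerivAt (chartMul n G)
    (fderiv ℝ (chartMul n G) (chartOne n G, chartOne n G)) (chartOne n G, chartOne n G) :=
  (contDiffAt_chartMul.differentiableAt (by simp)).hasFDerivAt

theorem fderiv_chartMul_inr (Y : EuclideanSpace ℝ (Fin n)) :
    fderiv ℝ (chartMul n G) (chartOne n G, chartOne n G) (0, Y) = Y := by
  have h := (hasFDerivAt_chartMul (n := n) (G := G)).comp (chartOne n G)
    (hasFDerivAt_prodMk_right (chartOne n G) (chartOne n G))
  have h2 := h.unique ((hasFDerivAt_id _).congr_of_eventuallyEq chartMul_chartOne_left)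
  exact congrArg (fun A => A Y) h2

theorem fderiv_chartMul_inl (Y : EuclideanSpace ℝ (Fin n)) :
    fderiv ℝ (chartMul n G) (chartOne n G, chartOne n G) (Y, 0) = Y := by
  have h := HasFDerivAt.comp (f := fun x => (x, chartOne n G)) (chartOne n G)
    (hasFDerivAt_chartMul (n := n) (G := G)) (hasFDerivAt_prodMk_left (chartOne n G) (chartOne n G))
  have h2 := h.unique ((hasFDerivAt_id _).congr_of_eventuallyEq chartMul_chartOne_right)
  exact congrArg (fun A => A Y) h2

/-- The adjoint representation in the chart, differentiated at `1` in the direction `X`. -/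
theorem hasFDerivAt_chartAd (Y : EuclideanSpace ℝ (Fin n)) :
    ∃ A : EuclideanSpace ℝ (Fin n) →L[ℝ] EuclideanSpace ℝ (Fin n),
    HasFDerivAt (fun x => fderiv ℝ (fun y => chartConj n G (x, y)) (chartOne n G) Y) A
      (chartOne n G) ∧ ∀ X, A X = chartHess n G X Y - chartHess n G Y X := by
  set e := chartOne n G with he
  have hdiff : DifferentiableAt ℝ (fun x => fderiv ℝ (fun y => chartConj n G (x, y)) e Y) e := by
    have h1 : ContDiffAt ℝ 1 (fun x => fderiv ℝ (fun y => chartConj n G (x, y)) e) e :=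
      ContDiffAt.fderiv (n := ∞) (f := fun x y => chartConj n G (x, y)) contDiffAt_chartConj
        contDiffAt_const (by norm_cast)
    exact (h1.differentiableAt (by simp)).clm_apply (differentiableAt_const _)
  refine ⟨_, hdiff.hasFDerivAt, fun X => ?_⟩
  have hA : HasFDerivAt (fun x => fderiv ℝ (chartMul n G) (e, x)) _ e :=
    hasFDerivAt_fderiv_chartMul.comp e (hasFDerivAt_prodMk_right _ _)
  have hB := hA.clm_apply (hdiff.hasFDerivAt.prodMk (hasFDerivAt_const (0 : EuclideanSpace ℝ (Fin n)) e))
  have hC := hB.unique ((hasFDerivAt_chartField Y).congr_of_eventuallyEq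
    (eventually_chartConj_fderiv.mono fun x hx => hx Y))
  have hD := congrArg (fun A => A X) hC
  have hY : fderiv ℝ (fun y => chartConj n G (e, y)) e Y = Y := by
    have : (fun y => chartConj n G (e, y)) =ᶠ[nhds e] id := by
      filter_upwards [extChartAt_target_mem_nhds (I := 𝓡 n) (1 : G)] with x hx
      simp only [chartConj, he, symm_chartOne, one_mul, inv_one, mul_one]
      exact (extChartAt (𝓡 n) (1 : G)).right_inv hx
    rw [this.fderiv_eq, fderiv_id]; rfl
  simp only [add_apply, ContinuousLinearMap.comp_apply,
    ContinuousLinearMap.flip_apply, ContinuousLinearMap.prod_apply, zero_apply,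
    ContinuousLinearMap.inr_apply, ContinuousLinearMap.inl_apply] at hD
  rw [fderiv_chartMul_inl, hY, fderiv_fderiv_chartMul_symm] at hD
  exact eq_sub_of_add_eq hD

end LieGroups

end

end CasimirRadial

namespace CasimirRadial

noncomputable section

/-! ### The differential of the adjoint representation -/

section LieGroups

open VectorField Filter Topology

variable {n : ℕ} {G : Type*} [TopologicalSpace G] [ChartedSpace (EuclideanSpace ℝ (Fin n)) G]
  [Group G] [LieGroup (𝓡 n) ∞ G]

/-- Left-invariant vector fields in the chart. -/
theorem eventually_mulInvariantVectorField_chart : ∀ᶠ x in 𝓝 (chartOne n G), ∀ X : LieAlg n G,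
    (mulInvariantVectorField (I := 𝓡 n) (G := G) X ((extChartAt (𝓡 n) (1 : G)).symm x) :
      EuclideanSpace ℝ (Fin n)) =
    mfderivWithin 𝓘(ℝ, EuclideanSpace ℝ (Fin n)) (𝓡 n) (extChartAt (𝓡 n) (1 : G)).symm
      (Set.range (𝓡 n)) x (fderiv ℝ (chartMul n G) (x, chartOne n G) (0, X) :
        EuclideanSpace ℝ (Fin n)) := by
  have hM : IsManifold (𝓡 n) ∞ G := inferInstance
  have hM1 : IsManifold (𝓡 n) 1 G := IsManifold.of_le (n := ∞) ENat.LEInfty.out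
  set e := chartOne n G with he
  set ψ := (extChartAt (𝓡 n) (1 : G)).symm with hψ
  have hpair : Tendsto (fun x => (x, e)) (𝓝 e) (𝓝 (e, e)) :=
    (continuous_id.prodMk continuous_const).tendsto e
  have hm : ∀ᶠ p in 𝓝 (e, e), DifferentiableAt ℝ (chartMul n G) p :=
    ((contDiffAt_chartMul.of_le (m := 1) ENat.LEInfty.out).eventually (by simp)).mono
      fun p hp => hp.differentiableAt (by simp)
  have hinv : ∀ᶠ p : EuclideanSpace ℝ (Fin n) × EuclideanSpace ℝ (Fin n) in 𝓝 (e, e),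
      ψ (chartMul n G p) = ψ p.1 * ψ p.2 := by
    have h1 : ContinuousAt (fun p : EuclideanSpace ℝ (Fin n) × EuclideanSpace ℝ (Fin n) =>
        ψ p.1 * ψ p.2) (e, e) :=
      ((contMDiffAt_chart_symm_comp (G := G) (contDiffAt_fst (𝕜 := ℝ) (n := ∞)
        (p := (e, e))) rfl).mul
          (contMDiffAt_chart_symm_comp contDiffAt_snd rfl)).continuousAt
    have h2 := h1.preimage_mem_nhds (t := (extChartAt (𝓡 n) (1 : G)).source) (by
      simp only [hψ, he, symm_chartOne, mul_one]
      exact extChartAt_source_mem_nhds 1)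
    filter_upwards [h2] with p hp
    exact (extChartAt (𝓡 n) (1 : G)).left_inv hp
  filter_upwards [hpair.eventually hm, hpair.eventually (eventually_eventually_nhds.mpr hinv),
    extChartAt_target_mem_nhds (I := 𝓡 n) (1 : G), chartMul_chartOne_right] with x h1 h2 h3 h4 X
  -- both sides are the derivative at `1` of `y ↦ ψ x * ψ y`, computed in two ways
  have hψd : ∀ z ∈ (extChartAt (𝓡 n) (1 : G)).target,
      HasMFDerivAt 𝓘(ℝ, EuclideanSpace ℝ (Fin n)) (𝓡 n) ψ z
        (mfderiv 𝓘(ℝ, EuclideanSpace ℝ (Fin n)) (𝓡 n) ψ z) := by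
    intro z hz
    have := mdifferentiableWithinAt_extChartAt_symm hz
    rw [ModelWithCorners.range_eq_univ, mdifferentiableWithinAt_univ] at this
    exact this.hasMFDerivAt
  have het : e ∈ (extChartAt (𝓡 n) (1 : G)).target := mem_extChartAt_target 1
  have hcm : HasFDerivAt (fun y => chartMul n G (x, y)) ((fderiv ℝ (chartMul n G) (x, e)).comp
      (ContinuousLinearMap.inr ℝ _ _)) e := h1.hasFDerivAt.comp e (hasFDerivAt_prodMk_right x e)
  have hA : HasMFDerivAt 𝓘(ℝ, EuclideanSpace ℝ (Fin n)) (𝓡 n) (fun y => ψ (chartMul n G (x, y))) e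
      ((mfderiv 𝓘(ℝ, EuclideanSpace ℝ (Fin n)) (𝓡 n) ψ (chartMul n G (x, e))).comp
        ((fderiv ℝ (chartMul n G) (x, e)).comp (ContinuousLinearMap.inr ℝ _ _))) :=
    HasMFDerivAt.comp e (hψd _ (by rw [h4]; exact h3)) hcm.hasMFDerivAt
  have hL : MDifferentiableAt (𝓡 n) (𝓡 n) (fun b : G => ψ x * b) (ψ e) :=
    (contMDiff_mul_left (I := 𝓡 n) (n := ∞)).mdifferentiable (by simp) _
  have hB : HasMFDerivAt 𝓘(ℝ, EuclideanSpace ℝ (Fin n)) (𝓡 n) (fun y => ψ x * ψ y) e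
      ((mfderiv (𝓡 n) (𝓡 n) (fun b : G => ψ x * b) (ψ e)).comp
        (mfderiv 𝓘(ℝ, EuclideanSpace ℝ (Fin n)) (𝓡 n) ψ e)) :=
    HasMFDerivAt.comp e hL.hasMFDerivAt (hψd _ het)
  have hev : (fun y => ψ (chartMul n G (x, y))) =ᶠ[𝓝 e] fun y => ψ x * ψ y :=
    (continuous_const.prodMk continuous_id).continuousAt.eventually h2
  let D : (EuclideanSpace ℝ (Fin n) → G) → EuclideanSpace ℝ (Fin n) → EuclideanSpace ℝ (Fin n) →
      EuclideanSpace ℝ (Fin n) :=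
    fun F x v => mfderiv 𝓘(ℝ, EuclideanSpace ℝ (Fin n)) (𝓡 n) F x v
  let D' : (G → G) → G → EuclideanSpace ℝ (Fin n) → EuclideanSpace ℝ (Fin n) :=
    fun F x v => mfderiv (𝓡 n) (𝓡 n) F x v
  have eA : D (fun y => ψ (chartMul n G (x, y))) e X =
      D ψ (chartMul n G (x, e)) (fderiv ℝ (chartMul n G) (x, e) (0, X)) :=
    congrArg (fun A : EuclideanSpace ℝ (Fin n) →L[ℝ] EuclideanSpace ℝ (Fin n) => A X) hA.mfderiv
  have eB : D (fun y => ψ x * ψ y) e X = D' (fun b => ψ x * b) (ψ e) (D ψ e X) :=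
    congrArg (fun A : EuclideanSpace ℝ (Fin n) →L[ℝ] EuclideanSpace ℝ (Fin n) => A X) hB.mfderiv
  have eAB : D (fun y => ψ (chartMul n G (x, y))) e X = D (fun y => ψ x * ψ y) e X :=
    congrArg (fun A : EuclideanSpace ℝ (Fin n) →L[ℝ] EuclideanSpace ℝ (Fin n) => A X)
      hev.mfderiv_eq
  have hid : D ψ e X = X := by
    have := mfderivWithin_range_extChartAt_symm (I := 𝓡 n) (x := (1 : G))
    rw [ModelWithCorners.range_eq_univ, mfderivWithin_univ] at this
    exact congrArg (fun A : EuclideanSpace ℝ (Fin n) →L[ℝ] EuclideanSpace ℝ (Fin n) => A X) this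
  rw [eA, eB, h4, hid] at eAB
  have hψe : ψ e = 1 := symm_chartOne
  rw [hψe] at eAB
  rw [ModelWithCorners.range_eq_univ, mfderivWithin_univ]
  exact eAB.symm

/-- The bracket is the antisymmetric part of the second derivative of the multiplication, since
`x ↦ ∂₂ m(x, 1) X` is the left-invariant field of `X`. -/
theorem bracket_eq_chartHess (X Y : LieAlg n G) :
    (⁅X, Y⁆ : LieAlg n G) = (chartHess n G X Y - chartHess n G Y X : EuclideanSpace ℝ (Fin n)) := by
  have hM : IsManifold (𝓡 n) ∞ G := inferInstance
  have hM1 : IsManifold (𝓡 n) 1 G := IsManifold.of_le (n := ∞) ENat.LEInfty.out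
  let V : EuclideanSpace ℝ (Fin n) → EuclideanSpace ℝ (Fin n) → EuclideanSpace ℝ (Fin n) := fun X =>
    mpullbackWithin 𝓘(ℝ, EuclideanSpace ℝ (Fin n)) (𝓡 n) (extChartAt (𝓡 n) (1 : G)).symm
      (mulInvariantVectorField (I := 𝓡 n) (G := G) (X : LieAlg n G)) (Set.range (𝓡 n))
  have hV : ∀ X : EuclideanSpace ℝ (Fin n), V X =ᶠ[𝓝 (chartOne n G)]
      fun x => fderiv ℝ (chartMul n G) (x, chartOne n G) (0, X) := by
    intro X
    filter_upwards [eventually_mulInvariantVectorField_chart,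
      extChartAt_target_mem_nhds (I := 𝓡 n) (1 : G)] with x hx hx'
    have hinv := isInvertible_mfderivWithin_extChartAt_symm (I := 𝓡 n) (x := (1 : G)) hx'
    exact hinv.inverse_apply_eq.mpr (hx X)
  let W : EuclideanSpace ℝ (Fin n) := lieBracketWithin ℝ (V X) (V Y)
    ((extChartAt (𝓡 n) (1 : G)).symm ⁻¹' Set.univ ∩ Set.range (𝓡 n)) (chartOne n G)
  have h1 : (⁅X, Y⁆ : LieAlg n G) = (mfderiv (𝓡 n) 𝓘(ℝ, EuclideanSpace ℝ (Fin n))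
      (extChartAt (𝓡 n) (1 : G)) 1).inverse W := rfl
  have h2 : ∀ X Y : EuclideanSpace ℝ (Fin n), lieBracketWithin ℝ (V X) (V Y)
      ((extChartAt (𝓡 n) (1 : G)).symm ⁻¹' Set.univ ∩ Set.range (𝓡 n)) (chartOne n G) =
        chartHess n G X Y - chartHess n G Y X := by
    intro X Y
    rw [ModelWithCorners.range_eq_univ, Set.preimage_univ, Set.univ_inter, lieBracketWithin_univ,
      lieBracket, (hV X).fderiv_eq, (hV Y).fderiv_eq, (hV X).eq_of_nhds, (hV Y).eq_of_nhds,
      fderiv_chartMul_inr, fderiv_chartMul_inr, (hasFDerivAt_chartField _).fderiv,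
      (hasFDerivAt_chartField _).fderiv]
    rfl
  rw [h1, mfderiv_extChartAt_self]
  exact (congrArg (fun A : EuclideanSpace ℝ (Fin n) →L[ℝ] EuclideanSpace ℝ (Fin n) => A W)
    ContinuousLinearMap.inverse_id).trans (h2 X Y)

/-- The derivative of `s ↦ Ad(γ(s)) Y` at `0` along a one-parameter subgroup `γ` with initial velocity
`X` is `[X, Y]`. -/
theorem hasDerivAt_Ad_zero {γ : ℝ → G} {X : LieAlg n G} (hγ : IsOneParameterSubgroup γ X)
    (Y : LieAlg n G) :
    HasDerivAt (fun s => (Ad n (γ s) Y : EuclideanSpace ℝ (Fin n)))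
      (⁅X, Y⁆ : LieAlg n G) 0 := by
  have hM : IsManifold (𝓡 n) ∞ G := inferInstance
  obtain ⟨hmul, hsm, hvel⟩ := hγ
  have h0 : γ 0 = 1 := by
    have := hmul 0 0
    rw [add_zero] at this
    exact left_eq_mul.mp this
  set φ := extChartAt (𝓡 n) (1 : G) with hφ
  have hd : MDifferentiableAt 𝓘(ℝ, ℝ) (𝓡 n) γ 0 := hsm.mdifferentiable (by simp) 0
  have hη : HasDerivAt (fun s => φ (γ s)) X 0 := by
    let A : ℝ →L[ℝ] EuclideanSpace ℝ (Fin n) := mfderiv 𝓘(ℝ, ℝ) (𝓡 n) γ 0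
    have h : HasFDerivWithinAt (extChartAt (𝓡 n) (γ 0) ∘ γ ∘ (extChartAt 𝓘(ℝ, ℝ) (0 : ℝ)).symm) A
      (Set.range 𝓘(ℝ, ℝ)) (extChartAt 𝓘(ℝ, ℝ) (0 : ℝ) 0) := hd.hasMFDerivAt.2
    rw [ModelWithCorners.range_eq_univ, hasFDerivWithinAt_univ, h0] at h
    have h' := h.hasDerivAt
    have hA : A 1 = X := hvel
    rw [hA] at h'
    exact h'
  obtain ⟨A, hA, hAX⟩ := hasFDerivAt_chartAd (n := n) (G := G) Y
  have hη0 : φ (γ 0) = chartOne n G := by rw [h0]; rfl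
  rw [← hη0] at hA
  have h1 : HasDerivAt ((fun x => fderiv ℝ (fun y => chartConj n G (x, y)) (φ (γ 0)) Y) ∘
      fun s => φ (γ s)) (A X) 0 := HasFDerivAt.comp_hasDerivAt 0 hA hη
  have hAX' : A X = (⁅X, Y⁆ : LieAlg n G) := (hAX X).trans (bracket_eq_chartHess X Y).symm
  refine (hAX' ▸ h1).congr_of_eventuallyEq ?_
  have hs : ∀ᶠ s in 𝓝 (0 : ℝ), γ s ∈ φ.source :=
    hd.continuousAt.preimage_mem_nhds (by rw [h0]; exact extChartAt_source_mem_nhds 1)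
  filter_upwards [hs] with s hs
  refine (Ad_eq_fderiv (γ s) Y).trans ?_
  simp only [Function.comp_apply, chartConj]
  rw [← hφ, φ.left_inv hs, hη0]
  rfl

end LieGroups

end

end CasimirRadial

namespace CasimirRadial

noncomputable section

/-! ### One-parameter subgroups and the exponential map -/

section LieGroups

open VectorField Filter Topology

variable {n : ℕ} {G : Type*} [TopologicalSpace G] [ChartedSpace (EuclideanSpace ℝ (Fin n)) G]
  [Group G] [LieGroup (𝓡 n) ∞ G]

theorem mfderiv_mul_left_mulInvariantVectorField (g h : G) (X : LieAlg n G) :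
    (mfderiv (𝓡 n) (𝓡 n) (fun b : G => g * b) h (mulInvariantVectorField X h) :
      EuclideanSpace ℝ (Fin n)) = mulInvariantVectorField (I := 𝓡 n) X (g * h) := by
  let D : (G → G) → G → EuclideanSpace ℝ (Fin n) → EuclideanSpace ℝ (Fin n) :=
    fun F x v => mfderiv (𝓡 n) (𝓡 n) F x v
  have hL : ∀ a : G, MDifferentiable (𝓡 n) (𝓡 n) (fun b : G => a * b) := fun a =>
    (contMDiff_mul_left (I := 𝓡 n) (n := ∞)).mdifferentiable (by simp)
  change D (fun b => g * b) h (D (fun b => h * b) 1 X) = D (fun b => g * h * b) 1 X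
  have e1 : (fun b => g * h * b) = (fun b => g * b) ∘ fun b => h * b := by
    funext b; simp [mul_assoc]
  have e2 : D ((fun b => g * b) ∘ fun b => h * b) 1 X =
      D (fun b => g * b) (h * 1) (D (fun b => h * b) 1 X) :=
    mfderiv_comp_apply (I' := 𝓡 n) 1 (hL _ _) (hL _ _) X
  rw [e1, e2, mul_one]

/-- Left translates of integral curves of left-invariant fields are integral curves. -/
theorem isMIntegralCurveOn_mul_left {γ : ℝ → G} {X : LieAlg n G} {s : Set ℝ}
    (hγ : IsMIntegralCurveOn γ (mulInvariantVectorField (I := 𝓡 n) X) s) (g : G) :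
    IsMIntegralCurveOn (fun t => g * γ t) (mulInvariantVectorField (I := 𝓡 n) X) s := by
  intro t ht
  have hL : MDifferentiableAt (𝓡 n) (𝓡 n) (fun b : G => g * b) (γ t) :=
    (contMDiff_mul_left (I := 𝓡 n) (n := ∞)).mdifferentiable (by simp) _
  have h := hL.hasMFDerivAt.comp_hasMFDerivWithinAt t (hγ t ht)
  refine h.congr_mfderiv ?_
  refine ContinuousLinearMap.ext_ring ?_
  have e1 := mfderiv_mul_left_mulInvariantVectorField g (γ t) X
  let A : EuclideanSpace ℝ (Fin n) →L[ℝ] EuclideanSpace ℝ (Fin n) :=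
    mfderiv (𝓡 n) (𝓡 n) (fun b : G => g * b) (γ t)
  let v : EuclideanSpace ℝ (Fin n) := mulInvariantVectorField (I := 𝓡 n) X (γ t)
  let w : EuclideanSpace ℝ (Fin n) := mulInvariantVectorField (I := 𝓡 n) X (g * γ t)
  change A ((1 : ℝ) • v) = (1 : ℝ) • w
  rw [one_smul, one_smul]
  exact e1

/-- The integral curve through `1` of a left-invariant field is defined for all times, since a
local solution can be translated to every point, and it is a homomorphism by uniqueness. -/
theorem exists_isMIntegralCurve (X : LieAlg n G) :
    ∃ γ : ℝ → G, γ 0 = 1 ∧ IsMIntegralCurve γ (mulInvariantVectorField (I := 𝓡 n) X) ∧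
      ∀ r s, γ (r + s) = γ r * γ s := by
  have hM1 : IsManifold (𝓡 n) 1 G := IsManifold.of_le (n := ∞) ENat.LEInfty.out
  have hT1 : T1Space G := ChartedSpace.t1Space (EuclideanSpace ℝ (Fin n)) G
  have hTG : IsTopologicalGroup G := topologicalGroup_of_lieGroup (𝓡 n) ∞
  have hT2 : T2Space G := inferInstance
  have hv : ContMDiff (𝓡 n) (𝓡 n).tangent 1 fun x : G =>
      (⟨x, mulInvariantVectorField X x⟩ : TangentBundle (𝓡 n) G) := by
    refine (contMDiff_mulInvariantVectorField (I := 𝓡 n) X).of_le ?_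
    rw [minSmoothness_of_isRCLikeNormedField]
    norm_num
  obtain ⟨γ₀, h0, hγ₀⟩ := exists_isMIntegralCurveAt_of_contMDiffAt_boundaryless 0
    (hv (1 : G))
  obtain ⟨ε, hε, hγ₀⟩ := isMIntegralCurveAt_iff'.mp hγ₀
  rw [Real.ball_eq_Ioo, zero_sub, zero_add] at hγ₀
  obtain ⟨γ, h1, hγ⟩ := exists_isMIntegralCurve_of_isMIntegralCurveOn hv hε
    (fun g => ⟨fun t => g * γ₀ t, by simp [h0], isMIntegralCurveOn_mul_left hγ₀ g⟩) 1
  refine ⟨γ, h1, hγ, fun r s => ?_⟩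
  have hs := hγ.comp_add r
  have hl : IsMIntegralCurve (fun t => γ r * γ t) (mulInvariantVectorField (I := 𝓡 n) X) :=
    isMIntegralCurve_iff_isMIntegralCurveOn.mpr
      (isMIntegralCurveOn_mul_left (isMIntegralCurve_iff_isMIntegralCurveOn.mp hγ) _)
  have := isMIntegralCurve_Ioo_eq_of_contMDiff_boundaryless (t₀ := 0) hv hs hl (by simp [h1])
  rw [add_comm]
  exact congrFun this s

/-- Solutions of an autonomous differential equation are as smooth as the equation. -/
theorem contDiffOn_of_hasDerivAt {E : Type*} [NormedAddCommGroup E] [NormedSpace ℝ E] {m : ℕ}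
    {F : E → E} {U : Set E} (hF : ContDiffOn ℝ m F U) {J : Set ℝ} (hJ : IsOpen J) {η : ℝ → E}
    (hη : ∀ t ∈ J, η t ∈ U ∧ HasDerivAt η (F (η t)) t) : ContDiffOn ℝ m η J := by
  have hd : DifferentiableOn ℝ η J := fun t ht => (hη t ht).2.differentiableAt.differentiableWithinAt
  have key : ∀ k : ℕ, k ≤ m → ContDiffOn ℝ k η J := by
    intro k
    induction k with
    | zero => intro _; exact contDiffOn_zero.mpr hd.continuousOn
    | succ k ih =>
      intro hk
      have h := ih (by omega)
      rw [Nat.cast_succ, contDiffOn_succ_iff_deriv_of_isOpen hJ]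
      refine ⟨hd, by simp, ?_⟩
      refine ContDiffOn.congr (f := F ∘ η) ?_ fun t ht => (hη t ht).2.deriv
      exact (hF.of_le (by exact_mod_cast (by omega : k ≤ m))).comp h fun t ht => (hη t ht).1
  exact key m le_rfl

/-- Integral curves of left-invariant fields are smooth. -/
theorem contMDiff_of_isMIntegralCurve {γ : ℝ → G} {X : LieAlg n G} (h0 : γ 0 = 1)
    (hγ : IsMIntegralCurve γ (mulInvariantVectorField (I := 𝓡 n) X))
    (hmul : ∀ r s, γ (r + s) = γ r * γ s) : ContMDiff 𝓘(ℝ, ℝ) (𝓡 n) ∞ γ := by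
  have hM : IsManifold (𝓡 n) ∞ G := inferInstance
  have hM1 : IsManifold (𝓡 n) 1 G := IsManifold.of_le (n := ∞) ENat.LEInfty.out
  -- translation reduces the claim to a neighbourhood of `0`, where it is an equation in the chart
  suffices h : ∀ m : ℕ, ContMDiffAt 𝓘(ℝ, ℝ) (𝓡 n) m γ 0 by
    refine contMDiff_infty.mpr fun m t₀ => ?_
    have hM : IsManifold (𝓡 n) m G := IsManifold.of_le (n := ∞) ENat.LEInfty.out
    have h1 : γ = (fun b => γ t₀ * b) ∘ γ ∘ fun t => t - t₀ := by
      funext t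
      simp only [Function.comp_apply]
      rw [← hmul]; congr 1; ring
    have h2 : ContMDiffAt 𝓘(ℝ, ℝ) 𝓘(ℝ, ℝ) m (fun t : ℝ => t - t₀) t₀ :=
      (contDiff_id.sub contDiff_const).contMDiff.contMDiffAt
    rw [h1]
    refine ContMDiffAt.comp (I' := 𝓡 n) t₀ ?_ (ContMDiffAt.comp (I' := 𝓘(ℝ, ℝ)) t₀ ?_ h2)
    · exact ((contMDiff_mul_left (I := 𝓡 n) (n := ∞)).of_le ENat.LEInfty.out).contMDiffAt
    · rw [sub_self]; exact h m
  intro m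
  set φ := extChartAt (𝓡 n) (1 : G) with hφ
  let F : EuclideanSpace ℝ (Fin n) → EuclideanSpace ℝ (Fin n) := fun x =>
    fderiv ℝ (chartMul n G) (x, chartOne n G) (0, X)
  have hF : ContDiffAt ℝ m F (chartOne n G) := by
    have h1 : ContDiffAt ℝ m (fderiv ℝ (chartMul n G)) (chartOne n G, chartOne n G) :=
      contDiffAt_chartMul.fderiv_right (m := m) (by exact_mod_cast le_top)
    exact (ContDiffAt.comp (g := fderiv ℝ (chartMul n G)) (f := fun x => (x, chartOne n G))
      (chartOne n G) h1 (contDiffAt_id.prodMk contDiffAt_const)).clm_apply contDiffAt_const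
  obtain ⟨U, hU, hFU⟩ := hF.contDiffOn le_rfl (by simp)
  have hcont : ContinuousAt γ 0 := (hγ 0).1
  have hsrc : ∀ᶠ t in 𝓝 (0 : ℝ), γ t ∈ φ.source :=
    hcont.preimage_mem_nhds (by rw [h0]; exact extChartAt_source_mem_nhds 1)
  have hφc : Tendsto (fun t => φ (γ t)) (𝓝 0) (𝓝 (chartOne n G)) := by
    have : ContinuousAt φ (γ 0) := by rw [h0]; exact continuousAt_extChartAt 1
    have h2 := this.tendsto.comp hcont
    rw [h0] at h2
    exact h2
  obtain ⟨J, hJ, hJo, hJ0⟩ := mem_nhds_iff.mp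
    (hsrc.and ((hφc.eventually hU).and (hφc.eventually eventually_mulInvariantVectorField_chart)))
  have hη : ∀ t ∈ J, φ (γ t) ∈ U ∧ HasDerivAt (fun t => φ (γ t)) (F (φ (γ t))) t := by
    intro t ht
    obtain ⟨h1, h2, h3⟩ := hJ ht
    refine ⟨h2, ?_⟩
    have h4 : HasMFDerivAt (𝓡 n) 𝓘(ℝ, EuclideanSpace ℝ (Fin n)) φ (γ t)
        (mfderiv (𝓡 n) 𝓘(ℝ, EuclideanSpace ℝ (Fin n)) φ (γ t)) :=
      (mdifferentiableAt_extChartAt (by rw [extChartAt_source] at h1; exact h1)).hasMFDerivAt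
    have h6 := h3 X
    rw [φ.left_inv h1] at h6
    have h7 := mfderiv_extChartAt_comp_mfderivWithin_extChartAt_symm' (I := 𝓡 n) h1
    let A : EuclideanSpace ℝ (Fin n) →L[ℝ] EuclideanSpace ℝ (Fin n) :=
      mfderiv (𝓡 n) 𝓘(ℝ, EuclideanSpace ℝ (Fin n)) φ (γ t)
    let C : EuclideanSpace ℝ (Fin n) →L[ℝ] EuclideanSpace ℝ (Fin n) :=
      mfderivWithin 𝓘(ℝ, EuclideanSpace ℝ (Fin n)) (𝓡 n) (extChartAt (𝓡 n) (1 : G)).symm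
      (Set.range (𝓡 n)) (φ (γ t))
    let v : EuclideanSpace ℝ (Fin n) := mulInvariantVectorField (I := 𝓡 n) X (γ t)
    have h5 : HasFDerivAt (fun t => φ (γ t)) (A.comp ((1 : ℝ →L[ℝ] ℝ).smulRight v)) t :=
      (HasMFDerivAt.comp t h4 (hγ t)).hasFDerivAt
    have h6' : v = C (F (φ (γ t))) := h6
    have h7' : A.comp C = ContinuousLinearMap.id ℝ _ := h7
    have h8 : A ((1 : ℝ) • v) = F (φ (γ t)) := by
      rw [one_smul, h6']
      exact congrArg (fun A : EuclideanSpace ℝ (Fin n) →L[ℝ] EuclideanSpace ℝ (Fin n) =>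
        A (F (φ (γ t)))) h7'
    exact h8 ▸ h5.hasDerivAt
  have hsm := (contDiffOn_of_hasDerivAt hFU hJo hη).contDiffAt (hJo.mem_nhds hJ0)
  have h9 : ContMDiffAt 𝓘(ℝ, ℝ) (𝓡 n) m (fun t => φ.symm (φ (γ t))) 0 := by
    refine ContMDiffAt.comp (I' := 𝓘(ℝ, EuclideanSpace ℝ (Fin n))) 0 ?_ hsm.contMDiffAt
    rw [h0]
    exact contMDiffAt_chart_symm.of_le ENat.LEInfty.out
  refine h9.congr_of_eventuallyEq ?_
  filter_upwards [hsrc] with t ht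
  rw [φ.left_inv ht]

/-- Every element of the Lie algebra is the initial velocity of a one-parameter subgroup. -/
theorem exists_isOneParameterSubgroup (X : LieAlg n G) :
    ∃ γ : ℝ → G, IsOneParameterSubgroup γ X := by
  obtain ⟨γ, h0, hγ, hmul⟩ := exists_isMIntegralCurve X
  refine ⟨γ, hmul, contMDiff_of_isMIntegralCurve h0 hγ hmul, ?_⟩
  have h1 := (hγ 0).mfderiv
  have h2 : (mulInvariantVectorField (I := 𝓡 n) X (γ 0) : EuclideanSpace ℝ (Fin n)) = X := by
    rw [h0]
    change mfderiv (𝓡 n) (𝓡 n) (fun b : G => 1 * b) 1 X = X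
    have : (fun b : G => 1 * b) = id := by funext b; simp
    rw [this, mfderiv_id]
    rfl
  let v : EuclideanSpace ℝ (Fin n) := mulInvariantVectorField (I := 𝓡 n) X (γ 0)
  have h3 : (mfderiv 𝓘(ℝ, ℝ) (𝓡 n) γ 0 (1 : ℝ) : EuclideanSpace ℝ (Fin n)) = (1 : ℝ) • v :=
    congrArg (fun A : ℝ →L[ℝ] EuclideanSpace ℝ (Fin n) => A 1) h1
  rw [h3, one_smul]
  exact h2

theorem exists_lieExp_eq (X : LieAlg n G) :
    ∃ γ : ℝ → G, IsOneParameterSubgroup γ X ∧ lieExp X = γ 1 := by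
  have h := exists_isOneParameterSubgroup X
  exact ⟨h.choose, h.choose_spec, dif_pos h⟩

theorem IsOneParameterSubgroup.map_zero {γ : ℝ → G} {X : LieAlg n G}
    (hγ : IsOneParameterSubgroup γ X) : γ 0 = 1 := by
  have := hγ.1 0 0
  rw [add_zero] at this
  exact left_eq_mul.mp this

/-- `d/ds Ad(γ(s)) Y = Ad(γ(s)) [X, Y]`. -/
theorem hasDerivAt_Ad {γ : ℝ → G} {X : LieAlg n G} (hγ : IsOneParameterSubgroup γ X)
    (Y : LieAlg n G) (s : ℝ) :
    HasDerivAt (fun s => (Ad n (γ s) Y : EuclideanSpace ℝ (Fin n)))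
      (Ad n (γ s) (⁅X, Y⁆ : LieAlg n G)) s := by
  let A : EuclideanSpace ℝ (Fin n) →L[ℝ] EuclideanSpace ℝ (Fin n) :=
    mfderiv (𝓡 n) (𝓡 n) (conjAut n (γ s)).toMulEquiv (1 : G)
  have h0 := hasDerivAt_Ad_zero hγ Y
  have h1 : HasDerivAt (fun r => A (Ad n (γ r) Y : EuclideanSpace ℝ (Fin n)))
      (A (⁅X, Y⁆ : LieAlg n G)) (s - s) := by
    rw [sub_self]
    exact A.hasFDerivAt.comp_hasDerivAt 0 h0
  have h2 := h1.comp_sub_const s s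
  refine h2.congr_of_eventuallyEq (Filter.Eventually.of_forall fun r => ?_)
  have : γ r = γ s * γ (r - s) := by rw [← hγ.1]; congr 1; ring
  change Ad n (γ r) Y = Ad n (γ s) (Ad n (γ (r - s)) Y)
  rw [this, Ad_mul]

/-- `Ad(exp X)` acts on an eigenvector of `ad X` by the exponential of the eigenvalue. -/
theorem homC_Ad_lieExp (X : LieAlg n G) {v : Cx (LieAlg n G)} {z : ℂ}
    (hv : LieAlgebra.ad ℂ (Cx (LieAlg n G)) ((1 : ℂ) ⊗ₜ[ℝ] X) v = z • v) :
    homC (Ad n (lieExp X)) v = Complex.exp z • v := by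
  obtain ⟨γ, hγ, hX⟩ := exists_lieExp_eq X
  rw [hX]
  let b := Module.finBasis ℝ (LieAlg n G)
  let bC := Algebra.TensorProduct.basis ℂ b
  refine bC.ext_elem fun i => ?_
  let f : Cx (LieAlg n G) →ₗ[ℂ] ℂ := bC.coord i
  have hf : ∀ (w : ℂ) (Y : LieAlg n G), f (w ⊗ₜ[ℝ] Y) = w * (b.coord i Y : ℝ) := by
    intro w Y
    change bC.repr (w ⊗ₜ[ℝ] Y) i = _
    simp [bC, Algebra.TensorProduct.basis_repr_tmul]
  have hd : ∀ (w : Cx (LieAlg n G)) (s : ℝ), HasDerivAt (fun s => f (homC (Ad n (γ s)) w))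
      (f (homC (Ad n (γ s)) (LieAlgebra.ad ℂ (Cx (LieAlg n G)) ((1 : ℂ) ⊗ₜ[ℝ] X) w))) s := by
    intro w s
    induction w using TensorProduct.induction_on with
    | zero => simpa using hasDerivAt_const s (0 : ℂ)
    | tmul w Y =>
      have h1 : LieAlgebra.ad ℂ (Cx (LieAlg n G)) ((1 : ℂ) ⊗ₜ[ℝ] X) (w ⊗ₜ[ℝ] Y) =
          w ⊗ₜ[ℝ] ⁅X, Y⁆ := by
        rw [LieAlgebra.ad_apply, LieAlgebra.ExtendScalars.bracket_tmul, one_mul]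
      rw [h1]
      simp only [homC_tmul, hf]
      let ℓ : EuclideanSpace ℝ (Fin n) →L[ℝ] ℝ :=
        LinearMap.toContinuousLinearMap (b.coord i : EuclideanSpace ℝ (Fin n) →ₗ[ℝ] ℝ)
      have h2 : HasDerivAt (fun s => ℓ (Ad n (γ s) Y : EuclideanSpace ℝ (Fin n)))
        (ℓ (Ad n (γ s) (⁅X, Y⁆ : LieAlg n G))) s :=
        ℓ.hasFDerivAt.comp_hasDerivAt s (hasDerivAt_Ad hγ Y s)
      exact h2.ofReal_comp.const_mul w
    | add w₁ w₂ h₁ h₂ =>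
      simp only [map_add]
      exact h₁.add h₂
  have hu : ∀ s, HasDerivAt (fun s => f (homC (Ad n (γ s)) v))
      (z * f (homC (Ad n (γ s)) v)) s := by
    intro s
    have h := hd v s
    rwa [hv, map_smul, map_smul, smul_eq_mul] at h
  -- each coordinate `u` of `Ad(γ(s)) v` solves `u' = z u`, so that `exp(-z s) u(s)` is constant
  have hconst : ∀ s : ℝ, HasDerivAt (fun s : ℝ => Complex.exp (-(z * s)) * f (homC (Ad n (γ s)) v))
      0 s := by
    intro s
    have h1 : HasDerivAt (fun s : ℝ => Complex.exp (-(z * s))) (Complex.exp (-(z * s)) * (-(z * 1))) s :=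
      (((Complex.ofRealCLM.hasDerivAt (x := s)).const_mul z).neg).cexp
    have h2 := h1.mul (hu s)
    refine h2.congr_deriv ?_
    ring
  have h3 := is_const_of_deriv_eq_zero (fun s => (hconst s).differentiableAt)
    (fun s => (hconst s).deriv) 1 0
  have hone : ∀ w : Cx (LieAlg n G), homC (Ad n (1 : G)) w = w := by
    intro w
    induction w using TensorProduct.induction_on with
    | zero => simp
    | tmul w Y => rw [homC_tmul, Ad_one]
    | add w₁ w₂ h₁ h₂ => rw [map_add, h₁, h₂]
  simp only [hγ.map_zero, hone, Complex.ofReal_one, Complex.ofReal_zero, mul_one, mul_zero,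
    neg_zero, Complex.exp_zero, one_mul] at h3
  change f _ = f _
  rw [map_smul, ← h3, smul_eq_mul, ← mul_assoc, ← Complex.exp_add]
  simp

/-- An `Ad(G)`-invariant form is `ad`-invariant. -/
theorem form_bracket (B : LinearMap.BilinForm ℝ (LieAlg n G))
    (hB : ∀ (g : G) X Y, B (Ad n g X) (Ad n g Y) = B X Y) (X Y Z : LieAlg n G) :
    B ⁅X, Y⁆ Z = -B Y ⁅X, Z⁆ := by
  obtain ⟨γ, hγ⟩ := exists_isOneParameterSubgroup X
  let ℓ₁ : EuclideanSpace ℝ (Fin n) →L[ℝ] ℝ :=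
    LinearMap.toContinuousLinearMap (B.flip Z : EuclideanSpace ℝ (Fin n) →ₗ[ℝ] ℝ)
  let ℓ₂ : EuclideanSpace ℝ (Fin n) →L[ℝ] ℝ :=
    LinearMap.toContinuousLinearMap (B Y : EuclideanSpace ℝ (Fin n) →ₗ[ℝ] ℝ)
  have h1 : HasDerivAt (fun s => ℓ₁ (Ad n (γ s) Y : EuclideanSpace ℝ (Fin n)))
      (ℓ₁ (⁅X, Y⁆ : LieAlg n G)) 0 := ℓ₁.hasFDerivAt.comp_hasDerivAt 0 (hasDerivAt_Ad_zero hγ Y)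
  have h2 : HasDerivAt (fun s => ℓ₂ (Ad n (γ s) Z : EuclideanSpace ℝ (Fin n)))
      (ℓ₂ (⁅X, Z⁆ : LieAlg n G)) (-0) := by
    rw [neg_zero]
    exact ℓ₂.hasFDerivAt.comp_hasDerivAt 0 (hasDerivAt_Ad_zero hγ Z)
  have h3 := h2.scomp 0 (hasDerivAt_neg (0 : ℝ))
  have h4 : (fun s => ℓ₁ (Ad n (γ s) Y : EuclideanSpace ℝ (Fin n))) =
      (fun s => ℓ₂ (Ad n (γ s) Z : EuclideanSpace ℝ (Fin n))) ∘ fun s => -s := by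
    funext s
    change B (Ad n (γ s) Y) Z = B Y (Ad n (γ (-s)) Z)
    rw [← hB (γ (-s)), ← Ad_mul, ← hγ.1, neg_add_cancel, hγ.map_zero, Ad_one]
  rw [h4] at h1
  have h5 := h1.unique h3
  change B ⁅X, Y⁆ Z = (-1 : ℝ) • B Y ⁅X, Z⁆ at h5
  rw [h5, neg_one_smul]

end LieGroups

end

end CasimirRadial

namespace CasimirRadial

noncomputable section

attribute [local instance 100] LieRing.ofAssociativeRing

/-! ### Semisimple endomorphisms and the root space decomposition -/

section Semisimple

/-- An endomorphism that is symmetric or skew for a definite form is semisimple: orthogonal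
complements of invariant subspaces are invariant. -/
theorem isSemisimple_of_adjoint {V : Type*} [AddCommGroup V] [Module ℝ V] [Module.Finite ℝ V]
    (β : LinearMap.BilinForm ℝ V) (hs : ∀ x y, β x y = β y x) (hp : ∀ x, x ≠ 0 → 0 < β x x)
    (f : Module.End ℝ V) (r : ℝ) (hf : ∀ x y, β (f x) y = r * β x (f y)) : f.IsSemisimple := by
  rw [Module.End.isSemisimple_iff]
  have hr : r = 0 → f = 0 := fun h => LinearMap.ext fun x => by
    by_contra hx
    have h1 := hp _ hx
    rw [hf, h, zero_mul] at h1
    exact lt_irrefl _ h1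
  intro p hp'
  refine ⟨β.orthogonal p, ?_, ?_⟩
  · intro x hx
    change ∀ n ∈ p, β n (f x) = 0
    intro n hn
    by_cases h : r = 0
    · rw [hr h]; simp
    · have h1 := hf n x
      rw [hx (f n) (hp' hn), eq_comm, mul_eq_zero] at h1
      exact h1.resolve_left h
  · refine LinearMap.BilinForm.isCompl_orthogonal_of_restrict_nondegenerate
      (fun x y h => by rw [hs, h]) ⟨fun x hx => ?_, fun x hx => ?_⟩
    all_goals
      by_contra h
      exact (hp x (fun h2 => h (Subtype.ext h2))).ne' (hx x)

/-- Over a perfect field, scalar extension preserves semisimplicity. -/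
theorem isSemisimple_baseChange {V : Type*} [AddCommGroup V] [Module ℝ V] [Module.Finite ℝ V]
    {f : Module.End ℝ V} (hf : f.IsSemisimple) :
    Module.End.IsSemisimple (M := ℂ ⊗[ℝ] V) (f.baseChange ℂ) := by
  have h1 : ((minpoly ℝ f).map (algebraMap ℝ ℂ)).Separable :=
    (PerfectField.separable_iff_squarefree.mpr hf.minpoly_squarefree).map
  refine Module.End.isSemisimple_of_squarefree_aeval_eq_zero h1.squarefree ?_
  rw [Polynomial.aeval_map_algebraMap]
  have h2 := Polynomial.aeval_algHom_apply (Module.End.baseChangeHom ℝ ℂ V) f (minpoly ℝ f)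
  rw [minpoly.aeval, map_zero] at h2
  exact h2

variable {L : Type*} [LieRing L] [LieAlgebra ℝ L]

theorem one_tmul_smul (r : ℝ) (Z : L) : (1 : ℂ) ⊗ₜ[ℝ] (r • Z) = (r : ℂ) • ((1 : ℂ) ⊗ₜ[ℝ] Z : Cx L) := by
  rw [← TensorProduct.smul_tmul, TensorProduct.smul_tmul', Complex.real_smul, smul_eq_mul]

theorem ad_one_tmul (Z : L) :
    (LieAlgebra.ad ℂ (Cx L) ((1 : ℂ) ⊗ₜ[ℝ] Z) : Module.End ℂ (Cx L)) =
      (LieAlgebra.ad ℝ L Z : Module.End ℝ L).baseChange ℂ := by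
  ext X
  simp

theorem commute_ad_one_tmul {X Y : L} (h : ⁅X, Y⁆ = 0) :
    Commute (LieAlgebra.ad ℂ (Cx L) ((1 : ℂ) ⊗ₜ[ℝ] X))
      (LieAlgebra.ad ℂ (Cx L) ((1 : ℂ) ⊗ₜ[ℝ] Y)) := by
  have h' : ⁅(1 : ℂ) ⊗ₜ[ℝ] X, (1 : ℂ) ⊗ₜ[ℝ] Y⁆ = (0 : Cx L) := by
    rw [LieAlgebra.ExtendScalars.bracket_tmul, h, TensorProduct.tmul_zero]
  rw [commute_iff_lie_eq, ← LieHom.map_lie, h', map_zero]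

/-- The root spaces are in direct sum. -/
theorem iSupIndep_rootSpace (c : LieSubalgebra ℝ L) (hc : ∀ X ∈ c, ∀ Y ∈ c, ⁅X, Y⁆ = 0) :
    iSupIndep (rootSpace c) := by
  have hind := Module.End.independent_iInf_maxGenEigenspace_of_forall_mapsTo
    (fun Z : c => LieAlgebra.ad ℂ (Cx L) ((1 : ℂ) ⊗ₜ[ℝ] (Z : L)))
    (fun i j φ => Module.End.mapsTo_maxGenEigenspace_of_comm
      (commute_ad_one_tmul (hc _ j.2 _ i.2)) φ)
  refine (hind.comp (f := fun α : c →ₗ[ℝ] ℂ => (α : c → ℂ)) DFunLike.coe_injective).mono ?_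
  intro α
  refine le_iInf fun Z X hX => ?_
  refine (Module.End.mem_maxGenEigenspace _ _ _).mpr ⟨1, ?_⟩
  have := hX Z
  simp only [pow_one, LinearMap.sub_apply, LinearMap.smul_apply, Module.End.one_apply]
  exact sub_eq_zero.mpr this

/-- If the elements of `𝔠` act semisimply and commute, then `𝔤_ℂ` is the sum of its root spaces. -/
theorem iSup_rootSpace_eq_top [Module.Finite ℝ L] (c : LieSubalgebra ℝ L)
    (hc : ∀ X ∈ c, ∀ Y ∈ c, ⁅X, Y⁆ = 0)
    (hss : ∀ X ∈ c, Module.End.IsSemisimple (LieAlgebra.ad ℝ L X : Module.End ℝ L)) :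
    ⨆ α, rootSpace c α = ⊤ := by
  set f : c → Module.End ℂ (Cx L) :=
    fun Z => LieAlgebra.ad ℂ (Cx L) ((1 : ℂ) ⊗ₜ[ℝ] (Z : L)) with hf
  have h := Module.End.iSup_iInf_maxGenEigenspace_eq_top_of_iSup_maxGenEigenspace_eq_top_of_commute
    f (fun i j _ => commute_ad_one_tmul (hc _ i.2 _ j.2))
    (fun i => Module.End.iSup_maxGenEigenspace_eq_top _)
  rw [eq_top_iff, ← h]
  refine iSup_le fun χ => ?_
  have hmem : ∀ X ∈ ⨅ i, (f i).maxGenEigenspace (χ i), ∀ i, f i X = χ i • X := by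
    intro X hX i
    have h1 := (Submodule.mem_iInf _).mp hX i
    have h2 : (f i).IsSemisimple := by
      rw [hf]; dsimp only; rw [ad_one_tmul]; exact isSemisimple_baseChange (hss _ i.2)
    rw [h2.isFinitelySemisimple.maxGenEigenspace_eq_eigenspace] at h1
    exact Module.End.mem_eigenspace_iff.mp h1
  by_cases hbot : (⨅ i, (f i).maxGenEigenspace (χ i)) = ⊥
  · rw [hbot]; exact bot_le
  obtain ⟨X, hX, hX0⟩ := Submodule.exists_mem_ne_zero_of_ne_bot hbot
  -- the system `χ` of eigenvalues of a nonzero simultaneous eigenvector is linear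
  let α : c →ₗ[ℝ] ℂ :=
    { toFun := χ
      map_add' := fun i j => smul_left_injective ℂ hX0 (by
        change χ (i + j) • X = (χ i + χ j) • X
        rw [add_smul, ← hmem X hX, ← hmem X hX, ← hmem X hX]
        change LieAlgebra.ad ℂ (Cx L) ((1 : ℂ) ⊗ₜ[ℝ] ((i : L) + (j : L))) X = _
        rw [TensorProduct.tmul_add, map_add]
        rfl)
      map_smul' := fun r i => smul_left_injective ℂ hX0 (by
        change χ (r • i) • X = (r • χ i) • X
        rw [Complex.real_smul, mul_smul, ← hmem X hX, ← hmem X hX]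
        change LieAlgebra.ad ℂ (Cx L) ((1 : ℂ) ⊗ₜ[ℝ] (r • (i : L))) X = _
        rw [one_tmul_smul, map_smul]
        rfl) }
  exact le_trans (show _ ≤ rootSpace c α from fun Y hY Z => hmem Y hY Z)
    (le_iSup (rootSpace c) α)

/-- Orthonormal bases exist for nondegenerate symmetric forms over `ℂ`. -/
theorem exists_orthonormal_basis {V : Type*} [AddCommGroup V] [Module ℂ V] [Module.Finite ℂ V]
    (β : LinearMap.BilinForm ℂ V) (hs : β.IsSymm) (hn : β.Nondegenerate) :
    ∃ e : Module.Basis (Fin (Module.finrank ℂ V)) ℂ V,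
      ∀ i j, β (e i) (e j) = if i = j then 1 else 0 := by
  obtain ⟨v, hv⟩ := LinearMap.BilinForm.exists_orthogonal_basis (B := β) ⟨hs.eq⟩
  have hne : ∀ i, β (v i) (v i) ≠ 0 := by
    intro i h
    refine v.ne_zero i (hn.1 _ fun y => ?_)
    rw [← v.sum_repr y, map_sum]
    refine Finset.sum_eq_zero fun j _ => ?_
    rw [map_smul]
    by_cases hij : i = j
    · rw [← hij, h, smul_zero]
    · rw [show β (v i) (v j) = 0 from hv hij, smul_zero]
  choose r hr using fun i => IsAlgClosed.exists_eq_mul_self (β (v i) (v i))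
  have hr0 : ∀ i, r i ≠ 0 := fun i h => hne i (by rw [hr, h, zero_mul])
  refine ⟨v.isUnitSMul (w := fun i => (r i)⁻¹) fun i => (IsUnit.mk0 _ (inv_ne_zero (hr0 i))),
    fun i j => ?_⟩
  rw [Module.Basis.isUnitSMul_apply, Module.Basis.isUnitSMul_apply, map_smul, map_smul,
    LinearMap.smul_apply, smul_eq_mul, smul_eq_mul]
  by_cases hij : i = j
  · subst hij
    rw [if_pos rfl, hr]
    have := hr0 i
    field_simp
  · rw [show β (v i) (v j) = 0 from hv hij, if_neg hij, mul_zero, mul_zero]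

end Semisimple

end

end CasimirRadial

namespace CasimirRadial

noncomputable section

attribute [local instance 100] LieRing.ofAssociativeRing

/-! ### Real and imaginary parts, complexified forms -/

section Complexification

variable {L : Type*} [LieRing L] [LieAlgebra ℝ L]

/-- The real part of an element of `𝔤_ℂ`. -/
def reCx (L : Type*) [LieRing L] [LieAlgebra ℝ L] : Cx L →ₗ[ℝ] L :=
  (TensorProduct.lid ℝ L).toLinearMap ∘ₗ LinearMap.rTensor L Complex.reLm

/-- The imaginary part of an element of `𝔤_ℂ`. -/
def imCx (L : Type*) [LieRing L] [LieAlgebra ℝ L] : Cx L →ₗ[ℝ] L :=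
  (TensorProduct.lid ℝ L).toLinearMap ∘ₗ LinearMap.rTensor L Complex.imLm

@[simp] theorem reCx_tmul (z : ℂ) (X : L) : reCx L (z ⊗ₜ[ℝ] X) = z.re • X := by
  simp [reCx]

@[simp] theorem imCx_tmul (z : ℂ) (X : L) : imCx L (z ⊗ₜ[ℝ] X) = z.im • X := by
  simp [imCx]

theorem eq_reCx_add_imCx (x : Cx L) :
    x = (1 : ℂ) ⊗ₜ[ℝ] reCx L x + Complex.I • ((1 : ℂ) ⊗ₜ[ℝ] imCx L x) := by
  induction x using TensorProduct.induction_on with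
  | zero => simp
  | tmul z X =>
    rw [reCx_tmul, imCx_tmul, one_tmul_smul, one_tmul_smul, smul_smul, ← add_smul,
      TensorProduct.smul_tmul', smul_eq_mul, mul_one, mul_comm Complex.I, Complex.re_add_im]
  | add x y hx hy =>
    rw [map_add, map_add, TensorProduct.tmul_add, TensorProduct.tmul_add, smul_add,
      add_add_add_comm, ← hx, ← hy]

theorem reCx_homC (f : L →ₗ⁅ℝ⁆ L) (x : Cx L) : reCx L (homC f x) = f (reCx L x) := by
  induction x using TensorProduct.induction_on with
  | zero => simp
  | tmul z X => rw [homC_tmul, reCx_tmul, reCx_tmul, map_smul]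
  | add x y hx hy => simp only [map_add, hx, hy]

theorem imCx_homC (f : L →ₗ⁅ℝ⁆ L) (x : Cx L) : imCx L (homC f x) = f (imCx L x) := by
  induction x using TensorProduct.induction_on with
  | zero => simp
  | tmul z X => rw [homC_tmul, imCx_tmul, imCx_tmul, map_smul]
  | add x y hx hy => simp only [map_add, hx, hy]

theorem one_tmul_injective {X Y : L} (h : (1 : ℂ) ⊗ₜ[ℝ] X = (1 : ℂ) ⊗ₜ[ℝ] Y) : X = Y := by
  simpa using congrArg (reCx L) h

theorem homC_comp_apply (f g : L →ₗ⁅ℝ⁆ L) (x : Cx L) :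
    homC (f.comp g) x = homC f (homC g x) := by
  induction x using TensorProduct.induction_on with
  | zero => simp
  | tmul z X => simp
  | add x y hx hy => simp only [map_add, hx, hy]

theorem mem_complexify_iff (S : LieSubalgebra ℝ L) (x : Cx L) :
    x ∈ complexify S ↔ reCx L x ∈ S ∧ imCx L x ∈ S := by
  constructor
  · intro hx
    change x ∈ S.toSubmodule.baseChange ℂ at hx
    have key : ∀ x ∈ S.toSubmodule.baseChange ℂ, ∀ z : ℂ,
        reCx L (z • x) ∈ S ∧ imCx L (z • x) ∈ S := by
      intro x hx
      rw [Submodule.baseChange_eq_span] at hx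
      induction hx using Submodule.span_induction with
      | mem x hx =>
        obtain ⟨y, hy, rfl⟩ := hx
        intro z
        rw [TensorProduct.mk_apply, TensorProduct.smul_tmul', reCx_tmul, imCx_tmul]
        exact ⟨S.smul_mem _ hy, S.smul_mem _ hy⟩
      | zero => intro z; rw [smul_zero, map_zero, map_zero]; exact ⟨S.zero_mem, S.zero_mem⟩
      | add x y _ _ hx hy =>
        intro z
        rw [smul_add, map_add, map_add]
        exact ⟨S.add_mem (hx z).1 (hy z).1, S.add_mem (hx z).2 (hy z).2⟩
      | smul r x _ hx => intro z; rw [smul_smul]; exact hx _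
    simpa using key x hx 1
  · rintro ⟨h1, h2⟩
    rw [eq_reCx_add_imCx x]
    exact add_mem (tmul_mem_complexify _ _ h1)
      ((complexify S).smul_mem _ (tmul_mem_complexify _ _ h2))

theorem cx_lie_add (x y z : Cx L) : ⁅x, y + z⁆ = ⁅x, y⁆ + ⁅x, z⁆ :=
  map_add (LieAlgebra.ad ℂ (Cx L) x) y z

theorem cx_lie_sub (x y z : Cx L) : ⁅x, y - z⁆ = ⁅x, y⁆ - ⁅x, z⁆ :=
  map_sub (LieAlgebra.ad ℂ (Cx L) x) y z

theorem cx_lie_zero (x : Cx L) : ⁅x, (0 : Cx L)⁆ = 0 := map_zero (LieAlgebra.ad ℂ (Cx L) x)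

theorem cx_lie_smul (x : Cx L) (r : ℂ) (y : Cx L) : ⁅x, r • y⁆ = r • ⁅x, y⁆ :=
  map_smul (LieAlgebra.ad ℂ (Cx L) x) r y

theorem cx_add_lie (x y z : Cx L) : ⁅x + y, z⁆ = ⁅x, z⁆ + ⁅y, z⁆ := add_lie x y z

theorem cx_zero_lie (x : Cx L) : ⁅(0 : Cx L), x⁆ = 0 := zero_lie x

theorem cx_smul_lie (r : ℂ) (x y : Cx L) : ⁅r • x, y⁆ = r • ⁅x, y⁆ := smul_lie r x y

theorem formC_homC {B : LinearMap.BilinForm ℝ L} {f : L →ₗ⁅ℝ⁆ L}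
    (hf : ∀ X Y, B (f X) (f Y) = B X Y) (x y : Cx L) :
    formC B (homC f x) (homC f y) = formC B x y := by
  induction x using TensorProduct.induction_on with
  | zero => simp
  | tmul z X =>
    induction y using TensorProduct.induction_on with
    | zero => simp
    | tmul w Y =>
      rw [homC_tmul, homC_tmul, LinearMap.BilinForm.baseChange_tmul,
        LinearMap.BilinForm.baseChange_tmul, hf]
    | add x y hx hy => simp only [map_add, hx, hy]
  | add x y hx hy => simp only [map_add, LinearMap.add_apply, hx, hy]

theorem formC_bracket {B : LinearMap.BilinForm ℝ L}
    (hB : ∀ X Y Z : L, B ⁅X, Y⁆ Z = -B Y ⁅X, Z⁆) (x y z : Cx L) :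
    formC B ⁅x, y⁆ z = -formC B y ⁅x, z⁆ := by
  induction x using TensorProduct.induction_on with
  | zero => rw [cx_zero_lie, cx_zero_lie]; simp
  | tmul a X =>
    induction y using TensorProduct.induction_on with
    | zero => rw [cx_lie_zero]; simp
    | tmul b Y =>
      induction z using TensorProduct.induction_on with
      | zero => rw [cx_lie_zero]; simp
      | tmul c Z =>
        rw [LieAlgebra.ExtendScalars.bracket_tmul, LieAlgebra.ExtendScalars.bracket_tmul,
          LinearMap.BilinForm.baseChange_tmul, LinearMap.BilinForm.baseChange_tmul, hB, neg_smul]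
        congr 2
        ring
      | add x y hx hy => rw [cx_lie_add, map_add, map_add, hx, hy, neg_add]
    | add x y hx hy =>
      rw [cx_lie_add, map_add, map_add, LinearMap.add_apply, LinearMap.add_apply, hx, hy, neg_add]
  | add x y hx hy =>
    rw [cx_add_lie, cx_add_lie, map_add, map_add, LinearMap.add_apply, hx, hy, neg_add]

theorem formC_symm {B : LinearMap.BilinForm ℝ L} (hs : B.IsSymm) (x y : Cx L) :
    formC B x y = formC B y x := by
  induction x using TensorProduct.induction_on with
  | zero => simp
  | tmul z X =>
    induction y using TensorProduct.induction_on with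
    | zero => simp
    | tmul w Y =>
      rw [LinearMap.BilinForm.baseChange_tmul, LinearMap.BilinForm.baseChange_tmul, hs.eq, mul_comm]
    | add x y hx hy => simp only [map_add, LinearMap.add_apply, hx, hy]
  | add x y hx hy => simp only [map_add, LinearMap.add_apply, hx, hy]

theorem formC_nondegenerate {B : LinearMap.BilinForm ℝ L} (hs : B.IsSymm) (hB : B.Nondegenerate) :
    (formC B).Nondegenerate := by
  have key : ∀ x : Cx L, (∀ y, formC B x y = 0) → x = 0 := by
    intro x hx
    have h : ∀ Y : L, B (reCx L x) Y = 0 ∧ B (imCx L x) Y = 0 := by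
      intro Y
      have h1 := hx ((1 : ℂ) ⊗ₜ[ℝ] Y)
      rw [eq_reCx_add_imCx x, map_add, map_smul, LinearMap.add_apply, LinearMap.smul_apply,
        LinearMap.BilinForm.baseChange_tmul, LinearMap.BilinForm.baseChange_tmul, mul_one,
        smul_eq_mul] at h1
      have h2 := congrArg Complex.re h1
      have h3 := congrArg Complex.im h1
      simp at h2 h3
      exact ⟨h2, h3⟩
    rw [eq_reCx_add_imCx x, hB.1 _ fun Y => (h Y).1, hB.1 _ fun Y => (h Y).2]
    simp
  refine ⟨key, fun y hy => key y fun x => ?_⟩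
  exact (formC_symm hs y x).trans (hy x)

end Complexification

/-! ### Radial data and regular points -/

section RadialData

variable {L : Type*} [LieRing L] [LieAlgebra ℝ L]

/-- The linear-algebraic content of a standard Cartan subset: an involution `σ`, an invariant
nondegenerate form `B`, an abelian subalgebra `𝔠` of `𝔤^{-σ}` acting semisimply, and an isometric
automorphism `T` with `T σ T = σ`. -/
structure RadialData (σ T : L →ₗ⁅ℝ⁆ L) (B : LinearMap.BilinForm ℝ L) (c : LieSubalgebra ℝ L) :
    Prop where
  symm : B.IsSymm
  nondegenerate : B.Nondegenerate
  bracket : ∀ X Y Z : L, B ⁅X, Y⁆ Z = -B Y ⁅X, Z⁆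
  involutive : ∀ X, σ (σ X) = X
  sigma_form : ∀ X Y, B (σ X) (σ Y) = B X Y
  anti : ∀ X ∈ c, σ X = -X
  comm : ∀ X ∈ c, ∀ Y ∈ c, ⁅X, Y⁆ = 0
  iSup_rootSpace : ⨆ α, rootSpace c α = ⊤
  twist_form : ∀ X Y, B (T X) (T Y) = B X Y
  twist : ∀ X, T (σ (T X)) = σ X

/-- `E` behaves as `Ad(x)` for a regular point `x = exp(X) t`, where `T = Ad(t)`: it is
`exp(ad X) T`, the space `𝔤^{-σ} ∩ E(𝔤^{-σ})` is commutative, and `𝔠` is its own centraliser in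
`𝔤^{-σ}`. -/
structure IsRegularPoint (σ T : L →ₗ⁅ℝ⁆ L) (c : LieSubalgebra ℝ L) (E : L →ₗ⁅ℝ⁆ L) (X : c) :
    Prop where
  apply_eq : ∀ (α : c →ₗ[ℝ] ℂ) (v : Cx L), homC T v ∈ rootSpace c α →
    homC E v = Complex.exp (α X) • homC T v
  comm : ∀ u v u' v', σ u = -u → σ v = -v → σ u' = -u' → σ v' = -v' → E u' = u → E v' = v →
    ⁅u, v⁆ = 0

variable {σ T : L →ₗ⁅ℝ⁆ L} {B : LinearMap.BilinForm ℝ L} {c : LieSubalgebra ℝ L}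

theorem homC_involutive (hσ : ∀ X, σ (σ X) = X) (x : Cx L) : homC σ (homC σ x) = x := by
  rw [← homC_comp_apply, show σ.comp σ = LieHom.id from LieHom.ext hσ]
  induction x using TensorProduct.induction_on with
  | zero => simp
  | tmul z X => simp
  | add x y hx hy => simp only [map_add, hx, hy]

theorem mem_rootSpace_iff {α : c →ₗ[ℝ] ℂ} {v : Cx L} :
    v ∈ rootSpace c α ↔ ∀ Z : c, ⁅(1 : ℂ) ⊗ₜ[ℝ] (Z : L), v⁆ = α Z • v := Iff.rfl

theorem eq_zero_of_mem_rootSpace_of_ne {α β : c →ₗ[ℝ] ℂ} (h : α ≠ β) {v : Cx L}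
    (h1 : v ∈ rootSpace c α) (h2 : v ∈ rootSpace c β) : v = 0 := by
  by_contra hv
  refine h (LinearMap.ext fun Z => smul_left_injective ℂ hv ?_)
  exact (mem_rootSpace_iff.mp h1 Z).symm.trans (mem_rootSpace_iff.mp h2 Z)

namespace RadialData

theorem homC_sigma_mem (h : RadialData σ T B c) {α : c →ₗ[ℝ] ℂ} {v : Cx L}
    (hv : v ∈ rootSpace c α) : homC σ v ∈ rootSpace c (-α) := by
  rw [mem_rootSpace_iff] at *
  intro Z
  have h1 : (1 : ℂ) ⊗ₜ[ℝ] (Z : L) = -homC σ ((1 : ℂ) ⊗ₜ[ℝ] (Z : L)) := by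
    rw [homC_tmul, h.anti _ Z.2, TensorProduct.tmul_neg, neg_neg]
  rw [h1, neg_lie, ← LieHom.map_lie, hv Z, map_smul, LinearMap.neg_apply, neg_smul]

theorem complexify_le_rootSpace (h : RadialData σ T B c) {Z : Cx L} (hZ : Z ∈ complexify c) :
    Z ∈ rootSpace c 0 := by
  rw [mem_complexify_iff] at hZ
  have key : ∀ Y ∈ c, (1 : ℂ) ⊗ₜ[ℝ] Y ∈ rootSpace c 0 := by
    intro Y hY
    rw [mem_rootSpace_iff]
    intro Z'
    rw [LieAlgebra.ExtendScalars.bracket_tmul, h.comm _ Z'.2 _ hY]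
    simp
  rw [eq_reCx_add_imCx Z]
  exact add_mem (key _ hZ.1) (Submodule.smul_mem _ _ (key _ hZ.2))

/-- The root spaces of `α` and `β` are orthogonal unless `α + β = 0`. -/
theorem formC_eq_zero (h : RadialData σ T B c) {α β : c →ₗ[ℝ] ℂ} (hαβ : α + β ≠ 0) {v w : Cx L}
    (hv : v ∈ rootSpace c α) (hw : w ∈ rootSpace c β) : formC B v w = 0 := by
  obtain ⟨Z, hZ⟩ : ∃ Z, (α + β) Z ≠ 0 := by
    by_contra! h'
    exact hαβ (LinearMap.ext h')
  have h1 := formC_bracket h.bracket ((1 : ℂ) ⊗ₜ[ℝ] (Z : L)) v w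
  rw [mem_rootSpace_iff.mp hv, mem_rootSpace_iff.mp hw, map_smul, LinearMap.smul_apply, map_smul,
    smul_eq_mul, smul_eq_mul, ← add_eq_zero_iff_eq_neg, ← add_mul] at h1
  exact (mul_eq_zero.mp h1).resolve_left hZ

/-- Two root vectors whose roots add up to zero can be paired nontrivially. -/
theorem exists_formC_ne_zero (h : RadialData σ T B c) {α : c →ₗ[ℝ] ℂ} {v : Cx L}
    (hv : v ∈ rootSpace c α) (hv0 : v ≠ 0) : ∃ w ∈ rootSpace c (-α), formC B v w ≠ 0 := by
  by_contra! hw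
  refine hv0 ((formC_nondegenerate h.symm h.nondegenerate).1 v fun y => ?_)
  have hy : y ∈ ⨆ β, rootSpace c β := by rw [h.iSup_rootSpace]; trivial
  induction hy using Submodule.iSup_induction' with
  | mem β y hy =>
    by_cases hβ : α + β = 0
    · rw [add_eq_zero_iff_neg_eq] at hβ
      exact hw y (hβ ▸ hy)
    · exact h.formC_eq_zero hβ hv hy
  | zero => simp
  | add x y _ _ hx hy => rw [map_add, hx, hy, add_zero]

variable {φ : Cx L →ₗ[ℂ] Cx L} {ε : (c →ₗ[ℝ] ℂ) → ℂˣ}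

theorem twist_homC (h : RadialData σ T B c) (x : Cx L) :
    homC T (homC σ (homC T x)) = homC σ x := by
  rw [← homC_comp_apply, ← homC_comp_apply,
    show (T.comp σ).comp T = σ from LieHom.ext h.twist]

theorem twist_twist (h : RadialData σ T B c) (hφ : TechnicalCondition σ B c T φ ε) {Z : L}
    (hZ : Z ∈ c) : T (T Z) = Z := by
  have h1 := h.twist Z
  rw [h.anti _ (hφ.mapsTo Z hZ), h.anti _ hZ, map_neg] at h1
  exact neg_injective h1

theorem dualAction_apply (hφ : TechnicalCondition σ B c T φ ε) (α : c →ₗ[ℝ] ℂ) (Z : c) :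
    hφ.dualAction α Z = α ⟨T Z, hφ.mapsTo Z Z.2⟩ := rfl

theorem dualAction_dualAction (h : RadialData σ T B c) (hφ : TechnicalCondition σ B c T φ ε)
    (α : c →ₗ[ℝ] ℂ) : hφ.dualAction (hφ.dualAction α) = α := by
  refine LinearMap.ext fun Z => ?_
  rw [dualAction_apply, dualAction_apply]
  exact congrArg α (Subtype.ext (h.twist_twist hφ Z.2))

theorem dualAction_neg (hφ : TechnicalCondition σ B c T φ ε) (α : c →ₗ[ℝ] ℂ) :
    hφ.dualAction (-α) = -hφ.dualAction α := rfl

theorem homC_twist_mem (h : RadialData σ T B c) (hφ : TechnicalCondition σ B c T φ ε)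
    {α : c →ₗ[ℝ] ℂ} {v : Cx L} (hv : v ∈ rootSpace c α) :
    homC T v ∈ rootSpace c (hφ.dualAction α) := by
  rw [mem_rootSpace_iff] at *
  intro Z
  have h1 : (1 : ℂ) ⊗ₜ[ℝ] (Z : L) = homC T ((1 : ℂ) ⊗ₜ[ℝ] (T Z : L)) := by
    rw [homC_tmul, h.twist_twist hφ Z.2]
  rw [h1, ← LieHom.map_lie, hv ⟨T Z, hφ.mapsTo Z Z.2⟩, map_smul, dualAction_apply]

theorem phi_mem (h : RadialData σ T B c) (hφ : TechnicalCondition σ B c T φ ε)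
    {α : c →ₗ[ℝ] ℂ} {v : Cx L} (hv : v ∈ rootSpace c α) :
    φ v ∈ rootSpace c (hφ.dualAction α) := by
  have h1 := h.homC_twist_mem hφ hv
  rw [hφ.eq_smul α v hv] at h1
  have h2 := Submodule.smul_mem _ ((ε α : ℂ)⁻¹) h1
  rwa [smul_smul, inv_mul_cancel₀ (ε α).ne_zero, one_smul] at h2

theorem eps_mul_eps_neg (h : RadialData σ T B c) (hφ : TechnicalCondition σ B c T φ ε)
    {α : c →ₗ[ℝ] ℂ} (hα : rootSpace c α ≠ ⊥) : (ε α : ℂ) * ε (-α) = 1 := by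
  obtain ⟨v, hv, hv0⟩ := Submodule.exists_mem_ne_zero_of_ne_bot hα
  obtain ⟨w, hw, hvw⟩ := h.exists_formC_ne_zero hv hv0
  have h1 := formC_homC h.twist_form v w
  rw [hφ.eq_smul _ _ hv, hφ.eq_smul _ _ hw, map_smul, map_smul,
    LinearMap.smul_apply, hφ.orthogonal, smul_eq_mul, smul_eq_mul, ← mul_assoc] at h1
  rw [mul_comm]
  exact mul_right_cancel₀ hvw (h1.trans (one_mul _).symm)

theorem rootSpace_neg_ne_bot (h : RadialData σ T B c) {α : c →ₗ[ℝ] ℂ} (hα : rootSpace c α ≠ ⊥) :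
    rootSpace c (-α) ≠ ⊥ := by
  obtain ⟨v, hv, hv0⟩ := Submodule.exists_mem_ne_zero_of_ne_bot hα
  intro hbot
  have h1 := h.homC_sigma_mem hv
  rw [hbot, Submodule.mem_bot] at h1
  rw [← homC_involutive h.involutive v, h1, map_zero] at hv0
  exact hv0 rfl

theorem rootSpace_dualAction_ne_bot (h : RadialData σ T B c)
    (hφ : TechnicalCondition σ B c T φ ε) {α : c →ₗ[ℝ] ℂ} (hα : rootSpace c α ≠ ⊥) :
    rootSpace c (hφ.dualAction α) ≠ ⊥ := by
  obtain ⟨v, hv, hv0⟩ := Submodule.exists_mem_ne_zero_of_ne_bot hα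
  intro hbot
  have h1 := h.phi_mem hφ hv
  rw [hbot, Submodule.mem_bot] at h1
  rw [← hφ.involutive v, h1, map_zero] at hv0
  exact hv0 rfl

/-- `t φ` acts on `𝔤_α` by `ε_α`. -/
theorem twist_phi (h : RadialData σ T B c) (hφ : TechnicalCondition σ B c T φ ε)
    {α : c →ₗ[ℝ] ℂ} {v : Cx L} (hv : v ∈ rootSpace c α) : homC T (φ v) = (ε α : ℂ) • v := by
  by_cases hα : rootSpace c α = ⊥
  · rw [hα, Submodule.mem_bot] at hv
    rw [hv]; simp
  have h1 := h.twist_homC (homC σ v)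
  have h2 := h.homC_sigma_mem hv
  rw [hφ.eq_smul _ _ h2, map_smul, map_smul, ← hφ.commutes, homC_involutive h.involutive] at h1
  conv_rhs => rw [← h1]
  rw [smul_smul, h.eps_mul_eps_neg hφ hα, one_smul]

variable {E : L →ₗ⁅ℝ⁆ L} {X : c}

theorem rootPower_mul_rootPower_neg (h : RadialData σ T B c)
    (hφ : TechnicalCondition σ B c T φ ε) {α : c →ₗ[ℝ] ℂ} (hα : rootSpace c α ≠ ⊥) (X : c) :
    rootPower ε α X * rootPower ε (-α) X = 1 := by
  rw [rootPower, rootPower, LinearMap.neg_apply, mul_mul_mul_comm, h.eps_mul_eps_neg hφ hα,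
    ← Complex.exp_add, add_neg_cancel, Complex.exp_zero, one_mul]

theorem rootPower_ne_zero (ε : (c →ₗ[ℝ] ℂ) → ℂˣ) (α : c →ₗ[ℝ] ℂ) (X : c) :
    rootPower ε α X ≠ 0 := mul_ne_zero (ε α).ne_zero (Complex.exp_ne_zero _)

/-- `Ad(x) φ` acts on `𝔤_α` by `x^α`. -/
theorem point_phi (h : RadialData σ T B c) (hφ : TechnicalCondition σ B c T φ ε)
    (hE : IsRegularPoint σ T c E X) {α : c →ₗ[ℝ] ℂ} {v : Cx L} (hv : v ∈ rootSpace c α) :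
    homC E (φ v) = rootPower ε α X • v := by
  rw [hE.apply_eq α (φ v) (by rw [h.twist_phi hφ hv]; exact Submodule.smul_mem _ _ hv),
    h.twist_phi hφ hv, smul_smul, rootPower, mul_comm]

/-- The complexification of `𝔤^{-σ} ∩ Ad(x) 𝔤^{-σ}` is commutative. -/
theorem lie_eq_zero_of_anti (hE : IsRegularPoint σ T c E X) {u v u' v' : Cx L}
    (hu : homC σ u = -u) (hv : homC σ v = -v) (hu' : homC σ u' = -u') (hv' : homC σ v' = -v')
    (huu' : homC E u' = u) (hvv' : homC E v' = v) : ⁅u, v⁆ = 0 := by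
  have hr : ∀ {x : Cx L}, homC σ x = -x → σ (reCx L x) = -reCx L x := fun {x} hx => by
    rw [← reCx_homC, hx, map_neg]
  have hi : ∀ {x : Cx L}, homC σ x = -x → σ (imCx L x) = -imCx L x := fun {x} hx => by
    rw [← imCx_homC, hx, map_neg]
  have er : ∀ {x y : Cx L}, homC E x = y → E (reCx L x) = reCx L y := fun {x y} hx => by
    rw [← reCx_homC, hx]
  have ei : ∀ {x y : Cx L}, homC E x = y → E (imCx L x) = imCx L y := fun {x y} hx => by
    rw [← imCx_homC, hx]
  have key : ∀ {X Y : L}, ⁅X, Y⁆ = 0 → ⁅(1 : ℂ) ⊗ₜ[ℝ] X, (1 : ℂ) ⊗ₜ[ℝ] Y⁆ = (0 : Cx L) :=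
    fun hXY => by rw [LieAlgebra.ExtendScalars.bracket_tmul, hXY, TensorProduct.tmul_zero]
  have h1 := key (hE.comm _ _ _ _ (hr hu) (hr hv) (hr hu') (hr hv') (er huu') (er hvv'))
  have h2 := key (hE.comm _ _ _ _ (hr hu) (hi hv) (hr hu') (hi hv') (er huu') (ei hvv'))
  have h3 := key (hE.comm _ _ _ _ (hi hu) (hr hv) (hi hu') (hr hv') (ei huu') (er hvv'))
  have h4 := key (hE.comm _ _ _ _ (hi hu) (hi hv) (hi hu') (hi hv') (ei huu') (ei hvv'))
  rw [eq_reCx_add_imCx u, eq_reCx_add_imCx v]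
  have e1 : ∀ a b c d : Cx L, ⁅a + Complex.I • b, c + Complex.I • d⁆ =
      ⁅a, c⁆ + Complex.I • ⁅a, d⁆ + (Complex.I • ⁅b, c⁆ + Complex.I • Complex.I • ⁅b, d⁆) := by
    intro a b c d
    rw [cx_add_lie, cx_smul_lie, cx_lie_add, cx_lie_add, cx_lie_smul, cx_lie_smul, smul_add]
  rw [e1, h1, h2, h3, h4]
  simp

/-- Every element of `𝔤_0` is the image under `Ad(x)` of a multiple of its image under `φ`. -/
theorem rootSpace_zero_point (h : RadialData σ T B c) (hφ : TechnicalCondition σ B c T φ ε)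
    (hE : IsRegularPoint σ T c E X) {v : Cx L} (hv : v ∈ rootSpace c 0) :
    homC E ((rootPower ε 0 X)⁻¹ • φ v) = v := by
  rw [map_smul, h.point_phi hφ hE hv, smul_smul, inv_mul_cancel₀ (rootPower_ne_zero _ _ _),
    one_smul]

/-- At a regular point `x^α ≠ x^{-α}` for every root: otherwise `v - σ v` (`v ∈ 𝔤_α`) lies in the
commutative space `𝔤^{-σ} ∩ Ad(x) 𝔤^{-σ}`, which contains `𝔠`. -/
theorem rootPower_ne (h : RadialData σ T B c) (hφ : TechnicalCondition σ B c T φ ε)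
    (hE : IsRegularPoint σ T c E X) {α : c →ₗ[ℝ] ℂ} (hα : α ∈ roots c) :
    rootPower ε α X ≠ rootPower ε (-α) X := by
  intro heq
  obtain ⟨v, hv, hv0⟩ := Submodule.exists_mem_ne_zero_of_ne_bot hα.2
  obtain ⟨Z, hZ⟩ : ∃ Z, α Z ≠ 0 := by
    by_contra! h'
    exact hα.1 (LinearMap.ext h')
  have hsv := h.homC_sigma_mem hv
  have hy := rootPower_ne_zero ε α X
  have hZa : homC σ ((1 : ℂ) ⊗ₜ[ℝ] (Z : L)) = -((1 : ℂ) ⊗ₜ[ℝ] (Z : L)) := by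
    rw [homC_tmul, h.anti _ Z.2, TensorProduct.tmul_neg]
  have hua : homC σ (v - homC σ v) = -(v - homC σ v) := by
    rw [map_sub, homC_involutive h.involutive, neg_sub]
  have hZ0 := h.complexify_le_rootSpace (tmul_mem_complexify c 1 Z.2)
  -- if `x^α = x^{-α}`, then `Ad(x)` maps the multiple `v'` of `φ (v - σ v)` to `v - σ v`
  have h1 := lie_eq_zero_of_anti hE (u := (1 : ℂ) ⊗ₜ[ℝ] (Z : L)) (v := v - homC σ v)
    (u' := (rootPower ε 0 X)⁻¹ • φ ((1 : ℂ) ⊗ₜ[ℝ] (Z : L)))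
    (v' := (rootPower ε α X)⁻¹ • φ (v - homC σ v)) hZa hua
    (by rw [map_smul, ← hφ.commutes, hZa, map_neg, smul_neg])
    (by rw [map_smul, ← hφ.commutes, hua, map_neg, smul_neg])
    (h.rootSpace_zero_point hφ hE hZ0)
    (by
      rw [map_smul, map_sub, map_sub, h.point_phi hφ hE hv, h.point_phi hφ hE hsv, ← heq,
        ← smul_sub, smul_smul, inv_mul_cancel₀ hy, one_smul])
  rw [cx_lie_sub, mem_rootSpace_iff.mp hv,
    mem_rootSpace_iff.mp hsv, LinearMap.neg_apply, neg_smul, sub_neg_eq_add, ← smul_add,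
    smul_eq_zero] at h1
  have h2 : v = -homC σ v := eq_neg_of_add_eq_zero_left (h1.resolve_left hZ)
  refine hv0 (eq_zero_of_mem_rootSpace_of_ne (β := -α) ?_ hv (h2 ▸ neg_mem hsv))
  intro h3
  exact hZ (self_eq_neg.mp (LinearMap.congr_fun h3 Z))

/-- The centraliser of `𝔠` in `𝔤^{-σ}` is commutative as soon as there is a regular point. -/
theorem lie_eq_zero_of_centralizes (h : RadialData σ T B c)
    (hφ : TechnicalCondition σ B c T φ ε) (hE : IsRegularPoint σ T c E X) {Y Y' : L}
    (hY : σ Y = -Y) (hY' : σ Y' = -Y') (hc : ∀ Z ∈ c, ⁅Z, Y⁆ = 0) (hc' : ∀ Z ∈ c, ⁅Z, Y'⁆ = 0) :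
    ⁅Y, Y'⁆ = 0 := by
  have h0 : ∀ {Y : L}, (∀ Z ∈ c, ⁅Z, Y⁆ = 0) → (1 : ℂ) ⊗ₜ[ℝ] Y ∈ rootSpace c 0 := by
    intro Y hY
    rw [mem_rootSpace_iff]
    intro Z
    rw [LieAlgebra.ExtendScalars.bracket_tmul, hY _ Z.2]
    simp
  have ha : ∀ {Y : L}, σ Y = -Y → homC σ ((1 : ℂ) ⊗ₜ[ℝ] Y) = -((1 : ℂ) ⊗ₜ[ℝ] Y) := by
    intro Y hY
    rw [homC_tmul, hY, TensorProduct.tmul_neg]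
  have h1 := lie_eq_zero_of_anti hE (ha hY) (ha hY')
    (u' := (rootPower ε 0 X)⁻¹ • φ ((1 : ℂ) ⊗ₜ[ℝ] Y))
    (v' := (rootPower ε 0 X)⁻¹ • φ ((1 : ℂ) ⊗ₜ[ℝ] Y'))
    (by rw [map_smul, ← hφ.commutes, ha hY, map_neg, smul_neg])
    (by rw [map_smul, ← hφ.commutes, ha hY', map_neg, smul_neg])
    (h.rootSpace_zero_point hφ hE (h0 hc)) (h.rootSpace_zero_point hφ hE (h0 hc'))
  rw [LieAlgebra.ExtendScalars.bracket_tmul, mul_one] at h1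
  exact one_tmul_injective (h1.trans (TensorProduct.tmul_zero _ _).symm)

end RadialData

end RadialData

end

end CasimirRadial

namespace CasimirRadial

noncomputable section

/-! ### Flat subspaces for compact symmetric pairs -/

section Flats

open scoped InnerProductSpace Topology
open NormedSpace

variable {E : Type*} [NormedAddCommGroup E] [InnerProductSpace ℝ E] [FiniteDimensional ℝ E]

/-- For commuting skew operators `A`, `D` a small perturbation `A + μ D` has kernel
`ker A ∩ ker D`. -/
theorem exists_ker_add_smul_le (A D : E →L[ℝ] E) (hA : ∀ x y, ⟪A x, y⟫_ℝ = -⟪x, A y⟫_ℝ)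
    (hD : ∀ x y, ⟪D x, y⟫_ℝ = -⟪x, D y⟫_ℝ) (h : ∀ x, A (D x) = D (A x)) :
    ∃ μ : ℝ, ∀ v, A v + μ • D v = 0 → A v = 0 ∧ D v = 0 := by
  set K : Submodule ℝ E := LinearMap.ker (A : E →ₗ[ℝ] E) with hK
  have hmem : ∀ v, v ∈ K ↔ A v = 0 := fun v => LinearMap.mem_ker
  have hAK : ∀ v, A v ∈ Kᗮ := fun v => by
    rw [Submodule.mem_orthogonal]
    intro u hu
    rw [real_inner_comm, hA, (hmem u).mp hu, inner_zero_right, neg_zero]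
  have hDK : ∀ v ∈ K, D v ∈ K := fun v hv => by
    rw [hmem, h, (hmem v).mp hv, map_zero]
  have hDK' : ∀ v ∈ Kᗮ, D v ∈ Kᗮ := fun v hv => by
    rw [Submodule.mem_orthogonal] at *
    intro u hu
    rw [real_inner_comm, hD, real_inner_comm, hv _ (hDK u hu), neg_zero]
  have hdisj : ∀ v, v ∈ K → v ∈ Kᗮ → v = 0 := fun v h1 h2 => by
    rw [Submodule.mem_orthogonal] at h2
    exact inner_self_eq_zero.mp (h2 v h1)
  have hsplit : ∀ u ∈ K, ∀ w ∈ Kᗮ, u + w = 0 → u = 0 ∧ w = 0 := fun u hu w hw huw => by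
    have h1 : u = -w := eq_neg_of_add_eq_zero_left huw
    have h2 : u = 0 := hdisj u hu (h1 ▸ neg_mem hw)
    exact ⟨h2, by rwa [h2, zero_add] at huw⟩
  set P : E →L[ℝ] E := K.starProjection with hP
  have hPK : ∀ v, P v ∈ K := fun v => Submodule.starProjection_apply_mem K v
  have hP0 : ∀ v ∈ Kᗮ, P v = 0 := fun v hv => (Submodule.starProjection_apply_eq_zero_iff K).mpr hv
  have hP1 : ∀ v, v - P v ∈ Kᗮ := fun v => Submodule.sub_starProjection_mem_orthogonal v
  -- `A + P` is invertible, hence so is `A + P + μ D` for small `μ ≠ 0`; on `Kᗮ` this is `A + μ D`, and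
  -- on `K = ker A` the operator `A + μ D` is `μ D`
  have hunit : IsUnit (A + P) := by
    have hinj : Function.Injective ((A + P : E →L[ℝ] E) : E →ₗ[ℝ] E) := by
      rw [← LinearMap.ker_eq_bot, LinearMap.ker_eq_bot']
      intro v hv
      have h1 : P v + A v = 0 := by rw [add_comm]; exact hv
      obtain ⟨h2, h3⟩ := hsplit _ (hPK v) _ (hAK v) h1
      have h4 := hP1 v
      rw [h2, sub_zero] at h4
      exact hdisj v ((hmem v).mpr h3) h4
    let e := (LinearEquiv.ofInjectiveEndo _ hinj).toContinuousLinearEquiv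
    exact ⟨ContinuousLinearEquiv.toUnit e, by ext v; rfl⟩
  have hcont : Continuous fun μ : ℝ => A + P + μ • D := by fun_prop
  have hev : ∀ᶠ μ in 𝓝 (0 : ℝ), IsUnit (A + P + μ • D) :=
    hcont.continuousAt.eventually (Units.isOpen.mem_nhds (by simpa using hunit))
  obtain ⟨μ, hμ, hμ0⟩ := ((hev.filter_mono nhdsWithin_le_nhds).and
    (self_mem_nhdsWithin : ∀ᶠ μ in 𝓝[≠] (0 : ℝ), μ ∈ ({0}ᶜ : Set ℝ))).exists
  refine ⟨μ, fun v hv => ?_⟩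
  have e1 : A (P v) = 0 := (hmem _).mp (hPK v)
  have e2 : (μ • D (P v)) + (A (v - P v) + μ • D (v - P v)) = 0 := by
    rw [map_sub, map_sub, e1, smul_sub, sub_zero, ← hv]; abel
  obtain ⟨e3, e4⟩ := hsplit _ (K.smul_mem _ (hDK _ (hPK v))) _
    (add_mem (hAK _) (Kᗮ.smul_mem _ (hDK' _ (hP1 v)))) e2
  have e5 : v - P v = 0 := by
    obtain ⟨U, hU⟩ := hμ
    have h1 : (A + P + μ • D) (v - P v) = 0 := by
      change A (v - P v) + P (v - P v) + μ • D (v - P v) = 0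
      rw [hP0 _ (hP1 v), add_zero, e4]
    have h2 : (↑U⁻¹ * (A + P + μ • D) : E →L[ℝ] E) (v - P v) = 0 := by
      rw [mul_apply_eq_comp, h1, map_zero]
    rw [← hU, Units.inv_mul] at h2
    exact h2
  rw [sub_eq_zero] at e5
  rw [← e5] at e1 e3
  exact ⟨e1, (smul_eq_zero.mp e3).resolve_left hμ0⟩

variable (br : E →ₗ[ℝ] E →ₗ[ℝ] E)

/-- A commuting family of skew operators contains one whose kernel is the common kernel. -/
theorem exists_generic (hinv : ∀ z x y, ⟪br z x, y⟫_ℝ = -⟪x, br z y⟫_ℝ)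
    (V : Submodule ℝ E) (hV : ∀ x ∈ V, ∀ y ∈ V, ∀ z, br x (br y z) = br y (br x z)) :
    ∃ X ∈ V, ∀ v, br X v = 0 → ∀ Z ∈ V, br Z v = 0 := by
  -- an element of `V` whose kernel has minimal dimension
  obtain ⟨X, hX⟩ := WellFounded.has_min (measure fun X : V =>
    Module.finrank ℝ (LinearMap.ker (br X))).wf Set.univ ⟨0, trivial⟩
  refine ⟨X, X.2, fun v hv Z hZ => ?_⟩
  obtain ⟨μ, hμ⟩ := exists_ker_add_smul_le (LinearMap.toContinuousLinearMap (br X))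
    (LinearMap.toContinuousLinearMap (br Z)) (fun x y => hinv X x y) (fun x y => hinv Z x y)
    (fun x => hV X X.2 Z hZ x)
  have h1 := hX.2 (X + μ • ⟨Z, hZ⟩) trivial
  have hle : LinearMap.ker (br (X + μ • ⟨Z, hZ⟩ : V)) ≤ LinearMap.ker (br X) := by
    intro w hw
    rw [LinearMap.mem_ker] at *
    exact (hμ w (by simpa using hw)).1
  have heq := Submodule.eq_of_le_of_finrank_le hle (not_lt.mp h1)
  have hv' : v ∈ LinearMap.ker (br (X + μ • ⟨Z, hZ⟩ : V)) := by rw [heq]; exact hv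
  rw [LinearMap.mem_ker] at hv'
  exact (hμ v (by simpa using hv')).2

/-- The isometric automorphisms of `br` commuting with `s`. -/
def isometricAutomorphisms (s : E →ₗ[ℝ] E) : Set (E →L[ℝ] E) :=
  {g | (∀ x y, ⟪g x, g y⟫_ℝ = ⟪x, y⟫_ℝ) ∧ (∀ x, s (g x) = g (s x)) ∧
    ∀ x y, g (br x y) = br (g x) (g y)}

theorem isCompact_isometricAutomorphisms (s : E →ₗ[ℝ] E) :
    IsCompact (isometricAutomorphisms br s) := by
  have : ProperSpace (E →L[ℝ] E) := FiniteDimensional.proper ℝ _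
  refine Metric.isCompact_of_isClosed_isBounded ?_ ?_
  · have hev : ∀ x : E, Continuous fun g : E →L[ℝ] E => g x := fun x => by fun_prop
    have hs : Continuous s := s.continuous_of_finiteDimensional
    have hbr : ∀ x y : E, Continuous fun g : E →L[ℝ] E => br (g x) (g y) := fun x y => by
      have h1 : Continuous fun p : E × E => br p.1 p.2 :=
        (LinearMap.toContinuousLinearMap
          (LinearMap.toContinuousLinearMap.toLinearMap ∘ₗ br)).continuous₂
      exact h1.comp ((hev x).prodMk (hev y))
    have : isometricAutomorphisms br s = (⋂ x, ⋂ y, {g | ⟪g x, g y⟫_ℝ = ⟪x, y⟫_ℝ}) ∩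
        ((⋂ x, {g | s (g x) = g (s x)}) ∩ ⋂ x, ⋂ y, {g | g (br x y) = br (g x) (g y)}) := by
      ext g; simp [isometricAutomorphisms]
    rw [this]
    refine IsClosed.inter (isClosed_iInter fun x => isClosed_iInter fun y => ?_)
      (IsClosed.inter (isClosed_iInter fun x => ?_)
        (isClosed_iInter fun x => isClosed_iInter fun y => ?_))
    · exact isClosed_eq ((hev x).inner (hev y)) continuous_const
    · exact isClosed_eq (hs.comp (hev x)) (hev _)
    · exact isClosed_eq (hev _) (hbr x y)
  · rw [isBounded_iff_forall_norm_le]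
    refine ⟨1, fun g hg => ContinuousLinearMap.opNorm_le_bound _ zero_le_one fun x => ?_⟩
    have h1 := hg.1 x x
    rw [real_inner_self_eq_norm_sq, real_inner_self_eq_norm_sq] at h1
    rw [one_mul]
    exact le_of_eq ((sq_eq_sq₀ (norm_nonneg _) (norm_nonneg _)).mp h1)

/-- `exp (ad Z)` is an isometric automorphism for `Z` fixed by `s`. -/
theorem exp_mem_isometricAutomorphisms (s : E →ₗ[ℝ] E)
    (hjac : ∀ z x y, br z (br x y) = br (br z x) y + br x (br z y))
    (hinv : ∀ z x y, ⟪br z x, y⟫_ℝ = -⟪x, br z y⟫_ℝ)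
    (hs : ∀ x y, s (br x y) = br (s x) (s y)) {Z : E} (hZ : s Z = Z) (r : ℝ) :
    exp (r • LinearMap.toContinuousLinearMap (br Z)) ∈ isometricAutomorphisms br s := by
  set A : E →L[ℝ] E := LinearMap.toContinuousLinearMap (br Z) with hA
  have hAx : ∀ x, A x = br Z x := fun x => rfl
  have hd : ∀ (x : E) (r : ℝ),
      HasDerivAt (fun r : ℝ => exp (r • A) x) (A (exp (r • A) x)) r := by
    intro x r
    have h1 := (hasDerivAt_exp_smul_const' (𝕂 := ℝ) A r).clm_apply (hasDerivAt_const r x)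
    simpa using h1
  have h0 : ∀ x, exp ((0 : ℝ) • A) x = x := fun x => by rw [zero_smul, exp_zero]; rfl
  have hinner : ∀ x y (r : ℝ), ⟪exp (r • A) x, exp (r • A) y⟫_ℝ = ⟪x, y⟫_ℝ := by
    intro x y r
    have h1 : ∀ r : ℝ, HasDerivAt (fun r : ℝ => ⟪exp (r • A) x, exp (r • A) y⟫_ℝ) 0 r := by
      intro r
      have h2 := (hd x r).inner ℝ (hd y r)
      rw [hAx (exp (r • A) x), hinv, ← hAx, add_neg_cancel] at h2
      exact h2
    have h3 := is_const_of_deriv_eq_zero (fun r => (h1 r).differentiableAt)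
      (fun r => (h1 r).deriv) r 0
    simpa only [h0] using h3
  -- `exp (r A)` is an automorphism: both sides of `exp (r A) [x, y] = [exp (r A) x, exp (r A) y]`
  -- have the same inner products with `exp (r A) z`
  have hbr : ∀ x y z (r : ℝ), ⟪br (exp (r • A) x) (exp (r • A) y), exp (r • A) z⟫_ℝ =
      ⟪br x y, z⟫_ℝ := by
    intro x y z r
    let brL : E →L[ℝ] E →L[ℝ] E :=
      LinearMap.toContinuousLinearMap (LinearMap.toContinuousLinearMap.toLinearMap ∘ₗ br)
    have h1 : ∀ r : ℝ, HasDerivAt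
        (fun r : ℝ => ⟪br (exp (r • A) x) (exp (r • A) y), exp (r • A) z⟫_ℝ) 0 r := by
      intro r
      have h2 : HasDerivAt (fun r : ℝ => brL (exp (r • A) x) (exp (r • A) y))
          (brL (A (exp (r • A) x)) (exp (r • A) y) + brL (exp (r • A) x) (A (exp (r • A) y))) r :=
        HasDerivAt.clm_apply (c := fun r => brL (exp (r • A) x))
          (brL.hasFDerivAt.comp_hasDerivAt r (hd x r)) (hd y r)
      have h3 := h2.inner ℝ (hd z r)
      have h4 : (brL (A (exp (r • A) x)) (exp (r • A) y) +
          brL (exp (r • A) x) (A (exp (r • A) y))) =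
          br Z (br (exp (r • A) x) (exp (r • A) y)) := (hjac Z _ _).symm
      rw [h4, hinv] at h3
      exact h3.congr_deriv (add_neg_cancel (⟪br (exp (r • A) x) (exp (r • A) y), A (exp (r • A) z)⟫_ℝ))
    have h3 := is_const_of_deriv_eq_zero (fun r => (h1 r).differentiableAt)
      (fun r => (h1 r).deriv) r 0
    simpa only [h0] using h3
  have hsurj : ∀ z, exp (r • A) (exp (-(r • A)) z) = z := by
    intro z
    let _ : NormedAlgebra ℚ (E →L[ℝ] E) := NormedAlgebra.restrictScalars ℚ ℝ _
    have h1 : exp (r • A) * exp (-(r • A)) = (1 : E →L[ℝ] E) := by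
      rw [← exp_add_of_commute ((Commute.refl _).neg_right), add_neg_cancel, exp_zero]
    exact congrArg (fun f : E →L[ℝ] E => f z) h1
  refine ⟨fun x y => hinner x y r, fun x => ?_, fun x y => ?_⟩
  · have h1 : Commute (LinearMap.toContinuousLinearMap s) A := by
      ext x
      change s (br Z x) = br Z (s x)
      rw [hs, hZ]
    exact congrArg (fun f : E →L[ℝ] E => f x) ((h1.smul_right r).exp_right).eq
  · refine ext_inner_right ℝ fun z => ?_
    rw [← hsurj z, hbr, hinner]

/-- In a compact symmetric pair, a flat subspace `V` is at most as large as a maximal flat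
subspace `C`: for generic `X ∈ C`, `Y ∈ V`, a maximum of `⟨g X, Y⟩` over the compact group of
isometric automorphisms makes `g X` commute with `Y`, so that `V ⊆ g C`. -/
theorem finrank_flat_le (s : E →ₗ[ℝ] E)
    (hskew : ∀ x y, br x y = -br y x)
    (hjac : ∀ z x y, br z (br x y) = br (br z x) y + br x (br z y))
    (hinv : ∀ z x y, ⟪br z x, y⟫_ℝ = -⟪x, br z y⟫_ℝ)
    (hs : ∀ x y, s (br x y) = br (s x) (s y))
    (C V : Submodule ℝ E) (hCs : ∀ x ∈ C, s x = -x) (hVs : ∀ x ∈ V, s x = -x)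
    (hC : ∀ x ∈ C, ∀ y ∈ C, br x y = 0) (hV : ∀ x ∈ V, ∀ y ∈ V, br x y = 0)
    (hmax : ∀ y, s y = -y → (∀ x ∈ C, br x y = 0) → y ∈ C) :
    Module.finrank ℝ V ≤ Module.finrank ℝ C := by
  have hcomm : ∀ W : Submodule ℝ E, (∀ x ∈ W, ∀ y ∈ W, br x y = 0) →
      ∀ x ∈ W, ∀ y ∈ W, ∀ z, br x (br y z) = br y (br x z) := by
    intro W hW x hx y hy z
    rw [hjac, hW x hx y hy, map_zero, LinearMap.zero_apply, zero_add]
  obtain ⟨X, hXC, hX⟩ := exists_generic br hinv C (hcomm C hC)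
  obtain ⟨Y, hYV, hY⟩ := exists_generic br hinv V (hcomm V hV)
  obtain ⟨g, hg, hgmax⟩ := (isCompact_isometricAutomorphisms br s).exists_isMaxOn
    ⟨ContinuousLinearMap.id ℝ E, fun _ _ => rfl, fun _ => rfl, fun _ _ => rfl⟩
    (f := fun g : E →L[ℝ] E => ⟪g X, Y⟫_ℝ) (by fun_prop)
  have hgXs : s (g X) = -g X := by rw [hg.2.1, hCs X hXC, map_neg]
  -- the derivative of `⟪exp (r ad Z) g X, Y⟫` vanishes at the maximum `r = 0`
  have hcrit : ∀ Z, s Z = Z → ⟪br Z (g X), Y⟫_ℝ = 0 := by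
    intro Z hZ
    set A : E →L[ℝ] E := LinearMap.toContinuousLinearMap (br Z) with hA
    have h1 := (hasDerivAt_exp_smul_const' (𝕂 := ℝ) A (0 : ℝ)).clm_apply
      (hasDerivAt_const (0 : ℝ) (g X))
    have h2 : HasDerivAt (fun r : ℝ => ⟪exp (r • A) (g X), Y⟫_ℝ) ⟪br Z (g X), Y⟫_ℝ 0 := by
      have h3 := h1.inner ℝ (hasDerivAt_const (0 : ℝ) Y)
      simpa [hA] using h3
    refine IsLocalMax.hasDerivAt_eq_zero (Filter.Eventually.of_forall fun r => ?_) h2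
    have h3 := exp_mem_isometricAutomorphisms br s hjac hinv hs hZ r
    have h4 : (exp (r • A) * g) ∈ isometricAutomorphisms br s := by
      refine ⟨fun x y => ?_, fun x => ?_, fun x y => ?_⟩
      · exact (h3.1 _ _).trans (hg.1 _ _)
      · exact (h3.2.1 _).trans (congrArg _ (hg.2.1 x))
      · exact (congrArg _ (hg.2.2 x y)).trans (h3.2.2 _ _)
    have h5 := hgmax h4
    simpa using h5
  -- `[g X, Y]` is itself fixed by `s`, so the critical equation gives `⟪[g X, Y], [g X, Y]⟫ = 0`
  have hzero : br (g X) Y = 0 := by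
    have h1 := hcrit (br (g X) Y) (by rw [hs, hgXs, hVs Y hYV]; simp)
    rw [hskew, inner_neg_left, neg_eq_zero, hinv, neg_eq_zero] at h1
    exact inner_self_eq_zero.mp h1
  have hVg := hY (g X) (by rw [hskew, hzero, neg_zero])
  have hinj : Function.Injective (g : E →ₗ[ℝ] E) := by
    rw [← LinearMap.ker_eq_bot, LinearMap.ker_eq_bot']
    intro v hv
    have h1 := hg.1 v v
    rw [show g v = 0 from hv, inner_zero_left, eq_comm, inner_self_eq_zero] at h1
    exact h1
  have hsurj := LinearMap.injective_iff_surjective.mp hinj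
  -- `g X` commutes with the generic element `Y`, hence with `V`; applying `g⁻¹` gives elements that
  -- commute with the generic element `X` of `C`, hence lie in `C`
  have hle : V ≤ C.map (g : E →ₗ[ℝ] E) := by
    intro v hv
    obtain ⟨u, hu⟩ := hsurj v
    refine ⟨u, hmax u (hinj ?_) (hX u (hinj ?_)), hu⟩
    · have h1 : g (s u) = s (g u) := (hg.2.1 u).symm
      have h2 : g u = v := hu
      change g (s u) = g (-u)
      rw [h1, map_neg, h2, hVs v hv]
    · have h2 : g u = v := hu
      change g (br X u) = g 0
      rw [hg.2.2, h2, map_zero, hskew, hVg v hv, neg_zero]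
  exact (Submodule.finrank_mono hle).trans (Submodule.finrank_map_le _ _)

end Flats

end

end CasimirRadial

namespace CasimirRadial

noncomputable section

attribute [local instance 100] LieRing.ofAssociativeRing

/-! ### Cartan involutions -/

section CartanInvolution

variable {L : Type*} [LieRing L] [LieAlgebra ℝ L]

/-- Commuting involutions `θ`, `σ` preserving an invariant form `B`, where `θ` is a Cartan involution
for `B`. -/
structure CartanData (θ σ : L →ₗ⁅ℝ⁆ L) (B : LinearMap.BilinForm ℝ L) : Prop where
  theta_involutive : ∀ X, θ (θ X) = X
  sigma_involutive : ∀ X, σ (σ X) = X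
  commutes : ∀ X, θ (σ X) = σ (θ X)
  symm : B.IsSymm
  bracket : ∀ X Y Z : L, B ⁅X, Y⁆ Z = -B Y ⁅X, Z⁆
  theta_form : ∀ X Y, B (θ X) (θ Y) = B X Y
  sigma_form : ∀ X Y, B (σ X) (σ Y) = B X Y
  orthogonal : ∀ X Y, θ X = X → θ Y = -Y → B X Y = 0
  pos_def : ∀ X, θ X = -X → X ≠ 0 → 0 < B X X
  neg_def : ∀ X, θ X = X → X ≠ 0 → B X X < 0

variable {θ σ : L →ₗ⁅ℝ⁆ L} {B : LinearMap.BilinForm ℝ L}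

namespace CartanData

theorem form_pos (h : CartanData θ σ B) {X : L} (hX : X ≠ 0) : 0 < -B X (θ X) := by
  set P := X + θ X with hP
  set M := X - θ X with hM
  have hP' : θ P = P := by rw [hP, map_add, h.theta_involutive, add_comm]
  have hM' : θ M = -M := by rw [hM, map_sub, h.theta_involutive, neg_sub]
  have hPM := h.orthogonal P M hP' hM'
  have h1 : B P P - B M M = 4 * B X (θ X) := by
    rw [hP, hM]
    simp only [map_add, map_sub, LinearMap.add_apply, LinearMap.sub_apply]
    rw [h.symm.eq (θ X) X]
    ring
  have h2 : B P P ≤ 0 := by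
    by_cases h0 : P = 0
    · simp [h0]
    · exact (h.neg_def P hP' h0).le
  have h3 : 0 ≤ B M M := by
    by_cases h0 : M = 0
    · simp [h0]
    · exact (h.pos_def M hM' h0).le
  by_cases h0 : P = 0
  · have h4 : M ≠ 0 := by
      intro h5
      apply hX
      have h6 : (2 : ℝ) • X = P + M := by rw [hP, hM, two_smul]; abel
      rw [h0, h5, add_zero] at h6
      exact (smul_eq_zero.mp h6).resolve_left two_ne_zero
    linarith [h.pos_def M hM' h4]
  · linarith [h.neg_def P hP' h0]

theorem form_theta (h : CartanData θ σ B) (X Y : L) : B (θ X) Y = B X (θ Y) := by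
  rw [← h.theta_form X, h.theta_involutive]

/-- Elements of `𝔨` and of `𝔭` act semisimply. -/
theorem isSemisimple_ad [Module.Finite ℝ L] (h : CartanData θ σ B) {X : L}
    (hX : θ X = X ∨ θ X = -X) :
    Module.End.IsSemisimple (LieAlgebra.ad ℝ L X : Module.End ℝ L) := by
  let β : LinearMap.BilinForm ℝ L := -B.compRight (θ : L →ₗ[ℝ] L)
  have hβ : ∀ x y, β x y = -B x (θ y) := fun x y => rfl
  have hs : ∀ x y, β x y = β y x := fun x y => by
    rw [hβ, hβ, ← h.form_theta, h.symm.eq]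
  have hp : ∀ x, x ≠ 0 → 0 < β x x := fun x hx => h.form_pos hx
  rcases hX with hX | hX
  · refine isSemisimple_of_adjoint β hs hp _ (-1) fun x y => ?_
    rw [hβ, hβ, LieAlgebra.ad_apply, LieAlgebra.ad_apply, h.bracket, LieHom.map_lie, hX]
    ring
  · refine isSemisimple_of_adjoint β hs hp _ 1 fun x y => ?_
    rw [hβ, hβ, LieAlgebra.ad_apply, LieAlgebra.ad_apply, h.bracket, LieHom.map_lie, hX, neg_lie,
      map_neg]
    ring

/-- The bracket of the compact dual `𝔨 ⊕ i𝔭`, transported to `𝔤 = 𝔨 ⊕ 𝔭`. -/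
def dualBracket (θ : L →ₗ⁅ℝ⁆ L) : L →ₗ[ℝ] L →ₗ[ℝ] L :=
  LinearMap.mk₂ ℝ (fun X Y => (1 / 2 : ℝ) • (⁅X, Y⁆ + ⁅X, θ Y⁆ + ⁅θ X, Y⁆ - ⁅θ X, θ Y⁆))
    (fun X X' Y => by simp only [map_add, add_lie]; module)
    (fun r X Y => by simp only [map_smul, smul_lie]; module)
    (fun X Y Y' => by simp only [map_add, lie_add]; module)
    (fun r X Y => by simp only [map_smul, lie_smul]; module)

theorem dualBracket_apply (X Y : L) : dualBracket θ X Y =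
    (1 / 2 : ℝ) • (⁅X, Y⁆ + ⁅X, θ Y⁆ + ⁅θ X, Y⁆ - ⁅θ X, θ Y⁆) := rfl

theorem theta_dualBracket (h : CartanData θ σ B) (X Y : L) : θ (dualBracket θ X Y) =
    (1 / 2 : ℝ) • (⁅θ X, θ Y⁆ + ⁅θ X, Y⁆ + ⁅X, θ Y⁆ - ⁅X, Y⁆) := by
  simp only [dualBracket_apply, map_smul, map_add, map_sub, LieHom.map_lie, h.theta_involutive]

theorem dualBracket_skew (X Y : L) : dualBracket θ X Y = -dualBracket θ Y X := by
  rw [dualBracket_apply, dualBracket_apply, ← lie_skew X Y, ← lie_skew X (θ Y), ← lie_skew (θ X) Y,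
    ← lie_skew (θ X) (θ Y)]
  module

theorem dualBracket_jacobi (h : CartanData θ σ B) (Z X Y : L) :
    dualBracket θ Z (dualBracket θ X Y) =
      dualBracket θ (dualBracket θ Z X) Y + dualBracket θ X (dualBracket θ Z Y) := by
  have e : ∀ X Y : L, (2 : ℝ) • dualBracket θ X Y = ⁅X, Y⁆ + ⁅X, θ Y⁆ + ⁅θ X, Y⁆ - ⁅θ X, θ Y⁆ :=
    fun X Y => by rw [dualBracket_apply]; module
  have e' : ∀ X Y : L, (2 : ℝ) • θ (dualBracket θ X Y) =
      ⁅θ X, θ Y⁆ + ⁅θ X, Y⁆ + ⁅X, θ Y⁆ - ⁅X, Y⁆ :=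
    fun X Y => by rw [h.theta_dualBracket]; module
  have h4 : (4 : ℝ) ≠ 0 := by norm_num
  refine smul_right_injective L h4 ?_
  change (4 : ℝ) • _ = (4 : ℝ) • _
  rw [show (4 : ℝ) = 2 * 2 by norm_num, mul_smul, mul_smul, smul_add, e, e, e, smul_add]
  simp only [smul_add, smul_sub, ← lie_smul, e, e']
  have e'' : ∀ P Q : L, ⁅dualBracket θ Z P, (2 : ℝ) • Q⁆ = ⁅(2 : ℝ) • dualBracket θ Z P, Q⁆ ∧
      ⁅θ (dualBracket θ Z P), (2 : ℝ) • Q⁆ = ⁅(2 : ℝ) • θ (dualBracket θ Z P), Q⁆ :=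
    fun P Q => by simp only [lie_smul, smul_lie, and_self]
  simp only [(e'' _ _).1, (e'' _ _).2, e, e']
  simp only [lie_add, lie_sub, add_lie, sub_lie]
  rw [leibniz_lie Z X Y, leibniz_lie Z X (θ Y), leibniz_lie Z (θ X) Y, leibniz_lie Z (θ X) (θ Y),
    leibniz_lie (θ Z) X Y, leibniz_lie (θ Z) X (θ Y), leibniz_lie (θ Z) (θ X) Y,
    leibniz_lie (θ Z) (θ X) (θ Y)]
  abel

theorem dualBracket_form (h : CartanData θ σ B) (Z X Y : L) :
    -B (dualBracket θ Z X) (θ Y) = -(-B X (θ (dualBracket θ Z Y))) := by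
  have e : ∀ a b c : L, B ⁅a, b⁆ c = -B b ⁅a, c⁆ := h.bracket
  have h1 : B (θ X) ⁅Z, θ Y⁆ = B X ⁅θ Z, Y⁆ := by
    rw [h.form_theta, LieHom.map_lie, h.theta_involutive]
  have h2 : B (θ X) ⁅θ Z, θ Y⁆ = B X ⁅Z, Y⁆ := by
    rw [h.form_theta, LieHom.map_lie, h.theta_involutive, h.theta_involutive]
  rw [h.theta_dualBracket, dualBracket_apply]
  simp only [map_smul, map_add, map_sub, LinearMap.smul_apply, LinearMap.add_apply,
    LinearMap.sub_apply, e, h1, h2, smul_eq_mul]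
  ring

theorem sigma_dualBracket (h : CartanData θ σ B) (X Y : L) :
    σ (dualBracket θ X Y) = dualBracket θ (σ X) (σ Y) := by
  simp only [dualBracket_apply, map_smul, map_add, map_sub, LieHom.map_lie, h.commutes]

theorem mem_antiFixed {X : L} : X ∈ antiFixed σ ↔ σ X = -X := by
  rw [antiFixed, LinearMap.mem_ker]
  exact add_eq_zero_iff_eq_neg

/-- A `θ`-stable commutative subspace of `𝔤^{-σ}` is at most as large as the fundamental Cartan
subspace. -/
theorem finrank_le_of_isCommSubspace [Module.Finite ℝ L] (h : CartanData θ σ B)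
    {t a : Submodule ℝ L} (hta : IsFundamentalCartan θ σ t a) (V : Submodule ℝ L)
    (hVσ : V ≤ antiFixed σ) (hV : IsCommSubspace V) (hVθ : ∀ X ∈ V, θ X ∈ V) :
    Module.finrank ℝ V ≤ Module.finrank ℝ (t ⊔ a : Submodule ℝ L) := by
  -- the inner product `-B(X, θ Y)`
  let core : InnerProductSpace.Core ℝ L :=
    { inner := fun x y => -B x (θ y)
      conj_inner_symm := fun x y => by
        change -B y (θ x) = -B x (θ y)
        rw [← h.form_theta, h.symm.eq]
      re_inner_nonneg := fun x => by
        change 0 ≤ -B x (θ x)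
        by_cases hx : x = 0
        · simp [hx]
        · exact (h.form_pos hx).le
      add_left := fun x y z => by
        change -B (x + y) (θ z) = -B x (θ z) + -B y (θ z)
        rw [map_add, LinearMap.add_apply, neg_add]
      smul_left := fun x y r => by
        change -B (r • x) (θ y) = r * -B x (θ y)
        rw [map_smul, LinearMap.smul_apply, smul_eq_mul, mul_neg]
      definite := fun x hx => by
        by_contra h0
        exact (h.form_pos h0).ne' hx }
  let _ : NormedAddCommGroup L := core.toNormedAddCommGroup
  let _ : InnerProductSpace ℝ L := InnerProductSpace.ofCore core.toCore
  have hθt : ∀ X ∈ t, θ X = X := fun X hX => by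
    have h1 := (hta.maximal_t.prop.1 hX).1
    exact sub_eq_zero.mp (LinearMap.mem_ker.mp h1)
  have hθa : ∀ X ∈ a, θ X = -X := fun X hX => mem_antiFixed.mp (hta.le_p hX)
  have hθC : ∀ X ∈ t ⊔ a, θ X ∈ t ⊔ a := by
    intro X hX
    obtain ⟨Y, hY, Z, hZ, rfl⟩ := Submodule.mem_sup.mp hX
    rw [map_add, hθt Y hY, hθa Z hZ]
    exact add_mem (Submodule.mem_sup_left hY) (Submodule.mem_sup_right (neg_mem hZ))
  have hcomm : ∀ W : Submodule ℝ L, IsCommSubspace W → (∀ X ∈ W, θ X ∈ W) →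
      ∀ X ∈ W, ∀ Y ∈ W, dualBracket θ X Y = 0 := by
    intro W hW hWθ X hX Y hY
    rw [dualBracket_apply, hW X hX Y hY, hW X hX _ (hWθ Y hY), hW _ (hWθ X hX) Y hY,
      hW _ (hWθ X hX) _ (hWθ Y hY)]
    simp
  refine finrank_flat_le (dualBracket θ) (σ : L →ₗ[ℝ] L) dualBracket_skew h.dualBracket_jacobi
    (fun z x y => h.dualBracket_form z x y) h.sigma_dualBracket (t ⊔ a) V
    (fun X hX => mem_antiFixed.mp (hta.maximal_c.prop.1 hX)) (fun X hX => mem_antiFixed.mp (hVσ hX))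
    (hcomm _ hta.maximal_c.prop.2 hθC) (hcomm _ hV hVθ) ?_
  -- the fundamental Cartan subspace is its own centraliser, also for the dual bracket
  intro Y hY hYc
  have hYt : ∀ X ∈ t, ⁅X, Y⁆ = 0 := by
    intro X hX
    have h1 := hYc X (Submodule.mem_sup_left hX)
    rw [dualBracket_apply, hθt X hX] at h1
    rw [← h1]
    module
  have hYa : ∀ X ∈ a, ⁅X, Y⁆ = 0 := by
    intro X hX
    have h1 := hYc X (Submodule.mem_sup_right hX)
    rw [dualBracket_apply, hθa X hX, neg_lie, neg_lie] at h1
    have h2 : ⁅X, θ Y⁆ = 0 := by rw [← h1]; module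
    have h3 := congrArg θ h2
    rw [LieHom.map_lie, h.theta_involutive, hθa X hX, neg_lie, map_zero, neg_eq_zero] at h3
    exact h3
  have hYC : ∀ X ∈ t ⊔ a, ⁅X, Y⁆ = 0 := by
    intro X hX
    obtain ⟨P, hP, Q, hQ, rfl⟩ := Submodule.mem_sup.mp hX
    rw [add_lie, hYt P hP, hYa Q hQ, add_zero]
  have hmax := hta.maximal_c.2 (y := (t ⊔ a) ⊔ Submodule.span ℝ {Y})
    ⟨sup_le hta.maximal_c.prop.1
      ((Submodule.span_singleton_le_iff_mem _ _).mpr (mem_antiFixed.mpr hY)), ?_⟩ le_sup_left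
  · exact hmax (Submodule.mem_sup_right (Submodule.mem_span_singleton_self Y))
  · intro P hP Q hQ
    obtain ⟨P₁, hP₁, P₂, hP₂, rfl⟩ := Submodule.mem_sup.mp hP
    obtain ⟨Q₁, hQ₁, Q₂, hQ₂, rfl⟩ := Submodule.mem_sup.mp hQ
    obtain ⟨r, rfl⟩ := Submodule.mem_span_singleton.mp hP₂
    obtain ⟨r', rfl⟩ := Submodule.mem_span_singleton.mp hQ₂
    have h1 : ⁅Y, Q₁⁆ = 0 := by rw [← lie_skew, hYC Q₁ hQ₁, neg_zero]
    simp only [add_lie, lie_add, smul_lie, lie_smul, hta.maximal_c.prop.2 _ hP₁ _ hQ₁, hYC P₁ hP₁,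
      h1, lie_self, smul_zero, add_zero]

end CartanData

end CartanInvolution

/-! ### The radial data of a standard Cartan subset -/

section GroupData

variable {n : ℕ} {G : Type*} [TopologicalSpace G] [ChartedSpace (EuclideanSpace ℝ (Fin n)) G]
  [Group G] [LieGroup (𝓡 n) ∞ G]
  {K : Subgroup G} {θ : LieAlg n G →ₗ⁅ℝ⁆ LieAlg n G} {B : LinearMap.BilinForm ℝ (LieAlg n G)}
  {σ : LieAlg n G →ₗ⁅ℝ⁆ LieAlg n G} {t a : Submodule ℝ (LieAlg n G)}
  {c' : LieSubalgebra ℝ (LieAlg n G)} {t₀ : G}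

theorem IsReductiveLieGroup.cartanData (hG : IsReductiveLieGroup K θ B)
    (hσ : ∀ X, σ (σ X) = X) (hθσ : ∀ X, θ (σ X) = σ (θ X))
    (hBσ : ∀ X Y, B (σ X) (σ Y) = B X Y) : CartanData θ σ B where
  theta_involutive := hG.theta_involutive
  sigma_involutive := hσ
  commutes := hθσ
  symm := hG.symm
  bracket := form_bracket B hG.ad_invariant
  theta_form := hG.theta_invariant
  sigma_form := hBσ
  orthogonal := hG.orthogonal
  pos_def := hG.pos_def
  neg_def := hG.neg_def

/-- If `t = exp(X)` with `X ∈ 𝔨^{-σ}`, then `Ad(t) σ Ad(t) = σ`: the eigenvectors of `ad X` span `𝔤_ℂ`,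
and `σ` interchanges those of opposite eigenvalue. -/
theorem CartanData.Ad_sigma_Ad (h : CartanData θ σ B) {X : LieAlg n G} (hθX : θ X = X)
    (hσX : σ X = -X) (Y : LieAlg n G) : Ad n (lieExp X) (σ (Ad n (lieExp X) Y)) = σ Y := by
  set T := Ad n (lieExp X) with hT
  have hss := isSemisimple_baseChange (h.isSemisimple_ad (Or.inl hθX))
  have htop : ⨆ μ, (LieAlgebra.ad ℂ (Cx (LieAlg n G)) ((1 : ℂ) ⊗ₜ[ℝ] X)).eigenspace μ = ⊤ := by
    rw [← Module.End.iSup_maxGenEigenspace_eq_top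
      (LieAlgebra.ad ℂ (Cx (LieAlg n G)) ((1 : ℂ) ⊗ₜ[ℝ] X))]
    refine iSup_congr fun μ => ?_
    rw [Module.End.IsFinitelySemisimple.maxGenEigenspace_eq_eigenspace]
    rw [ad_one_tmul]
    exact hss.isFinitelySemisimple
  have key : ∀ v : Cx (LieAlg n G), homC T (homC σ (homC T v)) = homC σ v := by
    intro v
    have hv : v ∈ ⨆ μ, (LieAlgebra.ad ℂ (Cx (LieAlg n G)) ((1 : ℂ) ⊗ₜ[ℝ] X)).eigenspace μ := by
      rw [htop]; trivial
    induction hv using Submodule.iSup_induction' with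
    | mem μ v hv =>
      have h1 := Module.End.mem_eigenspace_iff.mp hv
      have h2 : LieAlgebra.ad ℂ (Cx (LieAlg n G)) ((1 : ℂ) ⊗ₜ[ℝ] X) (homC σ v) =
          (-μ) • homC σ v := by
        have e1 : (1 : ℂ) ⊗ₜ[ℝ] X = -homC σ ((1 : ℂ) ⊗ₜ[ℝ] X) := by
          rw [homC_tmul, hσX, TensorProduct.tmul_neg, neg_neg]
        rw [LieAlgebra.ad_apply] at h1 ⊢
        rw [e1, neg_lie, ← LieHom.map_lie, h1, map_smul, neg_smul]
      rw [homC_Ad_lieExp X h1, map_smul, map_smul, homC_Ad_lieExp X h2, smul_smul, ← Complex.exp_add,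
        add_neg_cancel, Complex.exp_zero, one_smul]
    | zero => simp
    | add x y _ _ hx hy => simp only [map_add, hx, hy]
  have h3 := key ((1 : ℂ) ⊗ₜ[ℝ] Y)
  simp only [homC_tmul] at h3
  exact one_tmul_injective h3

/-- The elements of `𝔠'` act semisimply because `𝔠' = 𝔱' ⊕ 𝔞'` with `𝔱' ≤ 𝔨` and `𝔞' ≤ 𝔭`, and
`Ad(t) σ Ad(t) = σ` because `t ∈ exp(𝔱)`. -/
theorem radialData_of_isStandardCartan (h : CartanData θ σ B) (hG : IsReductiveLieGroup K θ B)
    (hC : IsFundamentalCartan θ σ t a) (hC' : IsStandardCartan θ σ t a c' t₀) :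
    RadialData σ (Ad n t₀) B c' where
  symm := hG.symm
  nondegenerate := hG.nondegenerate
  bracket := h.bracket
  involutive := h.sigma_involutive
  sigma_form := h.sigma_form
  anti X hX := CartanData.mem_antiFixed.mp (hC'.le_inf hX).1
  comm := hC'.comm
  iSup_rootSpace := by
    refine iSup_rootSpace_eq_top c' hC'.comm fun X hX => ?_
    obtain ⟨t', a', ht', -, ha', hdec⟩ := hC'.decomposition
    have hX' : X ∈ t' ⊔ a' := hdec ▸ hX
    obtain ⟨Y, hY, Z, hZ, rfl⟩ := Submodule.mem_sup.mp hX'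
    have hYc : Y ∈ c'.toSubmodule := by rw [hdec]; exact Submodule.mem_sup_left hY
    have hZc : Z ∈ c'.toSubmodule := by rw [hdec]; exact Submodule.mem_sup_right hZ
    have hYθ : θ Y = Y :=
      sub_eq_zero.mp (LinearMap.mem_ker.mp (hC.maximal_t.prop.1 (ht' hY)).1)
    rw [map_add]
    refine Module.End.IsSemisimple.add_of_commute ?_ (h.isSemisimple_ad (Or.inl hYθ))
      (h.isSemisimple_ad (Or.inr (CartanData.mem_antiFixed.mp (ha' hZ))))
    rw [commute_iff_lie_eq, ← LieHom.map_lie, hC'.comm Y hYc Z hZc, map_zero]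
  twist_form X Y := hG.ad_invariant t₀ X Y
  twist Y := by
    obtain ⟨X, hX, rfl⟩ := hC'.mem_T
    have h1 := hC.maximal_t.prop.1 hX
    exact h.Ad_sigma_Ad (sub_eq_zero.mp (LinearMap.mem_ker.mp h1.1))
      (CartanData.mem_antiFixed.mp h1.2) Y

/-- Elements of `C' ∩ G_rs` are regular points in the sense of linear algebra. Only the commutativity
of `𝔤^{-σ} ∩ Ad(x) 𝔤^{-σ}` matters. -/
theorem isRegularPoint_of_mem (X : c')
    (hX : lieExp (X : LieAlg n G) * t₀ ∈ regularSemisimple σ) :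
    IsRegularPoint σ (Ad n t₀) c' (Ad n (lieExp (X : LieAlg n G) * t₀)) X where
  apply_eq α v hv := by
    rw [show Ad n (lieExp (X : LieAlg n G) * t₀) = (Ad n (lieExp (X : LieAlg n G))).comp (Ad n t₀)
      from LieHom.ext fun Y => Ad_mul _ _ Y, homC_comp_apply]
    exact homC_Ad_lieExp _ (hv X)
  comm u v u' v' hu hv hu' hv' huu' hvv' :=
    hX.2 u ⟨CartanData.mem_antiFixed.mpr hu, u', CartanData.mem_antiFixed.mpr hu', huu'⟩ v
      ⟨CartanData.mem_antiFixed.mpr hv, v', CartanData.mem_antiFixed.mpr hv', hvv'⟩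

/-- If `C' ∩ G_rs` is not empty, then `𝔠'` is its own centraliser in `𝔤^{-σ}`: the centraliser is
commutative and `θ`-stable, so that its dimension is at most `dim 𝔠 = dim 𝔠'`. -/
theorem mem_of_centralizes (h : CartanData θ σ B) (hG : IsReductiveLieGroup K θ B)
    (hC : IsFundamentalCartan θ σ t a) (hC' : IsStandardCartan θ σ t a c' t₀)
    {φ : Cx (LieAlg n G) →ₗ[ℂ] Cx (LieAlg n G)} {ε : (c' →ₗ[ℝ] ℂ) → ℂˣ}
    (hφ : TechnicalCondition σ B c' (Ad n t₀) φ ε) (X : c')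
    (hX : lieExp (X : LieAlg n G) * t₀ ∈ regularSemisimple σ) {Y : LieAlg n G} (hY : σ Y = -Y)
    (hYc : ∀ Z ∈ c', ⁅Z, Y⁆ = 0) : Y ∈ c' := by
  have hR := radialData_of_isStandardCartan h hG hC hC'
  have hE := isRegularPoint_of_mem X hX
  let V : Submodule ℝ (LieAlg n G) :=
    { carrier := {Y | σ Y = -Y ∧ ∀ Z ∈ c', ⁅Z, Y⁆ = 0}
      add_mem' := fun {x y} hx hy =>
        ⟨by rw [map_add, hx.1, hy.1, neg_add], fun Z hZ => by
          rw [lie_add, hx.2 Z hZ, hy.2 Z hZ, add_zero]⟩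
      zero_mem' := ⟨by simp, fun Z _ => lie_zero Z⟩
      smul_mem' := fun r x hx =>
        ⟨by rw [map_smul, hx.1, smul_neg], fun Z hZ => by rw [lie_smul, hx.2 Z hZ, smul_zero]⟩ }
  have hθc : ∀ Z ∈ c', θ Z ∈ c' := by
    intro Z hZ
    obtain ⟨t', a', ht', -, ha', hdec⟩ := hC'.decomposition
    have hZ' : Z ∈ t' ⊔ a' := hdec ▸ hZ
    obtain ⟨P, hP, Q, hQ, rfl⟩ := Submodule.mem_sup.mp hZ'
    have hPθ : θ P = P :=
      sub_eq_zero.mp (LinearMap.mem_ker.mp (hC.maximal_t.prop.1 (ht' hP)).1)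
    rw [map_add, hPθ, CartanData.mem_antiFixed.mp (ha' hQ)]
    change _ ∈ c'.toSubmodule
    rw [hdec]
    exact add_mem (Submodule.mem_sup_left hP) (Submodule.mem_sup_right (neg_mem hQ))
  have hle := h.finrank_le_of_isCommSubspace hC V
    (fun Y hY => CartanData.mem_antiFixed.mpr hY.1)
    (fun Y hY Y' hY' => hR.lie_eq_zero_of_centralizes hφ hE hY.1 hY'.1 hY.2 hY'.2)
    (fun Y hY => ⟨by rw [← h.commutes, hY.1, map_neg], fun Z hZ => by
      have h1 := congrArg θ (hY.2 _ (hθc Z hZ))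
      rwa [LieHom.map_lie, h.theta_involutive, map_zero] at h1⟩)
  have hcV : c'.toSubmodule ≤ V := fun Z hZ => ⟨hR.anti Z hZ, fun Z' hZ' => hR.comm Z' hZ' Z hZ⟩
  have heq := Submodule.eq_of_le_of_finrank_le hcV (hle.trans hC'.finrank_eq.ge)
  have hYV : Y ∈ V := ⟨hY, hYc⟩
  rw [← heq] at hYV
  exact hYV

end GroupData

end

end CasimirRadial

namespace CasimirRadial

noncomputable section

attribute [local instance 100] LieRing.ofAssociativeRing

/-! ### Injectivity of the evaluation maps -/

section Injectivity

variable {L : Type*} [LieRing L] [LieAlgebra ℝ L]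

theorem reCx_lie (Z : L) (v : Cx L) : reCx L ⁅(1 : ℂ) ⊗ₜ[ℝ] Z, v⁆ = ⁅Z, reCx L v⁆ := by
  induction v using TensorProduct.induction_on with
  | zero => rw [cx_lie_zero, map_zero, lie_zero]
  | tmul z X => rw [LieAlgebra.ExtendScalars.bracket_tmul, reCx_tmul, reCx_tmul, one_mul, lie_smul]
  | add x y hx hy => rw [cx_lie_add, map_add, map_add, hx, hy, lie_add]

theorem imCx_lie (Z : L) (v : Cx L) : imCx L ⁅(1 : ℂ) ⊗ₜ[ℝ] Z, v⁆ = ⁅Z, imCx L v⁆ := by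
  induction v using TensorProduct.induction_on with
  | zero => rw [cx_lie_zero, map_zero, lie_zero]
  | tmul z X => rw [LieAlgebra.ExtendScalars.bracket_tmul, imCx_tmul, imCx_tmul, one_mul, lie_smul]
  | add x y hx hy => rw [cx_lie_add, map_add, map_add, hx, hy, lie_add]

/-- In the complexification of a Lie algebra with a Cartan involution the centre meets the derived
algebra trivially: a central `X ∈ [𝔤, 𝔤]` is orthogonal to `θ X`. -/
theorem CartanData.eq_zero_of_central {θ σ : L →ₗ⁅ℝ⁆ L} {B : LinearMap.BilinForm ℝ L}
    (h : CartanData θ σ B) (X : Cx L) (hX : ∀ Y : Cx L, ⁅X, Y⁆ = 0)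
    (hX' : X ∈ Submodule.span ℂ {Z | ∃ U V : Cx L, ⁅U, V⁆ = Z}) : X = 0 := by
  have hX2 : ∀ Y : Cx L, ⁅Y, X⁆ = 0 := fun Y => by
    rw [← lie_skew Y X, hX, neg_zero]
  -- `θ W` is central for central `W`, hence orthogonal to `[𝔤, 𝔤]`; this is applied to the real and
  -- the imaginary part of `X`
  have key : ∀ W : L, (∀ Z : L, ⁅Z, W⁆ = 0) → formC B X ((1 : ℂ) ⊗ₜ[ℝ] θ W) = 0 := by
    intro W hW
    have hc : ∀ Y : Cx L, ⁅Y, (1 : ℂ) ⊗ₜ[ℝ] θ W⁆ = (0 : Cx L) := by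
      intro Y
      induction Y using TensorProduct.induction_on with
      | zero => exact cx_zero_lie _
      | tmul z Y =>
        have h1 := congrArg θ (hW (θ Y))
        rw [LieHom.map_lie, h.theta_involutive, map_zero] at h1
        rw [LieAlgebra.ExtendScalars.bracket_tmul, h1, TensorProduct.tmul_zero]
      | add x y hx hy => rw [cx_add_lie, hx, hy, add_zero]
    clear hX hX2
    induction hX' using Submodule.span_induction with
    | mem x hx =>
      obtain ⟨U, V, rfl⟩ := hx
      rw [formC_bracket h.bracket, hc, map_zero, neg_zero]
    | zero => simp
    | add x y _ _ hx hy => rw [map_add, LinearMap.add_apply, hx, hy, add_zero]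
    | smul r x _ hx => rw [map_smul, LinearMap.smul_apply, hx, smul_zero]
  have hr := key (reCx L X) fun Z => by rw [← reCx_lie, hX2, map_zero]
  have hi := key (imCx L X) fun Z => by rw [← imCx_lie, hX2, map_zero]
  have e : ∀ W : L, formC B X ((1 : ℂ) ⊗ₜ[ℝ] W) =
      (B (reCx L X) W : ℂ) + Complex.I * (B (imCx L X) W : ℂ) := by
    intro W
    conv_lhs => rw [eq_reCx_add_imCx X]
    rw [map_add, map_smul, LinearMap.add_apply, LinearMap.smul_apply,
      LinearMap.BilinForm.baseChange_tmul, LinearMap.BilinForm.baseChange_tmul, mul_one,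
      smul_eq_mul, Complex.real_smul, Complex.real_smul, mul_one, mul_one]
  rw [e] at hr hi
  have hr' := congrArg Complex.re hr
  have hi' := congrArg Complex.im hi
  simp at hr' hi'
  have h1 : reCx L X = 0 := by
    by_contra h0
    have := h.form_pos h0
    rw [hr'] at this
    simp at this
  have h2 : imCx L X = 0 := by
    by_contra h0
    have := h.form_pos h0
    rw [hi'] at this
    simp at this
  rw [eq_reCx_add_imCx X, h1, h2]
  simp

variable {σ T : L →ₗ⁅ℝ⁆ L} {B : LinearMap.BilinForm ℝ L} {c : LieSubalgebra ℝ L}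
  {φ : Cx L →ₗ[ℂ] Cx L} {ε : (c →ₗ[ℝ] ℂ) → ℂˣ} {E : L →ₗ⁅ℝ⁆ L} {X : c}

theorem mem_rootSpace_zero_iff {v : Cx L} :
    v ∈ rootSpace c 0 ↔ ∀ Z ∈ c, ⁅Z, reCx L v⁆ = 0 ∧ ⁅Z, imCx L v⁆ = 0 := by
  rw [mem_rootSpace_iff]
  constructor
  · intro h Z hZ
    have h1 := h ⟨Z, hZ⟩
    rw [LinearMap.zero_apply, zero_smul] at h1
    rw [← reCx_lie, ← imCx_lie, h1, map_zero, map_zero]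
    exact ⟨rfl, rfl⟩
  · intro h Z
    rw [LinearMap.zero_apply, zero_smul, eq_reCx_add_imCx ⁅(1 : ℂ) ⊗ₜ[ℝ] (Z : L), v⁆, reCx_lie,
      imCx_lie, (h Z Z.2).1, (h Z Z.2).2]
    simp

namespace RadialData

theorem mem_mC_iff (h : RadialData σ T B c) {v : Cx L} :
    v ∈ mC σ c ↔ homC σ v = v ∧ v ∈ rootSpace c 0 := by
  rw [mem_complexify_iff, mem_rootSpace_zero_iff, ← mem_hC_iff h.involutive, mem_complexify_iff]
  exact ⟨fun hv => ⟨⟨hv.1.1, hv.2.1⟩, fun Z hZ => ⟨hv.1.2 Z hZ, hv.2.2 Z hZ⟩⟩,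
    fun hv => ⟨⟨hv.1.1, fun Z hZ => (hv.2 Z hZ).1⟩, ⟨hv.1.2, fun Z hZ => (hv.2 Z hZ).2⟩⟩⟩

theorem homC_sigma_of_mem (h : RadialData σ T B c) {Z : Cx L} (hZ : Z ∈ complexify c) :
    homC σ Z = -Z := by
  rw [mem_complexify_iff] at hZ
  rw [eq_reCx_add_imCx Z, map_add, map_smul, homC_tmul, homC_tmul, h.anti _ hZ.1, h.anti _ hZ.2,
    TensorProduct.tmul_neg, TensorProduct.tmul_neg, smul_neg, neg_add]

theorem mem_complexify_of_anti (hc : ∀ Y, σ Y = -Y → (∀ Z ∈ c, ⁅Z, Y⁆ = 0) → Y ∈ c)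
    {v : Cx L} (hv : homC σ v = -v) (hv0 : v ∈ rootSpace c 0) : v ∈ complexify c := by
  rw [mem_rootSpace_zero_iff] at hv0
  rw [mem_complexify_iff]
  exact ⟨hc _ (by rw [← reCx_homC, hv, map_neg]) fun Z hZ => (hv0 Z hZ).1,
    hc _ (by rw [← imCx_homC, hv, map_neg]) fun Z hZ => (hv0 Z hZ).2⟩

/-- `t²` is the identity on `𝔤_0`. -/
theorem twist_twist_zero (h : RadialData σ T B c) (hφ : TechnicalCondition σ B c T φ ε)
    {v : Cx L} (hv : v ∈ rootSpace c 0) : homC T (homC T v) = v := by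
  by_cases h0 : rootSpace c (0 : c →ₗ[ℝ] ℂ) = ⊥
  · rw [h0, Submodule.mem_bot] at hv
    simp [hv]
  have h1 := h.eps_mul_eps_neg hφ h0
  rw [neg_zero] at h1
  rw [hφ.eq_smul 0 v hv, map_smul, h.twist_phi hφ hv, smul_smul, h1, one_smul]

theorem dualAction_zero (hφ : TechnicalCondition σ B c T φ ε) : hφ.dualAction 0 = 0 := rfl

theorem homC_twist_mem_zero (h : RadialData σ T B c) (hφ : TechnicalCondition σ B c T φ ε)
    {v : Cx L} (hv : v ∈ rootSpace c 0) : homC T v ∈ rootSpace c 0 := by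
  have h1 := h.homC_twist_mem hφ hv
  rwa [dualAction_zero] at h1

theorem phi_mem_zero (h : RadialData σ T B c) (hφ : TechnicalCondition σ B c T φ ε)
    {v : Cx L} (hv : v ∈ rootSpace c 0) : φ v ∈ rootSpace c 0 := by
  have h1 := h.phi_mem hφ hv
  rwa [dualAction_zero] at h1

theorem homC_twist_mem_mC (h : RadialData σ T B c) (hφ : TechnicalCondition σ B c T φ ε)
    {v : Cx L} (hv : v ∈ mC σ c) : homC T v ∈ mC σ c := by
  rw [h.mem_mC_iff] at *
  have h0 := h.homC_twist_mem_zero hφ hv.2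
  refine ⟨?_, h0⟩
  have h1 := h.twist_homC v
  rw [hv.1] at h1
  rw [← h.twist_twist_zero hφ (show homC σ (homC T v) ∈ rootSpace c 0 by
    simpa using h.homC_sigma_mem h0), h1]

theorem point_of_mem_zero (h : RadialData σ T B c) (hφ : TechnicalCondition σ B c T φ ε)
    (hE : IsRegularPoint σ T c E X) {v : Cx L} (hv : v ∈ rootSpace c 0) :
    homC E v = homC T v := by
  rw [hE.apply_eq 0 v (h.homC_twist_mem_zero hφ hv), LinearMap.zero_apply, Complex.exp_zero, one_smul]

theorem point_apply (h : RadialData σ T B c) (hφ : TechnicalCondition σ B c T φ ε)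
    (hE : IsRegularPoint σ T c E X) {α : c →ₗ[ℝ] ℂ} {v : Cx L} (hv : v ∈ rootSpace c α) :
    homC E v = rootPower ε (hφ.dualAction α) X • φ v := by
  rw [← h.point_phi hφ hE (h.phi_mem hφ hv), hφ.involutive]

/-- If `v ∈ 𝔥_ℂ` and `Ad(x) v ∈ 𝔥_ℂ + 𝔠_ℂ` then `v ∈ 𝔪_ℂ`: the operator
`v ↦ φ (Ad(x) v - σ Ad(x) σ v)` acts on `𝔤_β` by a scalar that vanishes only for `β = 0`. -/
theorem mem_mC_of_point_mem [Module.Finite ℝ L] (h : RadialData σ T B c)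
    (hφ : TechnicalCondition σ B c T φ ε) (hE : IsRegularPoint σ T c E X) {v u Z : Cx L}
    (hv : v ∈ hC σ) (hu : u ∈ hC σ) (hZ : Z ∈ complexify c) (huZ : homC E v = u + Z) :
    v ∈ mC σ c := by
  rw [mem_hC_iff h.involutive] at hv hu
  let Q : Cx L →ₗ[ℂ] Cx L := φ ∘ₗ ((homC E : Cx L →ₗ[ℂ] Cx L) -
    (homC σ : Cx L →ₗ[ℂ] Cx L) ∘ₗ (homC E : Cx L →ₗ[ℂ] Cx L) ∘ₗ (homC σ : Cx L →ₗ[ℂ] Cx L))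
  have hQ : ∀ w, Q w = φ (homC E w - homC σ (homC E (homC σ w))) := fun w => rfl
  have hQβ : ∀ (β : c →ₗ[ℝ] ℂ) (w : Cx L), w ∈ rootSpace c β → Q w =
      (rootPower ε (hφ.dualAction β) X - rootPower ε (-hφ.dualAction β) X) • w := by
    intro β w hw
    rw [hQ, h.point_apply hφ hE hw, h.point_apply hφ hE (h.homC_sigma_mem hw), map_smul,
      hφ.commutes, homC_involutive h.involutive, dualAction_neg, ← sub_smul, map_smul,
      hφ.involutive]
  have hQ0 : ∀ w ∈ rootSpace c 0, Q w = 0 := fun w hw => by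
    rw [hQβ 0 w hw, dualAction_zero, neg_zero, sub_self, zero_smul]
  -- `Ad(x) v = u + Z` gives `Q v = φ (2 Z)`
  have hQv : Q v ∈ rootSpace c 0 := by
    have h1 : Q v = φ ((2 : ℂ) • Z) := by
      rw [hQ, hv, huZ, map_add, hu, h.homC_sigma_of_mem hZ, two_smul]
      congr 1
      abel
    rw [h1]
    exact h.phi_mem_zero hφ (Submodule.smul_mem _ _ (h.complexify_le_rootSpace hZ))
  rw [h.mem_mC_iff]
  refine ⟨hv, ?_⟩
  -- split off the components of `v` at the roots
  set W : Submodule ℂ (Cx L) := ⨆ β, ⨆ (_ : β ≠ 0), rootSpace c β with hW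
  have hdisj : Disjoint (rootSpace c 0) W := iSupIndep_rootSpace c h.comm 0
  have htop : rootSpace c 0 ⊔ W = ⊤ := by
    rw [eq_top_iff, ← h.iSup_rootSpace]
    refine iSup_le fun β => ?_
    by_cases hβ : β = 0
    · rw [hβ]; exact le_sup_left
    · exact le_trans (le_iSup₂_of_le β hβ le_rfl) le_sup_right
  have hQW : W ≤ W.map Q := by
    refine iSup₂_le fun β hβ w hw => ?_
    by_cases hbot : rootSpace c β = ⊥
    · rw [hbot, Submodule.mem_bot] at hw
      rw [hw]; exact zero_mem _
    have hne : rootPower ε (hφ.dualAction β) X - rootPower ε (-hφ.dualAction β) X ≠ 0 := by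
      refine sub_ne_zero.mpr (h.rootPower_ne hφ hE ⟨fun h0 => hβ ?_,
        h.rootSpace_dualAction_ne_bot hφ hbot⟩)
      rw [← h.dualAction_dualAction hφ β, h0, dualAction_zero]
    refine ⟨(rootPower ε (hφ.dualAction β) X - rootPower ε (-hφ.dualAction β) X)⁻¹ • w,
      Submodule.smul_mem _ _ (Submodule.mem_iSup_of_mem β (Submodule.mem_iSup_of_mem hβ hw)), ?_⟩
    rw [map_smul, hQβ β w hw, smul_smul, inv_mul_cancel₀ hne, one_smul]
  have hWQ : W.map Q = W :=
    (Submodule.eq_of_le_of_finrank_le hQW (Submodule.finrank_map_le _ _)).symm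
  have hinj : ∀ w ∈ W, Q w = 0 → w = 0 := by
    have hmaps : ∀ w ∈ W, Q w ∈ W := fun w hw => hWQ ▸ Submodule.mem_map_of_mem hw
    have hsurj : Function.Surjective (Q.restrict hmaps) := by
      rintro ⟨w, hw⟩
      obtain ⟨w', hw', rfl⟩ := hQW hw
      exact ⟨⟨w', hw'⟩, rfl⟩
    have hinj := LinearMap.injective_iff_surjective.mpr hsurj
    intro w hw h0
    have h1 : Q.restrict hmaps ⟨w, hw⟩ = Q.restrict hmaps 0 := by
      rw [map_zero]; exact Subtype.ext h0
    exact congrArg Subtype.val (hinj h1)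
  have hvtop : v ∈ rootSpace c 0 ⊔ W := htop ▸ Submodule.mem_top
  obtain ⟨v₀, hv₀, w, hw, rfl⟩ := Submodule.mem_sup.mp hvtop
  rw [map_add, hQ0 v₀ hv₀, zero_add] at hQv
  have h2 : Q w = 0 :=
    (Submodule.disjoint_def.mp hdisj) _ hQv (hWQ ▸ Submodule.mem_map_of_mem hw)
  rw [hinj w hw h2, add_zero]
  exact hv₀

end RadialData

end Injectivity

end

end CasimirRadial

namespace CasimirRadial

noncomputable section

attribute [local instance 100] LieRing.ofAssociativeRing

/-! ### Evaluation on the balanced tensor product -/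

section BalancedEvaluation

variable {L : Type*} [LieRing L] [LieAlgebra ℝ L]

theorem inclU_ι (S : LieSubalgebra ℂ (Cx L)) (x : S) :
    inclU S (UniversalEnvelopingAlgebra.ι ℂ x) = UniversalEnvelopingAlgebra.ι ℂ (x : Cx L) :=
  UniversalEnvelopingAlgebra.lift_ι_apply _ _ _

theorem mapU_ι (f : L →ₗ⁅ℝ⁆ L) (x : Cx L) :
    mapU f (UniversalEnvelopingAlgebra.ι ℂ x) = UniversalEnvelopingAlgebra.ι ℂ (homC f x) :=
  UniversalEnvelopingAlgebra.lift_ι_apply _ _ _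

theorem inclU_ιm {σ : L →ₗ⁅ℝ⁆ L} {c : LieSubalgebra ℝ L} (x : mC σ c) :
    inclU (hC σ) (ιm σ c x) = UniversalEnvelopingAlgebra.ι ℂ (x : Cx L) :=
  inclU_ι (hC σ) _

theorem ι_commute {x y : Cx L} (h : ⁅x, y⁆ = 0) :
    Commute (UniversalEnvelopingAlgebra.ι ℂ x : Ug L) (UniversalEnvelopingAlgebra.ι ℂ y) := by
  rw [commute_iff_lie_eq, ← LieHom.map_lie, h, map_zero]

/-- An element of `𝔤_0` commutes with the image of `S(𝔠)`. -/
theorem commute_inclU {c : LieSubalgebra ℝ L} {x : Cx L} (hx : x ∈ rootSpace c 0) (p : Sc c) :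
    Commute (UniversalEnvelopingAlgebra.ι ℂ x : Ug L) (inclU (complexify c) p) := by
  have hp : p ∈ Algebra.adjoin ℂ (Set.range (UniversalEnvelopingAlgebra.ι ℂ :
      complexify c →ₗ⁅ℂ⁆ Sc c)) := by rw [adjoin_range_ι]; trivial
  induction hp using Algebra.adjoin_induction with
  | mem y hy =>
    obtain ⟨Z, rfl⟩ := hy
    rw [inclU_ι]
    refine ι_commute ?_
    have hZ := (mem_complexify_iff c _).mp Z.2
    have key : ∀ Y ∈ c, ⁅x, (1 : ℂ) ⊗ₜ[ℝ] Y⁆ = (0 : Cx L) := by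
      intro Y hY
      have h1 := mem_rootSpace_iff.mp hx ⟨Y, hY⟩
      rw [LinearMap.zero_apply, zero_smul] at h1
      rw [← lie_skew, h1, neg_zero]
    rw [eq_reCx_add_imCx (Z : Cx L), cx_lie_add, cx_lie_smul, key _ hZ.1, key _ hZ.2]
    simp
  | algebraMap r => rw [AlgHom.commutes]; exact (Algebra.commutes r _).symm
  | add y z _ _ hy hz => rw [map_add]; exact hy.add_right hz
  | mul y z _ _ hy hz => rw [map_mul]; exact hy.mul_right hz

variable {σ T : L →ₗ⁅ℝ⁆ L} {B : LinearMap.BilinForm ℝ L} {c : LieSubalgebra ℝ L}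
  {φ : Cx L →ₗ[ℂ] Cx L} {ε : (c →ₗ[ℝ] ℂ) → ℂˣ} {E : L →ₗ⁅ℝ⁆ L} {X : c}

theorem multiplyOut_balanced (hE : ∀ v ∈ mC σ c, homC E v = homC T v) (p : Sc c)
    {w : Uh σ ⊗[ℂ] Uh σ} (hw : w ∈ balanceRelations σ c T) :
    multiplyOut σ c (AlgHom.id ℂ _) (mapU E) (p ⊗ₜ[ℂ] w) = 0 := by
  induction hw using Submodule.span_induction with
  | mem w hw =>
    obtain ⟨u, v, Y, Y', hY, rfl⟩ := hw
    rw [TensorProduct.tmul_sub, map_sub, multiplyOut_tmul, multiplyOut_tmul]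
    simp only [map_mul, inclU_ιm, mapU_ι, AlgHom.id_apply]
    rw [hE _ Y.2, ← hY]
    have h0 : (Y' : Cx L) ∈ rootSpace c 0 := by
      have h1 := (mem_complexify_iff _ _).mp Y'.2
      exact mem_rootSpace_zero_iff.mpr fun Z hZ => ⟨h1.1.2 Z hZ, h1.2.2 Z hZ⟩
    rw [mul_assoc, mul_assoc, mul_assoc, ← mul_assoc (UniversalEnvelopingAlgebra.ι ℂ (Y' : Cx L)),
      (commute_inclU h0 p).eq]
    simp only [mul_assoc, sub_self]
  | zero => simp
  | add x y _ _ hx hy => rw [TensorProduct.tmul_add, map_add, hx, hy, add_zero]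
  | smul r x _ hx => rw [TensorProduct.tmul_smul, map_smul, hx, smul_zero]

/-- The linear map `p ⊗ u ⊗ v ↦ u p E(v)` on the balanced tensor product. -/
def balancedEval (hE : ∀ v ∈ mC σ c, homC E v = homC T v) :
    Sc c ⊗[ℂ] BalancedTensor σ c T →ₗ[ℂ] Ug L :=
  TensorProduct.lift (LinearMap.flip ((balanceRelations σ c T).liftQ
    (LinearMap.flip (TensorProduct.curry (multiplyOut σ c (AlgHom.id ℂ _) (mapU E))))
    fun _ hw => LinearMap.mem_ker.mpr (LinearMap.ext fun p => multiplyOut_balanced hE p hw)))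

theorem balancedEval_tmul (hE : ∀ v ∈ mC σ c, homC E v = homC T v) (p : Sc c)
    (w : Uh σ ⊗[ℂ] Uh σ) : balancedEval hE (p ⊗ₜ[ℂ] (balanceRelations σ c T).mkQ w) =
      multiplyOut σ c (AlgHom.id ℂ _) (mapU E) (p ⊗ₜ[ℂ] w) := rfl

/-- The linear map `f ⊗ p ⊗ u ⊗ v ↦ f(x) u p E(v)`. -/
def radialEval {R : Type*} [CommRing R] [Algebra ℂ R] (hE : ∀ v ∈ mC σ c, homC E v = homC T v)
    (evx : R →ₐ[ℂ] ℂ) : Radial R σ c T →ₗ[ℂ] Ug L :=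
  (TensorProduct.lid ℂ (Ug L)).toLinearMap ∘ₗ
    TensorProduct.map evx.toLinearMap (balancedEval hE)

/-- Evaluation factors through the balanced tensor product. -/
theorem evalRadial_eq_radialEval {R : Type*} [CommRing R] [Algebra ℂ R]
    (hE : ∀ v ∈ mC σ c, homC E v = homC T v) (evx : R →ₐ[ℂ] ℂ) (F : FreeRadial R σ c) :
    evalRadial σ c (AlgHom.id ℂ _) (mapU E) evx F = radialEval hE evx (Radial.mk R σ c T F) := by
  have h1 : (evalRadial σ c (AlgHom.id ℂ _) (mapU E) evx : FreeRadial R σ c →ₗ[ℂ] Ug L) =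
      radialEval hE evx ∘ₗ Radial.mk R σ c T := by
    refine TensorProduct.ext' fun f y => ?_
    induction y using TensorProduct.induction_on with
    | zero => simp
    | tmul p w =>
      simp only [evalRadial, radialEval, LinearMap.comp_apply, TensorProduct.map_tmul, Radial.mk,
        LinearMap.id_apply, balancedEval_tmul]
    | add x y hx hy => rw [TensorProduct.tmul_add, map_add, map_add, hx, hy]
  exact LinearMap.congr_fun h1 F

theorem radialEval_term {R : Type*} [CommRing R] [Algebra ℂ R]
    (hE : ∀ v ∈ mC σ c, homC E v = homC T v) (evx : R →ₐ[ℂ] ℂ) (f : R) (p : Sc c)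
    (w : Uh σ ⊗[ℂ] Uh σ) : radialEval hE evx (Radial.term T f p w) =
      evx f • multiplyOut σ c (AlgHom.id ℂ _) (mapU E) (p ⊗ₜ[ℂ] w) := by
  rw [Radial.term, ← evalRadial_eq_radialEval, evalRadial, LinearMap.comp_apply,
    TensorProduct.map_tmul]
  exact TensorProduct.lid_tmul _ _

theorem radialMk_surjective (R : Type*) [CommRing R] [Algebra ℂ R] (σ : L →ₗ⁅ℝ⁆ L)
    (c : LieSubalgebra ℝ L) (T : L →ₗ⁅ℝ⁆ L) : Function.Surjective (Radial.mk R σ c T) :=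
  TensorProduct.map_surjective Function.surjective_id
    (TensorProduct.map_surjective Function.surjective_id (Submodule.mkQ_surjective _))

end BalancedEvaluation

/-! ### Monomials -/

section Monomials

/-- The ordered list of the variables of a monomial in variables `κ₁ ⊕ κ₂`, those of `κ₁` first. -/
def sumList {κ₁ κ₂ : Type*} (l₁ : (κ₁ →₀ ℕ) → List κ₁) (l₂ : (κ₂ →₀ ℕ) → List κ₂)
    (a : κ₁ ⊕ κ₂ →₀ ℕ) : List (κ₁ ⊕ κ₂) :=
  (l₁ (Finsupp.sumFinsuppEquivProdFinsupp a).1).map Sum.inl ++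
    (l₂ (Finsupp.sumFinsuppEquivProdFinsupp a).2).map Sum.inr

theorem coe_sumList {κ₁ κ₂ : Type*} {l₁ : (κ₁ →₀ ℕ) → List κ₁} {l₂ : (κ₂ →₀ ℕ) → List κ₂}
    (h₁ : ∀ a, (l₁ a : Multiset κ₁) = Finsupp.toMultiset a)
    (h₂ : ∀ a, (l₂ a : Multiset κ₂) = Finsupp.toMultiset a) (a : κ₁ ⊕ κ₂ →₀ ℕ) :
    (sumList l₁ l₂ a : Multiset (κ₁ ⊕ κ₂)) = Finsupp.toMultiset a := by
  obtain ⟨⟨a₁, a₂⟩, rfl⟩ := Finsupp.sumFinsuppEquivProdFinsupp.symm.surjective a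
  have e : Finsupp.sumFinsuppEquivProdFinsupp.symm (a₁, a₂) =
      a₁.mapDomain Sum.inl + a₂.mapDomain Sum.inr := by
    ext i
    rcases i with i | i
    · simp [Finsupp.mapDomain_apply Sum.inl_injective, Finsupp.mapDomain_of_notMem_range]
    · simp [Finsupp.mapDomain_apply Sum.inr_injective, Finsupp.mapDomain_of_notMem_range]
  rw [sumList, Equiv.apply_symm_apply, e, map_add, ← Multiset.coe_add, ← Multiset.map_coe,
    ← Multiset.map_coe, h₁, h₂, Finsupp.toMultiset_map, Finsupp.toMultiset_map]

/-- A choice of an ordering of the variables in each monomial. -/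
def monomialList {κ : Type*} (a : κ →₀ ℕ) : List κ := (Finsupp.toMultiset a).toList

theorem coe_monomialList {κ : Type*} (a : κ →₀ ℕ) :
    (monomialList a : Multiset κ) = Finsupp.toMultiset a := Multiset.coe_toList _

/-- The monomial with exponents `a` in the elements `b i`. -/
def monomialU {g : Type*} [LieRing g] [LieAlgebra ℂ g] {κ : Type*} (b : κ → g) (a : κ →₀ ℕ) :
    UniversalEnvelopingAlgebra ℂ g :=
  ((monomialList a).map fun i => UniversalEnvelopingAlgebra.ι ℂ (b i)).prod

theorem span_monomialU {g : Type*} [LieRing g] [LieAlgebra ℂ g] {κ : Type*} [Fintype κ] (b : κ → g)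
    (hb : Submodule.span ℂ (Set.range b) = ⊤) : Submodule.span ℂ (Set.range (monomialU b)) = ⊤ :=
  span_monomials b hb monomialList coe_monomialList

theorem inclU_monomialU {L : Type*} [LieRing L] [LieAlgebra ℝ L] (S : LieSubalgebra ℂ (Cx L))
    {κ : Type*} (b : κ → S) (a : κ →₀ ℕ) :
    inclU S (monomialU b a) = monomialU (fun i => (b i : Cx L)) a := by
  rw [monomialU, monomialU, map_list_prod, List.map_map]
  refine congrArg List.prod (List.map_congr_left fun i _ => inclU_ι S (b i))

theorem mapU_monomialU {L : Type*} [LieRing L] [LieAlgebra ℝ L] (E : L →ₗ⁅ℝ⁆ L)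
    {κ : Type*} (b : κ → Cx L) (a : κ →₀ ℕ) :
    mapU E (monomialU b a) = monomialU (fun i => homC E (b i)) a := by
  rw [monomialU, monomialU, map_list_prod, List.map_map]
  refine congrArg List.prod (List.map_congr_left fun i _ => mapU_ι E (b i))

end Monomials

/-! ### Uniqueness of the decompositions -/

section Uniqueness

variable {L : Type*} [LieRing L] [LieAlgebra ℝ L]
  {σ T : L →ₗ⁅ℝ⁆ L} {B : LinearMap.BilinForm ℝ L} {c : LieSubalgebra ℝ L}
  {φ : Cx L →ₗ[ℂ] Cx L} {ε : (c →ₗ[ℝ] ℂ) → ℂˣ}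

/-- Elements of `U(𝔪)` can be moved from the right to the left factor. -/
theorem mkQ_tmul_prod_mul (hT : ∀ v ∈ mC σ c, homC T v ∈ mC σ c) {κ : Type*} (b : κ → mC σ c)
    (l : List κ) (u v : Uh σ) : ∃ u' : Uh σ, (balanceRelations σ c T).mkQ
      (u ⊗ₜ[ℂ] ((l.map fun i => ιm σ c (b i)).prod * v)) =
      (balanceRelations σ c T).mkQ (u' ⊗ₜ[ℂ] v) := by
  induction l generalizing u with
  | nil => exact ⟨u, by simp⟩
  | cons i l ih =>
    obtain ⟨u', hu'⟩ := ih (u * ιm σ c ⟨homC T (b i), hT _ (b i).2⟩)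
    refine ⟨u', ?_⟩
    rw [← hu', List.map_cons, List.prod_cons, mul_assoc, eq_comm, ← sub_eq_zero, ← map_sub,
      ← LinearMap.mem_ker, Submodule.ker_mkQ]
    exact Submodule.subset_span ⟨u, _, b i, ⟨homC T (b i), hT _ (b i).2⟩, rfl, rfl⟩

/-- If `𝔥 = 𝔪 ⊕ 𝔮`, the balanced tensor product is spanned by the tensors `u ⊗ q` for monomials `u` in
`U(𝔥)` and `q` in elements of `𝔮`. -/
theorem span_balanced (hT : ∀ v ∈ mC σ c, homC T v ∈ mC σ c) {κ₁ κ₂ κ₃ : Type*}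
    [Fintype κ₁] [Fintype κ₂] [Fintype κ₃]
    (bh : κ₁ → hC σ) (bm : κ₂ → mC σ c) (bq : κ₃ → hC σ)
    (hh : Submodule.span ℂ (Set.range bh) = ⊤)
    (hmq : Submodule.span ℂ (Set.range (Sum.elim
      (fun i => (⟨bm i, mC_le_hC σ c (bm i).2⟩ : hC σ)) bq)) = ⊤) :
    Submodule.span ℂ (Set.range fun a : (κ₁ →₀ ℕ) × (κ₃ →₀ ℕ) =>
      (balanceRelations σ c T).mkQ (monomialU bh a.1 ⊗ₜ[ℂ] monomialU bq a.2)) = ⊤ := by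
  set S := Submodule.span ℂ (Set.range fun a : (κ₁ →₀ ℕ) × (κ₃ →₀ ℕ) =>
      (balanceRelations σ c T).mkQ (monomialU bh a.1 ⊗ₜ[ℂ] monomialU bq a.2)) with hS
  have h1 : ∀ (u : Uh σ) (d : κ₃ →₀ ℕ),
      (balanceRelations σ c T).mkQ (u ⊗ₜ[ℂ] monomialU bq d) ∈ S := by
    intro u d
    have hu : u ∈ Submodule.span ℂ (Set.range (monomialU bh)) := by
      rw [span_monomialU bh hh]; trivial
    induction hu using Submodule.span_induction with
    | mem u hu =>
      obtain ⟨a, rfl⟩ := hu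
      exact Submodule.subset_span ⟨(a, d), rfl⟩
    | zero => rw [TensorProduct.zero_tmul, map_zero]; exact zero_mem _
    | add x y _ _ hx hy => rw [TensorProduct.add_tmul, map_add]; exact add_mem hx hy
    | smul r x _ hx =>
      rw [← TensorProduct.smul_tmul', map_smul]; exact Submodule.smul_mem _ _ hx
  have h2 : ∀ u v : Uh σ, (balanceRelations σ c T).mkQ (u ⊗ₜ[ℂ] v) ∈ S := by
    intro u v
    -- monomials whose factors from `𝔪` come first, so that these can be moved to the left factor
    have hv : v ∈ Submodule.span ℂ (Set.range fun a => ((sumList monomialList monomialList a).map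
        fun i => UniversalEnvelopingAlgebra.ι ℂ (Sum.elim
          (fun i => (⟨bm i, mC_le_hC σ c (bm i).2⟩ : hC σ)) bq i)).prod) := by
      rw [span_monomials _ hmq _ (coe_sumList coe_monomialList coe_monomialList)]; trivial
    induction hv using Submodule.span_induction with
    | mem v hv =>
      obtain ⟨a, rfl⟩ := hv
      dsimp only
      rw [sumList, List.map_append, List.prod_append, List.map_map, List.map_map]
      obtain ⟨u', hu'⟩ := mkQ_tmul_prod_mul hT bm
        (monomialList (Finsupp.sumFinsuppEquivProdFinsupp a).1) u
        (monomialU bq (Finsupp.sumFinsuppEquivProdFinsupp a).2)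
      exact (congrArg (· ∈ S) hu').mpr (h1 u' _)
    | zero => rw [TensorProduct.tmul_zero, map_zero]; exact zero_mem _
    | add x y _ _ hx hy => rw [TensorProduct.tmul_add, map_add]; exact add_mem hx hy
    | smul r x _ hx => rw [TensorProduct.tmul_smul, map_smul]; exact Submodule.smul_mem _ _ hx
  rw [eq_top_iff]
  rintro w -
  obtain ⟨w, rfl⟩ := Submodule.mkQ_surjective _ w
  induction w using TensorProduct.induction_on with
  | zero => rw [map_zero]; exact zero_mem _
  | tmul u v => exact h2 u v
  | add x y hx hy => rw [map_add]; exact add_mem hx hy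

variable [Module.Finite ℝ L]

/-- The space `S(𝔠) ⊗ (U(𝔥) ⊗_{U(𝔪)} U(𝔥))` has a basis that each regular point maps to linearly
independent elements of `U(𝔤)`: evaluation gives ordered monomials in a basis of `𝔥`, a basis of `𝔠`
and the image under `Ad(x)` of a basis of a complement of `𝔪` in `𝔥`. -/
theorem exists_spanning_family (h : RadialData σ T B c) (hφ : TechnicalCondition σ B c T φ ε)
    (hZ : ∀ X : Cx L, (∀ Y : Cx L, ⁅X, Y⁆ = 0) →
      X ∈ Submodule.span ℂ {Z | ∃ U V : Cx L, ⁅U, V⁆ = Z} → X = 0) :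
    ∃ (κ : Type) (w : κ → Sc c ⊗[ℂ] BalancedTensor σ c T),
      Submodule.span ℂ (Set.range w) = ⊤ ∧
      ∀ (E : L →ₗ⁅ℝ⁆ L) (X : c) (_ : IsRegularPoint σ T c E X)
        (hE : ∀ v ∈ mC σ c, homC E v = homC T v),
        LinearIndependent ℂ fun i => balancedEval hE (w i) := by
  obtain ⟨q, hq⟩ := Submodule.exists_isCompl
    ((mC σ c).toSubmodule.comap (hC σ).toSubmodule.subtype)
  let bh := Module.finBasis ℂ (hC σ)
  let bc := Module.finBasis ℂ (complexify c)
  let bm := Module.finBasis ℂ (mC σ c)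
  let bq := Module.finBasis ℂ q
  let vq : Fin (Module.finrank ℂ q) → hC σ := fun i => (bq i : hC σ)
  let w : (Fin (Module.finrank ℂ (complexify c)) →₀ ℕ) ×
      ((Fin (Module.finrank ℂ (hC σ)) →₀ ℕ) × (Fin (Module.finrank ℂ q) →₀ ℕ)) →
      Sc c ⊗[ℂ] BalancedTensor σ c T := fun a => monomialU bc a.1 ⊗ₜ[ℂ]
        (balanceRelations σ c T).mkQ (monomialU bh a.2.1 ⊗ₜ[ℂ] monomialU vq a.2.2)
  refine ⟨_, w, ?_, ?_⟩
  · have hmq : Submodule.span ℂ (Set.range (Sum.elim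
        (fun i => (⟨bm i, mC_le_hC σ c (bm i).2⟩ : hC σ)) vq)) = ⊤ := by
      rw [Set.Sum.elim_range, Submodule.span_union, eq_top_iff, ← hq.sup_eq_top]
      refine sup_le_sup ?_ ?_
      · intro x hx
        have h1 : (⟨x, hx⟩ : mC σ c) ∈ Submodule.span ℂ (Set.range bm) := by
          rw [bm.span_eq]; trivial
        have h2 := Submodule.mem_map_of_mem
          (f := Submodule.inclusion (p := (mC σ c).toSubmodule) (p' := (hC σ).toSubmodule)
            (mC_le_hC σ c)) h1
        rw [Submodule.map_span, ← Set.range_comp] at h2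
        exact h2
      · intro x hx
        have h1 : (⟨x, hx⟩ : q) ∈ Submodule.span ℂ (Set.range bq) := by
          rw [bq.span_eq]; trivial
        have h2 := Submodule.mem_map_of_mem (f := q.subtype) h1
        rw [Submodule.map_span, ← Set.range_comp] at h2
        exact h2
    have h1 := span_balanced (T := T) (fun v hv => h.homC_twist_mem_mC hφ hv) bh bm vq bh.span_eq hmq
    have h2 := span_monomialU bc bc.span_eq
    have h3 := Submodule.map₂_span_span ℂ (TensorProduct.mk ℂ (Sc c) (BalancedTensor σ c T))
      (Set.range (monomialU bc))
      (Set.range fun a : (Fin (Module.finrank ℂ (hC σ)) →₀ ℕ) × (Fin (Module.finrank ℂ q) →₀ ℕ) =>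
        (balanceRelations σ c T).mkQ (monomialU bh a.1 ⊗ₜ[ℂ] monomialU vq a.2))
    rw [h1, h2, TensorProduct.map₂_mk_top_top_eq_top, Set.image2_range] at h3
    exact h3.symm
  · intro E X hE' hE
    let F : (Fin (Module.finrank ℂ (hC σ)) ⊕ Fin (Module.finrank ℂ (complexify c))) ⊕
        Fin (Module.finrank ℂ q) → Cx L :=
      Sum.elim (Sum.elim (fun i => (bh i : Cx L)) fun i => (bc i : Cx L)) fun i => homC E (vq i)
    have hhc : Disjoint (hC σ).toSubmodule (complexify c).toSubmodule := by
      rw [Submodule.disjoint_def]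
      intro x hx hx'
      have h1 := (mem_hC_iff h.involutive x).mp hx
      rw [h.homC_sigma_of_mem hx'] at h1
      rw [neg_eq_iff_add_eq_zero, ← two_smul ℂ x] at h1
      exact (smul_eq_zero.mp h1).resolve_left two_ne_zero
    have hF : LinearIndependent ℂ F := by
      have i1 : LinearIndependent ℂ fun i => (bh i : Cx L) :=
        bh.linearIndependent.map' (hC σ).toSubmodule.subtype (Submodule.ker_subtype _)
      have i2 : LinearIndependent ℂ fun i => (bc i : Cx L) :=
        bc.linearIndependent.map' (complexify c).toSubmodule.subtype (Submodule.ker_subtype _)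
      have s1 : Submodule.span ℂ (Set.range fun i => (bh i : Cx L)) = (hC σ).toSubmodule := by
        have h1 := congrArg (Submodule.map (hC σ).toSubmodule.subtype) bh.span_eq
        rw [Submodule.map_span, ← Set.range_comp, Submodule.map_top, Submodule.range_subtype] at h1
        exact h1
      have s2 : Submodule.span ℂ (Set.range fun i => (bc i : Cx L)) =
          (complexify c).toSubmodule := by
        have h1 := congrArg (Submodule.map (complexify c).toSubmodule.subtype) bc.span_eq
        rw [Submodule.map_span, ← Set.range_comp, Submodule.map_top, Submodule.range_subtype] at h1
        exact h1
      have i12 : LinearIndependent ℂ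
          (Sum.elim (fun i => (bh i : Cx L)) fun i => (bc i : Cx L)) :=
        i1.sum_type i2 (by rw [s1, s2]; exact hhc)
      -- `Ad(x) 𝔮` meets `𝔥_ℂ ⊕ 𝔠_ℂ` trivially
      let EQ : q →ₗ[ℂ] Cx L := (homC E : Cx L →ₗ[ℂ] Cx L) ∘ₗ (hC σ).toSubmodule.subtype ∘ₗ q.subtype
      have key : ∀ x : q, EQ x ∈ (hC σ).toSubmodule ⊔ (complexify c).toSubmodule → x = 0 := by
        intro x hx
        obtain ⟨u, hu, Z, hZ', huZ⟩ := Submodule.mem_sup.mp hx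
        have h1 := h.mem_mC_of_point_mem hφ hE' (x : hC σ).2 hu hZ' huZ.symm
        have h2 := (Submodule.disjoint_def.mp hq.disjoint) (x : hC σ) h1 x.2
        exact Subtype.ext h2
      have i3 : LinearIndependent ℂ (fun i => homC E (vq i)) := by
        refine bq.linearIndependent.map' EQ (LinearMap.ker_eq_bot'.mpr fun x hx => key x ?_)
        rw [hx]; exact zero_mem _
      refine i12.sum_type i3 ?_
      rw [Set.Sum.elim_range, Submodule.span_union, s1, s2, Submodule.disjoint_def]
      intro x hx hx'
      have h1 : x ∈ LinearMap.range EQ := by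
        have h2 : Submodule.span ℂ (Set.range fun i => homC E (vq i)) ≤ LinearMap.range EQ := by
          rw [Submodule.span_le]
          rintro _ ⟨i, rfl⟩
          exact ⟨bq i, rfl⟩
        exact h2 hx'
      obtain ⟨y, rfl⟩ := h1
      rw [key y hx, map_zero]
    have hmon := linearIndependent_monomials (k := ℂ) (g := Cx L) hZ F hF
      (sumList (sumList monomialList monomialList) monomialList)
      (coe_sumList (coe_sumList coe_monomialList coe_monomialList) coe_monomialList)
    -- `w` lists the exponents in the order `𝔠`, `𝔥`, `𝔮`, while evaluation multiplies in the order
    -- `𝔥`, `𝔠`, `Ad(x) 𝔮`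
    let e : (Fin (Module.finrank ℂ (complexify c)) →₀ ℕ) ×
        ((Fin (Module.finrank ℂ (hC σ)) →₀ ℕ) × (Fin (Module.finrank ℂ q) →₀ ℕ)) →
        ((Fin (Module.finrank ℂ (hC σ)) ⊕ Fin (Module.finrank ℂ (complexify c))) ⊕
        Fin (Module.finrank ℂ q) →₀ ℕ) := fun a => Finsupp.sumFinsuppEquivProdFinsupp.symm
          (Finsupp.sumFinsuppEquivProdFinsupp.symm (a.2.1, a.1), a.2.2)
    have he : Function.Injective e := by
      rintro ⟨a, b, d⟩ ⟨a', b', d'⟩ hab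
      have h1 := Finsupp.sumFinsuppEquivProdFinsupp.symm.injective hab
      have h2 := Finsupp.sumFinsuppEquivProdFinsupp.symm.injective (congrArg Prod.fst h1)
      have h3 := congrArg Prod.snd h1
      simp only [Prod.mk.injEq] at h2 h3 ⊢
      exact ⟨h2.2, h2.1, h3⟩
    have hfun : (fun i => balancedEval hE (w i)) = (fun a => ((sumList (sumList monomialList
        monomialList) monomialList a).map fun i => UniversalEnvelopingAlgebra.ι ℂ (F i)).prod) ∘ e := ?_
    · rw [hfun]
      exact hmon.comp e he
    funext a
    change balancedEval hE (monomialU bc a.1 ⊗ₜ[ℂ]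
        (balanceRelations σ c T).mkQ (monomialU bh a.2.1 ⊗ₜ[ℂ] monomialU vq a.2.2)) = _
    rw [balancedEval_tmul, multiplyOut_tmul, AlgHom.id_apply, inclU_monomialU, inclU_monomialU,
      inclU_monomialU, mapU_monomialU]
    simp only [Function.comp_apply, e, sumList, Equiv.apply_symm_apply, List.map_append,
      List.prod_append, List.map_map]
    rfl

/-- An element of `R ⊗ S(𝔠) ⊗ (U(𝔥) ⊗_{U(𝔪)} U(𝔥))` that vanishes at all regular points is zero, if
the elements of `R` are determined by their values. -/
theorem eq_zero_of_eval_eq_zero (h : RadialData σ T B c) (hφ : TechnicalCondition σ B c T φ ε)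
    (hZ : ∀ X : Cx L, (∀ Y : Cx L, ⁅X, Y⁆ = 0) →
      X ∈ Submodule.span ℂ {Z | ∃ U V : Cx L, ⁅U, V⁆ = Z} → X = 0)
    {R : Type*} [CommRing R] [Algebra ℂ R] {P : Type*} (ev : P → R →ₐ[ℂ] ℂ)
    (hev : ∀ f : R, (∀ x, ev x f = 0) → f = 0) (E : P → L →ₗ⁅ℝ⁆ L) (X : P → c)
    (hreg : ∀ x, IsRegularPoint σ T c (E x) (X x))
    (hE : ∀ x, ∀ v ∈ mC σ c, homC (E x) v = homC T v) (F : Radial R σ c T)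
    (hF : ∀ x, radialEval (hE x) (ev x) F = 0) : F = 0 := by
  classical
  rcases isEmpty_or_nonempty P with hP | ⟨⟨x₀⟩⟩
  · have : Subsingleton R := ⟨fun f g => sub_eq_zero.mp (hev _ fun x => isEmptyElim x)⟩
    have h1 : ∀ F : Radial R σ c T, F = 0 := by
      intro F
      induction F using TensorProduct.induction_on with
      | zero => rfl
      | tmul f w => rw [Subsingleton.elim f 0, TensorProduct.zero_tmul]
      | add x y hx hy => rw [hx, hy, add_zero]
    exact h1 F
  -- expand `F` in a basis of `S(𝔠) ⊗ (U(𝔥) ⊗_{U(𝔪)} U(𝔥))`, with coefficients in `R`; at every point the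
  -- values of the coefficients vanish
  obtain ⟨κ, w, hspan, hind⟩ := exists_spanning_family h hφ hZ
  have hw : LinearIndependent ℂ w :=
    LinearIndependent.of_comp (balancedEval (hE x₀)) (hind _ _ (hreg x₀) (hE x₀))
  let b : Module.Basis κ ℂ (Sc c ⊗[ℂ] BalancedTensor σ c T) := Module.Basis.mk hw hspan.ge
  have hb : ∀ i, b i = w i := fun i => Module.Basis.mk_apply hw hspan.ge i
  obtain ⟨f, rfl⟩ := (TensorProduct.equivFinsuppOfBasisRight b).symm.surjective F
  suffices hf : f = 0 by rw [hf, map_zero]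
  ext i
  refine hev _ fun x => ?_
  have h1 := hF x
  rw [TensorProduct.equivFinsuppOfBasisRight_symm_apply, Finsupp.sum, map_sum] at h1
  simp only [radialEval, LinearMap.comp_apply, LinearEquiv.coe_coe, TensorProduct.map_tmul,
    TensorProduct.lid_tmul, hb] at h1
  have h2 := linearIndependent_iff'.mp (hind _ _ (hreg x) (hE x)) f.support
    (fun i => ev x (f i)) h1
  by_cases hi : i ∈ f.support
  · exact h2 i hi
  · rw [Finsupp.notMem_support_iff.mp hi, map_zero]

end Uniqueness

end

end CasimirRadial

namespace CasimirRadial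

noncomputable section

attribute [local instance 100] LieRing.ofAssociativeRing

/-! ### Canonical tensors and contractions -/

section Contraction

variable {V : Type*} [AddCommGroup V] [Module ℂ V]

/-- The contraction `a ⊗ b ↦ β(a, w) b`. -/
def contract (β : LinearMap.BilinForm ℂ V) (w : V) : V ⊗[ℂ] V →ₗ[ℂ] V :=
  (TensorProduct.lid ℂ V).toLinearMap ∘ₗ LinearMap.rTensor V (β.flip w)

@[simp] theorem contract_tmul (β : LinearMap.BilinForm ℂ V) (w a b : V) :
    contract β w (a ⊗ₜ[ℂ] b) = β a w • b := by
  simp [contract]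

/-- The contraction with a tensor in `p ⊗ V` vanishes on the orthogonal complement of `p`. -/
theorem contract_map_eq_zero (β : LinearMap.BilinForm ℂ V) {p : Submodule ℂ V} {W : Type*}
    [AddCommGroup W] [Module ℂ W] (f : W →ₗ[ℂ] V) {w : V} (hw : ∀ a ∈ p, β a w = 0)
    (x : p ⊗[ℂ] W) : contract β w (TensorProduct.map p.subtype f x) = 0 := by
  induction x using TensorProduct.induction_on with
  | zero => simp
  | tmul a b => rw [TensorProduct.map_tmul, contract_tmul, Submodule.subtype_apply, hw a a.2, zero_smul]
  | add x y hx hy => rw [map_add, map_add, hx, hy, add_zero]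

variable [Module.Finite ℂ V]

theorem contract_injective {β : LinearMap.BilinForm ℂ V} (hs : β.IsSymm) (hn : β.Nondegenerate)
    {x y : V ⊗[ℂ] V} (hxy : ∀ w, contract β w x = contract β w y) : x = y := by
  obtain ⟨e, he⟩ := exists_orthonormal_basis β hs hn
  rw [← sub_eq_zero]
  obtain ⟨f, hf⟩ := (TensorProduct.equivFinsuppOfBasisLeft (N := V) e).symm.surjective (x - y)
  have h1 : ∀ w, contract β w (x - y) = 0 := fun w => by rw [map_sub, hxy, sub_self]
  suffices h0 : f = 0 by rw [← hf, h0, map_zero]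
  ext j
  have h2 := h1 (e j)
  rw [← hf, TensorProduct.equivFinsuppOfBasisLeft_symm_apply, Finsupp.sum, map_sum] at h2
  simp only [contract_tmul, he, ite_smul, one_smul, zero_smul, Finset.sum_ite_eq'] at h2
  by_cases hj : j ∈ f.support
  · rw [if_pos hj] at h2; exact h2
  · exact Finsupp.notMem_support_iff.mp hj

theorem contract_canonicalTensor {β : LinearMap.BilinForm ℂ V} (hs : β.IsSymm)
    (hn : β.Nondegenerate) (w : V) : contract β w (canonicalTensor β) = w := by
  obtain ⟨e, he⟩ := exists_orthonormal_basis β hs hn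
  rw [canonicalTensor_eq_sum β e he, map_sum]
  conv_rhs => rw [← e.sum_repr w]
  refine Finset.sum_congr rfl fun i _ => ?_
  have h1 : β (e i) = e.coord i := e.ext fun j => by
    rw [he, Module.Basis.coord_apply, Module.Basis.repr_self, Finsupp.single_apply]
    exact if_congr eq_comm rfl rfl
  rw [contract_tmul, h1, Module.Basis.coord_apply]

/-- The contraction with the canonical tensor of a subspace `p` is the identity on `p`. -/
theorem contract_map_canonicalTensor {β : LinearMap.BilinForm ℂ V} (hs : β.IsSymm)
    {p : Submodule ℂ V} (hn : (β.restrict p).Nondegenerate) {w : V} (hw : w ∈ p) :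
    contract β w (TensorProduct.map p.subtype p.subtype (canonicalTensor (β.restrict p))) = w := by
  have h1 := contract_canonicalTensor (hs.restrict p) hn ⟨w, hw⟩
  have h2 : ∀ x : p ⊗[ℂ] p, contract β w (TensorProduct.map p.subtype p.subtype x) =
      (contract (β.restrict p) ⟨w, hw⟩ x : V) := by
    intro x
    induction x using TensorProduct.induction_on with
    | zero => simp
    | tmul a b => rw [TensorProduct.map_tmul, contract_tmul, contract_tmul]; rfl
    | add x y hx hy => rw [map_add, map_add, map_add, hx, hy]; rfl
  rw [h2, h1]

end Contraction

/-! ### The Casimir element in terms of root vectors -/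

section CasimirDecomposition

variable {L : Type*} [LieRing L] [LieAlgebra ℝ L]
  {σ T : L →ₗ⁅ℝ⁆ L} {B : LinearMap.BilinForm ℝ L} {c : LieSubalgebra ℝ L}
  {φ : Cx L →ₗ[ℂ] Cx L} {ε : (c →ₗ[ℝ] ℂ) → ℂˣ} {E : L →ₗ⁅ℝ⁆ L} {X : c}

namespace RadialData

theorem formC_sigma (h : RadialData σ T B c) (x y : Cx L) :
    formC B (homC σ x) y = formC B x (homC σ y) := by
  rw [← formC_homC h.sigma_form, homC_involutive h.involutive]

theorem formSigma_apply (x y : Cx L) : formSigma B σ x y = -formC B x (homC σ y) := rfl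

theorem formSigma_restrict_isSymm (h : RadialData σ T B c) (α : c →ₗ[ℝ] ℂ) :
    ((formSigma B σ).restrict (rootSpace c α)).IsSymm := ⟨fun x y => by
  change formSigma B σ x y = formSigma B σ y x
  rw [formSigma_apply, formSigma_apply, ← h.formC_sigma, formC_symm h.symm]⟩

theorem formSigma_restrict_nondegenerate (h : RadialData σ T B c) (α : c →ₗ[ℝ] ℂ) :
    ((formSigma B σ).restrict (rootSpace c α)).Nondegenerate := by
  have key : ∀ x : rootSpace c α, (∀ y : rootSpace c α, formSigma B σ x y = 0) → x = 0 := by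
    intro x hx
    by_contra h0
    obtain ⟨w, hw, hxw⟩ := h.exists_formC_ne_zero x.2 (fun h1 => h0 (Subtype.ext h1))
    have h1 := h.homC_sigma_mem hw
    rw [neg_neg] at h1
    have h2 := hx ⟨_, h1⟩
    rw [formSigma_apply, homC_involutive h.involutive, neg_eq_zero] at h2
    exact hxw h2
  exact ⟨key, fun y hy => key y fun x => ((h.formSigma_restrict_isSymm α).eq y x).trans (hy x)⟩

theorem formC_mC_complexify (h : RadialData σ T B c) {v Z : Cx L} (hv : v ∈ mC σ c)
    (hZ : Z ∈ complexify c) : formC B v Z = 0 := by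
  have h1 := h.formC_sigma v Z
  rw [((h.mem_mC_iff).mp hv).1, h.homC_sigma_of_mem hZ, map_neg, eq_neg_iff_add_eq_zero,
    ← two_mul] at h1
  exact (mul_eq_zero.mp h1).resolve_left two_ne_zero

theorem half_add_mem_mC (h : RadialData σ T B c) {w : Cx L} (hw : w ∈ rootSpace c 0) :
    (1 / 2 : ℂ) • (w + homC σ w) ∈ mC σ c := by
  rw [h.mem_mC_iff]
  have h1 := h.homC_sigma_mem hw
  rw [neg_zero] at h1
  exact ⟨by rw [map_smul, map_add, homC_involutive h.involutive, add_comm],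
    Submodule.smul_mem _ _ (add_mem hw h1)⟩

theorem half_sub_mem_complexify (h : RadialData σ T B c)
    (hc : ∀ Y, σ Y = -Y → (∀ Z ∈ c, ⁅Z, Y⁆ = 0) → Y ∈ c) {w : Cx L} (hw : w ∈ rootSpace c 0) :
    (1 / 2 : ℂ) • (w - homC σ w) ∈ complexify c := by
  have h1 := h.homC_sigma_mem hw
  rw [neg_zero] at h1
  refine mem_complexify_of_anti hc ?_ (Submodule.smul_mem _ _ (sub_mem hw h1))
  rw [map_smul, map_sub, homC_involutive h.involutive, ← smul_neg, neg_sub]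

theorem half_add_half_sub (w w' : Cx L) :
    (1 / 2 : ℂ) • (w + w') + (1 / 2 : ℂ) • (w - w') = w := by
  module

theorem restrict_mC_nondegenerate (h : RadialData σ T B c)
    (hc : ∀ Y, σ Y = -Y → (∀ Z ∈ c, ⁅Z, Y⁆ = 0) → Y ∈ c) :
    ((formC B).restrict (mC σ c).toSubmodule).Nondegenerate := by
  have key : ∀ x ∈ mC σ c, (∀ y ∈ mC σ c, formC B x y = 0) → x = 0 := by
    intro x hx hxy
    by_contra h0
    obtain ⟨w, hw, hxw⟩ := h.exists_formC_ne_zero ((h.mem_mC_iff).mp hx).2 h0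
    rw [neg_zero] at hw
    refine hxw ?_
    rw [← half_add_half_sub w (homC σ w), map_add, hxy _ (h.half_add_mem_mC hw),
      h.formC_mC_complexify hx (h.half_sub_mem_complexify hc hw), add_zero]
  refine ⟨fun x hx => Subtype.ext (key x x.2 fun y hy => hx ⟨y, hy⟩),
    fun y hy => Subtype.ext (key y y.2 fun x hx => ?_)⟩
  rw [formC_symm h.symm]
  exact hy ⟨x, hx⟩

theorem eq_zero_of_orthogonal_complexify (h : RadialData σ T B c)
    (hc : ∀ Y, σ Y = -Y → (∀ Z ∈ c, ⁅Z, Y⁆ = 0) → Y ∈ c) {x : Cx L} (hx : x ∈ complexify c)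
    (hxy : ∀ y ∈ complexify c, formC B x y = 0) : x = 0 := by
  by_contra h0
  obtain ⟨w, hw, hxw⟩ := h.exists_formC_ne_zero (h.complexify_le_rootSpace hx) h0
  rw [neg_zero] at hw
  refine hxw ?_
  rw [← half_add_half_sub w (homC σ w), map_add, hxy _ (h.half_sub_mem_complexify hc hw),
    formC_symm h.symm, h.formC_mC_complexify (h.half_add_mem_mC hw) hx, add_zero]

theorem restrict_complexify_nondegenerate (h : RadialData σ T B c)
    (hc : ∀ Y, σ Y = -Y → (∀ Z ∈ c, ⁅Z, Y⁆ = 0) → Y ∈ c) :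
    ((formC B).restrict (complexify c).toSubmodule).Nondegenerate := by
  refine ⟨fun x hx => Subtype.ext (h.eq_zero_of_orthogonal_complexify hc x.2
    fun y hy => hx ⟨y, hy⟩), fun y hy => Subtype.ext (h.eq_zero_of_orthogonal_complexify hc y.2
    fun x hx => ?_)⟩
  rw [formC_symm h.symm]
  exact hy ⟨x, hx⟩

/-- `[v, σ v]` is centralised by `𝔠` and anti-invariant under `σ`. -/
theorem lie_sigma_mem (h : RadialData σ T B c)
    (hc : ∀ Y, σ Y = -Y → (∀ Z ∈ c, ⁅Z, Y⁆ = 0) → Y ∈ c) {α : c →ₗ[ℝ] ℂ} {v : Cx L}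
    (hv : v ∈ rootSpace c α) : ⁅v, homC σ v⁆ ∈ complexify c := by
  refine mem_complexify_of_anti hc ?_ ?_
  · rw [LieHom.map_lie, homC_involutive h.involutive, lie_skew]
  · rw [mem_rootSpace_iff]
    intro Z
    have h1 := leibniz_lie ((1 : ℂ) ⊗ₜ[ℝ] (Z : L) : Cx L) v (homC σ v)
    refine h1.trans ?_
    have h2 := mem_rootSpace_iff.mp hv Z
    have h3 := mem_rootSpace_iff.mp (h.homC_sigma_mem hv) Z
    have e1 : ⁅⁅(1 : ℂ) ⊗ₜ[ℝ] (Z : L), v⁆, homC σ v⁆ = α Z • (⁅v, homC σ v⁆ : Cx L) := by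
      rw [h2, cx_smul_lie]
    have e2 : ⁅v, ⁅(1 : ℂ) ⊗ₜ[ℝ] (Z : L), homC σ v⁆⁆ = -(α Z • (⁅v, homC σ v⁆ : Cx L)) := by
      rw [h3, cx_lie_smul, LinearMap.neg_apply, neg_smul]
    refine (congrArg₂ (· + ·) e1 e2).trans ?_
    rw [add_neg_cancel, LinearMap.zero_apply, zero_smul]

theorem formC_lie_sigma (h : RadialData σ T B c) {α : c →ₗ[ℝ] ℂ} {v : Cx L}
    (hv : v ∈ rootSpace c α) (Z : c) : formC B ⁅v, homC σ v⁆ ((1 : ℂ) ⊗ₜ[ℝ] (Z : L)) =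
      -(α Z * formSigma B σ v v) := by
  rw [formC_bracket h.bracket, ← lie_skew, mem_rootSpace_iff.mp hv Z, map_neg, map_smul,
    formC_symm h.symm, formSigma_apply, smul_eq_mul]
  ring

theorem eq_of_formC_eq (h : RadialData σ T B c)
    (hc : ∀ Y, σ Y = -Y → (∀ Z ∈ c, ⁅Z, Y⁆ = 0) → Y ∈ c) {x y : Cx L} (hx : x ∈ complexify c)
    (hy : y ∈ complexify c)
    (hxy : ∀ Z : c, formC B x ((1 : ℂ) ⊗ₜ[ℝ] (Z : L)) = formC B y ((1 : ℂ) ⊗ₜ[ℝ] (Z : L))) :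
    x = y := by
  rw [← sub_eq_zero]
  refine h.eq_zero_of_orthogonal_complexify hc (sub_mem hx hy) fun w hw => ?_
  rw [mem_complexify_iff] at hw
  have key : ∀ Z ∈ c, formC B (x - y) ((1 : ℂ) ⊗ₜ[ℝ] Z) = 0 := fun Z hZ => by
    rw [map_sub, LinearMap.sub_apply, hxy ⟨Z, hZ⟩, sub_self]
  rw [eq_reCx_add_imCx w, map_add, map_smul, key _ hw.1, key _ hw.2, smul_zero, add_zero]

theorem neg_mem_roots (h : RadialData σ T B c) {α : c →ₗ[ℝ] ℂ} (hα : α ∈ roots c) :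
    -α ∈ roots c := ⟨neg_ne_zero.mpr hα.1, h.rootSpace_neg_ne_bot hα.2⟩

variable [Module.Finite ℝ L]

/-- The part of the canonical tensor of `B` in `𝔤_α ⊗ 𝔤_{-α}`. -/
def rootTensor (σ : L →ₗ⁅ℝ⁆ L) (B : LinearMap.BilinForm ℝ L) (α : c →ₗ[ℝ] ℂ) : Cx L ⊗[ℂ] Cx L :=
  -TensorProduct.map (rootSpace c α).subtype
    ((homC σ : Cx L →ₗ[ℂ] Cx L) ∘ₗ (rootSpace c α).subtype)
    (canonicalTensor ((formSigma B σ).restrict (rootSpace c α)))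

/-- `B(𝔤_α, 𝔤_β) = 0` unless `α + β = 0`. -/
theorem contract_rootTensor_of_ne (h : RadialData σ T B c) {α β : c →ₗ[ℝ] ℂ} (hαβ : α + β ≠ 0)
    {w : Cx L} (hw : w ∈ rootSpace c β) : contract (formC B) w (rootTensor σ B α) = 0 := by
  rw [rootTensor, map_neg, contract_map_eq_zero (formC B) _ (fun a ha => h.formC_eq_zero hαβ ha hw),
    neg_zero]

theorem contract_rootTensor (h : RadialData σ T B c) {α : c →ₗ[ℝ] ℂ} {w : Cx L}
    (hw : w ∈ rootSpace c (-α)) : contract (formC B) w (rootTensor σ B α) = w := by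
  have hw' := h.homC_sigma_mem hw
  rw [neg_neg] at hw'
  have h1 := contract_canonicalTensor (h.formSigma_restrict_isSymm α)
    (h.formSigma_restrict_nondegenerate α) ⟨_, hw'⟩
  have h2 : ∀ x : rootSpace c α ⊗[ℂ] rootSpace c α, -contract (formC B) w (TensorProduct.map
      (rootSpace c α).subtype ((homC σ : Cx L →ₗ[ℂ] Cx L) ∘ₗ (rootSpace c α).subtype) x) =
      homC σ (contract ((formSigma B σ).restrict (rootSpace c α)) ⟨_, hw'⟩ x : Cx L) := by
    intro x
    induction x using TensorProduct.induction_on with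
    | zero => simp
    | tmul a b =>
      rw [TensorProduct.map_tmul, contract_tmul, contract_tmul]
      change -(formC B (a : Cx L) w • homC σ (b : Cx L)) =
        homC σ (formSigma B σ (a : Cx L) (homC σ w) • (b : Cx L))
      rw [formSigma_apply, homC_involutive h.involutive, map_smul, neg_smul]
    | add x y hx hy =>
      rw [map_add, map_add, neg_add, hx, hy, map_add, Submodule.coe_add, map_add]
  rw [rootTensor, map_neg, h2, h1, homC_involutive h.involutive]

/-- The decomposition of the canonical tensor of `B` along `𝔤_ℂ = 𝔠_ℂ ⊕ 𝔪_ℂ ⊕ ⨁ 𝔤_α`. -/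
theorem canonicalTensor_eq (h : RadialData σ T B c)
    (hc : ∀ Y, σ Y = -Y → (∀ Z ∈ c, ⁅Z, Y⁆ = 0) → Y ∈ c) :
    canonicalTensor (formC B) =
      TensorProduct.map (complexify c).toSubmodule.subtype (complexify c).toSubmodule.subtype
        (canonicalTensor ((formC B).restrict (complexify c).toSubmodule)) +
      TensorProduct.map (mC σ c).toSubmodule.subtype (mC σ c).toSubmodule.subtype
        (canonicalTensor ((formC B).restrict (mC σ c).toSubmodule)) +
      ∑ α ∈ (finite_roots c h.comm).toFinset, rootTensor σ B α := by
  have hs : (formC B).IsSymm := ⟨formC_symm h.symm⟩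
  have hn := formC_nondegenerate h.symm h.nondegenerate
  -- both sides are determined by their contractions with the elements `w` of the root spaces
  refine contract_injective hs hn fun w => ?_
  rw [contract_canonicalTensor hs hn]
  have hw : w ∈ ⨆ β, rootSpace c β := by rw [h.iSup_rootSpace]; trivial
  have hadd : ∀ x y : Cx L, ∀ t : Cx L ⊗[ℂ] Cx L,
      contract (formC B) (x + y) t = contract (formC B) x t + contract (formC B) y t := by
    intro x y t
    induction t using TensorProduct.induction_on with
    | zero => simp
    | tmul a b => rw [contract_tmul, contract_tmul, contract_tmul, map_add, add_smul]
    | add s t hs ht => rw [map_add, map_add, map_add, hs, ht, add_add_add_comm]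
  induction hw using Submodule.iSup_induction' with
  | mem β w hw =>
    rw [map_add, map_add, map_sum]
    by_cases hβ : β = 0
    · subst hβ
      rw [Finset.sum_eq_zero (fun α hα => h.contract_rootTensor_of_ne (by
        rw [add_zero]; exact ((Set.Finite.mem_toFinset _).mp hα).1) hw), add_zero]
      have hcw := h.half_sub_mem_complexify hc hw
      have hmw := h.half_add_mem_mC hw
      have e1 := contract_map_canonicalTensor hs (h.restrict_complexify_nondegenerate hc) hcw
      have e2 := contract_map_canonicalTensor hs (h.restrict_mC_nondegenerate hc) hmw
      have e3 := contract_map_eq_zero (formC B) (p := (complexify c).toSubmodule)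
        (complexify c).toSubmodule.subtype
        (fun a ha => (formC_symm h.symm a _).trans (h.formC_mC_complexify hmw ha))
        (canonicalTensor ((formC B).restrict (complexify c).toSubmodule))
      have e4 := contract_map_eq_zero (formC B) (p := (mC σ c).toSubmodule)
        (mC σ c).toSubmodule.subtype (fun a ha => h.formC_mC_complexify ha hcw)
        (canonicalTensor ((formC B).restrict (mC σ c).toSubmodule))
      conv_rhs => rw [← half_add_half_sub w (homC σ w)]
      rw [hadd, hadd, e1, e2, e3, e4, add_zero, zero_add, add_comm, half_add_half_sub]
    · have e3 := contract_map_eq_zero (formC B) (p := (complexify c).toSubmodule)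
        (complexify c).toSubmodule.subtype
        (fun a ha => h.formC_eq_zero (by rwa [zero_add]) (h.complexify_le_rootSpace ha) hw)
        (canonicalTensor ((formC B).restrict (complexify c).toSubmodule))
      have e4 := contract_map_eq_zero (formC B) (p := (mC σ c).toSubmodule)
        (mC σ c).toSubmodule.subtype
        (fun a ha => h.formC_eq_zero (by rwa [zero_add]) ((h.mem_mC_iff).mp ha).2 hw)
        (canonicalTensor ((formC B).restrict (mC σ c).toSubmodule))
      rw [e3, e4, zero_add, zero_add]
      by_cases hw0 : w = 0
      · rw [hw0]
        refine (Finset.sum_eq_zero fun α _ => ?_).symm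
        have h2 := hadd 0 0 (rootTensor σ B α)
        rw [add_zero] at h2
        exact left_eq_add.mp h2
      have hbot : rootSpace c β ≠ ⊥ := fun h1 => hw0 (by rwa [h1, Submodule.mem_bot] at hw)
      have hβ' : -β ∈ (finite_roots c h.comm).toFinset :=
        (Set.Finite.mem_toFinset _).mpr ⟨neg_ne_zero.mpr hβ, h.rootSpace_neg_ne_bot hbot⟩
      rw [Finset.sum_eq_single_of_mem _ hβ' fun α _ hα => h.contract_rootTensor_of_ne
        (fun h0 => hα (eq_neg_of_add_eq_zero_left h0)) hw]
      exact (h.contract_rootTensor (by rwa [neg_neg])).symm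
  | zero =>
    have h2 := hadd 0 0 (TensorProduct.map (complexify c).toSubmodule.subtype
        (complexify c).toSubmodule.subtype
        (canonicalTensor ((formC B).restrict (complexify c).toSubmodule)) +
      TensorProduct.map (mC σ c).toSubmodule.subtype (mC σ c).toSubmodule.subtype
        (canonicalTensor ((formC B).restrict (mC σ c).toSubmodule)) +
      ∑ α ∈ (finite_roots c h.comm).toFinset, rootTensor σ B α)
    rw [add_zero] at h2
    exact (left_eq_add.mp h2).symm
  | add x y _ _ hx hy => rw [hadd, ← hx, ← hy]

theorem formC_coroot (h : RadialData σ T B c)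
    (hc : ∀ Y, σ Y = -Y → (∀ Z ∈ c, ⁅Z, Y⁆ = 0) → Y ∈ c) {α : c →ₗ[ℝ] ℂ} (hα : α ∈ roots c)
    (Z : c) : formC B (coroot B c α : Cx L) ((1 : ℂ) ⊗ₜ[ℝ] (Z : L)) = α Z := by
  have hex : ∃ C : complexify c, ∀ Y : c, formC B (C : Cx L) ((1 : ℂ) ⊗ₜ[ℝ] (Y : L)) = α Y := by
    obtain ⟨e, he⟩ := exists_orthonormal_basis _ (h.formSigma_restrict_isSymm α)
      (h.formSigma_restrict_nondegenerate α)
    have hpos : 0 < Module.finrank ℂ (rootSpace c α) :=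
      Module.finrank_pos_iff.mpr ((Submodule.nontrivial_iff_ne_bot).mpr hα.2)
    refine ⟨-⟨_, h.lie_sigma_mem hc (e ⟨0, hpos⟩).2⟩, fun Y => ?_⟩
    change formC B (-⁅(e ⟨0, hpos⟩ : Cx L), homC σ (e ⟨0, hpos⟩ : Cx L)⁆) _ = _
    rw [map_neg, LinearMap.neg_apply, h.formC_lie_sigma (e ⟨0, hpos⟩).2, neg_neg,
      show formSigma B σ (e ⟨0, hpos⟩ : Cx L) (e ⟨0, hpos⟩ : Cx L) = 1 from
        (he _ _).trans (if_pos rfl), mul_one]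
  rw [coroot, dif_pos hex]
  exact hex.choose_spec Z

theorem coroot_neg (h : RadialData σ T B c)
    (hc : ∀ Y, σ Y = -Y → (∀ Z ∈ c, ⁅Z, Y⁆ = 0) → Y ∈ c) {α : c →ₗ[ℝ] ℂ} (hα : α ∈ roots c) :
    (coroot B c (-α) : Cx L) = -(coroot B c α : Cx L) := by
  refine h.eq_of_formC_eq hc (coroot B c (-α)).2 (neg_mem (coroot B c α).2) fun Z => ?_
  rw [h.formC_coroot hc (h.neg_mem_roots hα), map_neg, LinearMap.neg_apply, LinearMap.neg_apply,
    h.formC_coroot hc hα]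

theorem finrank_rootSpace_neg_le (h : RadialData σ T B c) (α : c →ₗ[ℝ] ℂ) :
    Module.finrank ℂ (rootSpace c α) ≤ Module.finrank ℂ (rootSpace c (-α)) := by
  refine LinearMap.finrank_le_finrank_of_injective
    (f := (homC σ : Cx L →ₗ[ℂ] Cx L).restrict (p := rootSpace c α) (q := rootSpace c (-α))
      fun x hx => h.homC_sigma_mem hx) fun x y hxy => Subtype.ext ?_
  have h1 : homC σ (x : Cx L) = homC σ (y : Cx L) := congrArg Subtype.val hxy
  rw [← homC_involutive h.involutive (x : Cx L), h1, homC_involutive h.involutive]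

theorem finrank_rootSpace_neg (h : RadialData σ T B c) (α : c →ₗ[ℝ] ℂ) :
    Module.finrank ℂ (rootSpace c (-α)) = Module.finrank ℂ (rootSpace c α) := by
  refine le_antisymm ?_ (h.finrank_rootSpace_neg_le α)
  have h1 := h.finrank_rootSpace_neg_le (-α)
  rwa [neg_neg] at h1

/-- `∑ n_α C_α = 0`, as the terms of `α` and `-α` cancel. -/
theorem sum_coroot (h : RadialData σ T B c)
    (hc : ∀ Y, σ Y = -Y → (∀ Z ∈ c, ⁅Z, Y⁆ = 0) → Y ∈ c) :
    ∑ α ∈ (finite_roots c h.comm).toFinset,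
      (Module.finrank ℂ (rootSpace c α) : ℂ) • (coroot B c α : Cx L) = 0 := by
  set S := ∑ α ∈ (finite_roots c h.comm).toFinset,
      (Module.finrank ℂ (rootSpace c α) : ℂ) • (coroot B c α : Cx L) with hS
  have h1 : S = -S := by
    conv_lhs => rw [hS]
    rw [hS, ← Finset.sum_neg_distrib]
    refine Finset.sum_nbij' (fun α => -α) (fun α => -α) ?_ ?_ (fun _ _ => neg_neg _)
      (fun _ _ => neg_neg _) fun α hα => ?_
    · intro α hα
      exact (Set.Finite.mem_toFinset _).mpr (h.neg_mem_roots ((Set.Finite.mem_toFinset _).mp hα))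
    · intro α hα
      exact (Set.Finite.mem_toFinset _).mpr (h.neg_mem_roots ((Set.Finite.mem_toFinset _).mp hα))
    · rw [h.coroot_neg hc ((Set.Finite.mem_toFinset _).mp hα), h.finrank_rootSpace_neg, smul_neg,
        neg_neg]
  rw [eq_neg_iff_add_eq_zero, ← two_smul ℂ] at h1
  exact (smul_eq_zero.mp h1).resolve_left two_ne_zero

/-- `∑ [Xᵢ, σ Xᵢ] = -n_α C_α` for an orthonormal basis of `𝔤_α`. -/
theorem sum_lie_sigma (h : RadialData σ T B c)
    (hc : ∀ Y, σ Y = -Y → (∀ Z ∈ c, ⁅Z, Y⁆ = 0) → Y ∈ c) {α : c →ₗ[ℝ] ℂ} (hα : α ∈ roots c)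
    {ι : Type*} [Fintype ι] (e : ι → rootSpace c α) (he : ∀ i, formSigma B σ (e i) (e i) = 1) :
    ∑ i, ⁅(e i : Cx L), homC σ (e i : Cx L)⁆ =
      -((Fintype.card ι : ℂ) • (coroot B c α : Cx L)) := by
  refine h.eq_of_formC_eq hc (sum_mem fun i _ => h.lie_sigma_mem hc (e i).2)
    (neg_mem ((complexify c).smul_mem _ (coroot B c α).2)) fun Z => ?_
  rw [map_sum, LinearMap.sum_apply, map_neg, LinearMap.neg_apply, map_smul, LinearMap.smul_apply,
    h.formC_coroot hc hα, Finset.sum_congr rfl fun i _ => h.formC_lie_sigma (e i).2 Z]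
  simp [he]

end RadialData

end CasimirDecomposition

end

end CasimirRadial

namespace CasimirRadial

noncomputable section

attribute [local instance 100] LieRing.ofAssociativeRing

/-! ### Evaluation of the formula at a regular point -/

section FormulaEvaluation

/-- The identity `-x s = a (Y² + Z²) + b Y Z + d [x, s]` for `Y = x + s`, `Z = y x + y' s`. -/
theorem neg_mul_eq {A : Type*} [Ring A] [Algebra ℂ A] (x s : A) {y y' a b d : ℂ} (hy : y * y' = 1)
    (h1 : a * (1 + y ^ 2) + b * y = 0) (h2 : a * (1 + y' ^ 2) + b * y' = 0)
    (h3 : 2 * a + b * y' + d = -1) (h4 : 2 * a + b * y - d = 0) :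
    -(x * s) = a • ((x + s) * (x + s) + (y • x + y' • s) * (y • x + y' • s)) +
      b • ((x + s) * (y • x + y' • s)) + d • (x * s - s * x) := by
  have e : a • ((x + s) * (x + s) + (y • x + y' • s) * (y • x + y' • s)) +
      b • ((x + s) * (y • x + y' • s)) + d • (x * s - s * x) =
      (a * (1 + y ^ 2) + b * y) • (x * x) + (a * (1 + y' ^ 2) + b * y') • (s * s) +
      (a * (1 + y * y') + b * y' + d) • (x * s) + (a * (1 + y * y') + b * y - d) • (s * x) := by
    simp only [mul_add, add_mul, smul_mul_assoc, mul_smul_comm]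
    module
  rw [e, h1, h2, hy, show a * (1 + 1) + b * y' + d = -1 by rw [← h3]; ring,
    show a * (1 + 1) + b * y - d = 0 by rw [← h4]; ring]
  simp

variable {L : Type*} [LieRing L] [LieAlgebra ℝ L]

/-- The image of `x ⊗ y` in `U(𝔤)`. -/
def mulU (L : Type*) [LieRing L] [LieAlgebra ℝ L] : Cx L ⊗[ℂ] Cx L →ₗ[ℂ] Ug L :=
  LinearMap.mul' ℂ (Ug L) ∘ₗ TensorProduct.map
    (UniversalEnvelopingAlgebra.ι ℂ : Cx L →ₗ⁅ℂ⁆ Ug L).toLinearMap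
    (UniversalEnvelopingAlgebra.ι ℂ : Cx L →ₗ⁅ℂ⁆ Ug L).toLinearMap

theorem mulU_tmul (x y : Cx L) : mulU L (x ⊗ₜ[ℂ] y) =
    UniversalEnvelopingAlgebra.ι ℂ x * UniversalEnvelopingAlgebra.ι ℂ y := rfl

theorem inclU_quadratic {S : LieSubalgebra ℂ (Cx L)} {p : Submodule ℂ (Cx L)}
    (f : p →ₗ[ℂ] UniversalEnvelopingAlgebra ℂ S)
    (hf : ∀ x : p, inclU S (f x) = UniversalEnvelopingAlgebra.ι ℂ (x : Cx L)) (t : p ⊗[ℂ] p) :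
    inclU S (LinearMap.mul' ℂ _ (TensorProduct.map f f t)) =
      mulU L (TensorProduct.map p.subtype p.subtype t) := by
  induction t using TensorProduct.induction_on with
  | zero => simp
  | tmul x y =>
    rw [TensorProduct.map_tmul, TensorProduct.map_tmul, LinearMap.mul'_apply, map_mul, hf, hf,
      mulU_tmul]
    rfl
  | add x y hx hy => simp only [map_add, hx, hy]

variable {σ T : L →ₗ⁅ℝ⁆ L} {B : LinearMap.BilinForm ℝ L} {c : LieSubalgebra ℝ L}
  {φ : Cx L →ₗ[ℂ] Cx L} {ε : (c →ₗ[ℝ] ℂ) → ℂˣ} {E : L →ₗ⁅ℝ⁆ L} {X : c}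

namespace RadialData

/-- `φ` maps an orthonormal basis of `𝔤_α` to an orthonormal basis of `𝔤_{tα}`. -/
def phiEquiv (h : RadialData σ T B c) (hφ : TechnicalCondition σ B c T φ ε) (α : c →ₗ[ℝ] ℂ) :
    rootSpace c α ≃ₗ[ℂ] rootSpace c (hφ.dualAction α) :=
  LinearEquiv.ofBijective
    (φ.restrict (p := rootSpace c α) (q := rootSpace c (hφ.dualAction α)) fun _ hx =>
      h.phi_mem hφ hx)
    ⟨fun x y hxy => Subtype.ext (by
      rw [← hφ.involutive (x : Cx L), ← hφ.involutive (y : Cx L)]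
      exact congrArg φ (congrArg Subtype.val hxy)),
    fun y => ⟨⟨φ y, by
      have h1 := h.phi_mem hφ y.2
      rwa [h.dualAction_dualAction hφ] at h1⟩, Subtype.ext (hφ.involutive _)⟩⟩

theorem phiEquiv_apply (h : RadialData σ T B c) (hφ : TechnicalCondition σ B c T φ ε)
    (α : c →ₗ[ℝ] ℂ) (x : rootSpace c α) : (h.phiEquiv hφ α x : Cx L) = φ x := rfl

variable [Module.Finite ℝ L]

theorem mulU_rootTensor (α : c →ₗ[ℝ] ℂ) {ι : Type*} [Fintype ι] [DecidableEq ι]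
    (e : Module.Basis ι ℂ (rootSpace c α))
    (he : ∀ i j, (formSigma B σ).restrict (rootSpace c α) (e i) (e j) = if i = j then 1 else 0) :
    mulU L (rootTensor σ B α) = ∑ i, -(UniversalEnvelopingAlgebra.ι ℂ (e i : Cx L) *
      UniversalEnvelopingAlgebra.ι ℂ (homC σ (e i : Cx L))) := by
  rw [rootTensor, canonicalTensor_eq_sum _ e he, map_neg, map_sum, map_sum, Finset.sum_neg_distrib]
  rfl

/-- The contribution of a root to the Casimir element, at a regular point. The last term comes from
the brackets `[eᵢ, σ eᵢ]`; it cancels in the sum over all roots. -/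
theorem mulU_rootTensor_eq (h : RadialData σ T B c) (hφ : TechnicalCondition σ B c T φ ε)
    (hE : IsRegularPoint σ T c E X) (hc : ∀ Y, σ Y = -Y → (∀ Z ∈ c, ⁅Z, Y⁆ = 0) → Y ∈ c)
    {α : c →ₗ[ℝ] ℂ} (hα : α ∈ roots c) {ι : Type*} [Fintype ι] [DecidableEq ι]
    (e : Module.Basis ι ℂ (rootSpace c α))
    (he : ∀ i j, (formSigma B σ).restrict (rootSpace c α) (e i) (e j) = if i = j then 1 else 0)
    {y y' : ℂ} (hy : y = rootPower ε α X) (hy' : y' = rootPower ε (-α) X)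
    (Y Z : ι → Ug L)
    (hY : ∀ i, Y i = UniversalEnvelopingAlgebra.ι ℂ ((e i : Cx L) + homC σ (e i : Cx L)))
    (hZ : ∀ i, Z i = UniversalEnvelopingAlgebra.ι ℂ
      (homC E (φ ((e i : Cx L) + homC σ (e i : Cx L))))) :
    mulU L (rootTensor σ B α) =
      ((Module.finrank ℂ (rootSpace c α) : ℂ) / 2) • ((y + y') / (y - y')) •
        (UniversalEnvelopingAlgebra.ι ℂ (coroot B c α : Cx L) : Ug L) +
      (1 / 4 : ℂ) • (2 / (y - y')) ^ 2 •
        (∑ i, Y i * Y i + ∑ i, Z i * Z i + (2 : ℂ) • ∑ i, Y i * Z i) -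
      (1 / 4 : ℂ) • (4 / (y + y' - 2)) • ∑ i, Y i * Z i +
      (1 / 2 : ℂ) • UniversalEnvelopingAlgebra.ι ℂ
        ((Module.finrank ℂ (rootSpace c α) : ℂ) • (coroot B c α : Cx L)) := by
  have hyy : y * y' = 1 := by rw [hy, hy']; exact h.rootPower_mul_rootPower_neg hφ hα.2 X
  have hne : y - y' ≠ 0 := by rw [hy, hy']; exact sub_ne_zero.mpr (h.rootPower_ne hφ hE hα)
  have hne2 : y + y' - 2 ≠ 0 := by
    intro h0
    refine pow_ne_zero 2 hne ?_
    linear_combination (y + y' + 2) * h0 - 4 * hyy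
  -- with `Y = x + s` and `Z = y x + y' s` for `x = eᵢ`, `s = σ eᵢ`, these are the coefficients that
  -- express `-x s` through `Y²`, `Z²`, `Y Z` and the bracket `[x, s]`
  set a : ℂ := 1 / (y - y') ^ 2 with ha
  set b : ℂ := -(y + y') / (y - y') ^ 2 with hb
  set d : ℂ := -y / (y - y') with hd
  have hZ' : ∀ i, Z i = y • UniversalEnvelopingAlgebra.ι ℂ (e i : Cx L) +
      y' • UniversalEnvelopingAlgebra.ι ℂ (homC σ (e i : Cx L)) := fun i => by
    rw [hZ, map_add, map_add, h.point_phi hφ hE (e i).2,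
      h.point_phi hφ hE (h.homC_sigma_mem (e i).2), map_add, map_smul, map_smul, hy, hy']
  have hY' : ∀ i, Y i = UniversalEnvelopingAlgebra.ι ℂ (e i : Cx L) +
      UniversalEnvelopingAlgebra.ι ℂ (homC σ (e i : Cx L)) := fun i => by rw [hY, map_add]
  have hterm : ∀ i, -(UniversalEnvelopingAlgebra.ι ℂ (e i : Cx L) *
      UniversalEnvelopingAlgebra.ι ℂ (homC σ (e i : Cx L)) : Ug L) =
      a • (Y i * Y i + Z i * Z i) + b • (Y i * Z i) +
        d • UniversalEnvelopingAlgebra.ι ℂ ⁅(e i : Cx L), homC σ (e i : Cx L)⁆ := by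
    intro i
    rw [hZ', hY', LieHom.map_lie, LieRing.of_associative_ring_bracket]
    refine neg_mul_eq _ _ hyy ?_ ?_ ?_ ?_
    · rw [ha, hb]; field_simp; linear_combination -hyy
    · rw [ha, hb]; field_simp; linear_combination -hyy
    · rw [ha, hb, hd]; field_simp; linear_combination (-2 : ℂ) * hyy
    · rw [ha, hb, hd]; field_simp; linear_combination (-2 : ℂ) * hyy
  have hsum := h.sum_lie_sigma hc hα e (fun i => (he i i).trans (if_pos rfl))
  have hcard : (Fintype.card ι : ℂ) = Module.finrank ℂ (rootSpace c α) := by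
    rw [Module.finrank_eq_card_basis e]
  rw [hcard] at hsum
  rw [mulU_rootTensor α e he, Finset.sum_congr rfl fun i _ => hterm i, Finset.sum_add_distrib,
    Finset.sum_add_distrib, ← Finset.smul_sum, ← Finset.smul_sum, ← Finset.smul_sum, ← map_sum,
    hsum, Finset.sum_add_distrib, map_neg, map_smul]
  set n : ℂ := (Module.finrank ℂ (rootSpace c α) : ℂ)
  set P := ∑ i, Y i * Y i
  set Q := ∑ i, Z i * Z i
  set W := ∑ i, Y i * Z i
  set C : Ug L := UniversalEnvelopingAlgebra.ι ℂ (coroot B c α : Cx L)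
  have e1 : (1 / 4 : ℂ) * (2 / (y - y')) ^ 2 = a := by rw [ha]; field_simp; norm_num
  have e2 : (1 / 4 : ℂ) * (2 / (y - y')) ^ 2 * 2 - (1 / 4 : ℂ) * (4 / (y + y' - 2)) = b := by
    rw [hb]
    field_simp
    linear_combination (16 : ℂ) * hyy
  have e3 : n / 2 * ((y + y') / (y - y')) + 1 / 2 * n = -(d * n) := by
    rw [hd]; field_simp; ring
  calc a • (P + Q) + b • W + d • -(n • C) = a • (P + Q) + b • W + (-(d * n)) • C := by module
    _ = _ := by rw [← e3, ← e2, ← e1]; module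

variable (h : RadialData σ T B c) (hφ : TechnicalCondition σ B c T φ ε)

/-- The value of `m(A_α) ⊗ 1 + 1 ⊗ m(A_{tα}) + 2 (1 ⊗ φ) A_α` and of `(1 ⊗ φ) A_α`. -/
theorem multiplyOut_root (α : c →ₗ[ℝ] ℂ) {ι : Type*} [Fintype ι] [DecidableEq ι]
    (e : Module.Basis ι ℂ (rootSpace c α))
    (he : ∀ i j, (formSigma B σ).restrict (rootSpace c α) (e i) (e j) = if i = j then 1 else 0)
    (Y Z : ι → Ug L)
    (hY : ∀ i, Y i = UniversalEnvelopingAlgebra.ι ℂ ((e i : Cx L) + homC σ (e i : Cx L)))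
    (hZ : ∀ i, Z i = UniversalEnvelopingAlgebra.ι ℂ
      (homC E (φ ((e i : Cx L) + homC σ (e i : Cx L))))) :
    multiplyOut σ c (AlgHom.id ℂ _) (mapU E) (1 ⊗ₜ[ℂ]
      (LinearMap.mul' ℂ (Uh σ) (TensorProduct.map (ιh σ) (ιh σ)
        (tensorA h.involutive B c α)) ⊗ₜ[ℂ] (1 : Uh σ))) = ∑ i, Y i * Y i ∧
    multiplyOut σ c (AlgHom.id ℂ _) (mapU E) (1 ⊗ₜ[ℂ]
      ((1 : Uh σ) ⊗ₜ[ℂ] LinearMap.mul' ℂ (Uh σ) (TensorProduct.map (ιh σ) (ιh σ)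
        (tensorA h.involutive B c (hφ.dualAction α))))) = ∑ i, Z i * Z i ∧
    multiplyOut σ c (AlgHom.id ℂ _) (mapU E) (1 ⊗ₜ[ℂ]
      TensorProduct.map (ιh σ) (ιh σ ∘ₗ hφ.restrictPhi h.involutive)
        (tensorA h.involutive B c α)) = ∑ i, Y i * Z i := by
  have hA := tensorA_eq_sum h.involutive B c α e he
  have hA' := tensorA_eq_sum h.involutive B c (hφ.dualAction α) (e.map (h.phiEquiv hφ α))
    (fun i j => by
      rw [← he, Module.Basis.map_apply, Module.Basis.map_apply, phiEquiv_apply, phiEquiv_apply,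
        formSigma_apply, ← hφ.commutes, hφ.orthogonal]
      rfl)
  have hι : ∀ x : hC σ, inclU (hC σ) (ιh σ x) = UniversalEnvelopingAlgebra.ι ℂ (x : Cx L) :=
    inclU_ι (hC σ)
  have hs : ∀ (β : c →ₗ[ℝ] ℂ) (x : rootSpace c β),
      (symmetrize h.involutive c β x : Cx L) = (x : Cx L) + homC σ (x : Cx L) := fun _ _ => rfl
  refine ⟨?_, ?_, ?_⟩
  · rw [multiplyOut_tmul, hA]
    simp only [map_sum, map_one, mul_one, AlgHom.id_apply, TensorProduct.map_tmul,
      LinearMap.mul'_apply, map_mul, hι, hs, hY]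
  · rw [multiplyOut_tmul, hA']
    simp only [map_sum, map_one, one_mul, TensorProduct.map_tmul,
      LinearMap.mul'_apply, map_mul, hι, hs, hZ, mapU_ι, Module.Basis.map_apply, phiEquiv_apply,
      ← hφ.commutes, ← map_add φ]
  · rw [hA, map_sum, TensorProduct.tmul_sum, map_sum]
    refine Finset.sum_congr rfl fun i _ => ?_
    rw [TensorProduct.map_tmul, multiplyOut_tmul, LinearMap.comp_apply, hι, hι, mapU_ι, map_one,
      mul_one, AlgHom.id_apply, hY, hZ, hs]
    rfl

theorem inclU_casimirC : inclU (complexify c) (casimirC B c) = mulU L (TensorProduct.map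
    (complexify c).toSubmodule.subtype (complexify c).toSubmodule.subtype
    (canonicalTensor ((formC B).restrict (complexify c).toSubmodule))) :=
  inclU_quadratic (S := complexify c) (p := (complexify c).toSubmodule) _
    (fun x => inclU_ι (complexify c) x) _

theorem inclU_casimirM : inclU (hC σ) (casimirM σ B c) = mulU L (TensorProduct.map
    (mC σ c).toSubmodule.subtype (mC σ c).toSubmodule.subtype
    (canonicalTensor ((formC B).restrict (mC σ c).toSubmodule))) :=
  inclU_quadratic (S := hC σ) (p := (mC σ c).toSubmodule) (ιm σ c) (fun x => inclU_ιm x) _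

/-- The contribution of a root to the Casimir element, in terms of the formula. -/
theorem mulU_rootTensor_eq_radialEval (hE : IsRegularPoint σ T c E X)
    (hEm : ∀ v ∈ mC σ c, homC E v = homC T v)
    (hc : ∀ Y, σ Y = -Y → (∀ Z ∈ c, ⁅Z, Y⁆ = 0) → Y ∈ c)
    {R : Type*} [CommRing R] [Algebra ℂ R] (evx : R →ₐ[ℂ] ℂ)
    {α : c →ₗ[ℝ] ℂ} (hα' : α ∈ roots c) (f g k : R)
    (h₁ : evx f =
      (rootPower ε α X + rootPower ε (-α) X) / (rootPower ε α X - rootPower ε (-α) X))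
    (h₂ : evx g = 2 / (rootPower ε α X - rootPower ε (-α) X))
    (h₃ : evx k = 4 / (rootPower ε α X + rootPower ε (-α) X - 2)) :
    mulU L (rootTensor σ B α) =
      ((Module.finrank ℂ (rootSpace c α) : ℂ) / 2) • radialEval hEm evx
        (Radial.term T f (UniversalEnvelopingAlgebra.ι ℂ (coroot B c α)) (1 ⊗ₜ[ℂ] 1)) +
      (1 / 4 : ℂ) • radialEval hEm evx (Radial.term T (g ^ 2) 1
        (LinearMap.mul' ℂ (Uh σ) (TensorProduct.map (ιh σ) (ιh σ)
          (tensorA h.involutive B c α)) ⊗ₜ[ℂ] 1 + 1 ⊗ₜ[ℂ] LinearMap.mul' ℂ (Uh σ)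
          (TensorProduct.map (ιh σ) (ιh σ) (tensorA h.involutive B c (hφ.dualAction α))) +
          (2 : ℂ) • TensorProduct.map (ιh σ) (ιh σ ∘ₗ hφ.restrictPhi h.involutive)
            (tensorA h.involutive B c α))) -
      (1 / 4 : ℂ) • radialEval hEm evx (Radial.term T k 1
        (TensorProduct.map (ιh σ) (ιh σ ∘ₗ hφ.restrictPhi h.involutive)
          (tensorA h.involutive B c α))) +
      (1 / 2 : ℂ) • UniversalEnvelopingAlgebra.ι ℂ
        ((Module.finrank ℂ (rootSpace c α) : ℂ) • (coroot B c α : Cx L)) := by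
  obtain ⟨e, he⟩ := exists_orthonormal_basis _ (h.formSigma_restrict_isSymm α)
    (h.formSigma_restrict_nondegenerate α)
  obtain ⟨m₁, m₂, m₃⟩ := h.multiplyOut_root (E := E) hφ α e he _ _ (fun i => rfl) (fun i => rfl)
  have m₄ : ∀ t, multiplyOut σ c (AlgHom.id ℂ _) (mapU E) (1 ⊗ₜ[ℂ] ((2 : ℂ) • t)) =
      (2 : ℂ) • multiplyOut σ c (AlgHom.id ℂ _) (mapU E) (1 ⊗ₜ[ℂ] t) := fun t => by
    rw [TensorProduct.tmul_smul, map_smul]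
  rw [h.mulU_rootTensor_eq hφ hE hc hα' e he rfl rfl _ _ (fun i => rfl) (fun i => rfl),
    radialEval_term, radialEval_term, radialEval_term, h₁, map_pow, h₂, h₃,
    TensorProduct.tmul_add, TensorProduct.tmul_add, map_add, map_add, m₄,
    m₁, m₂, m₃, multiplyOut_tmul, map_one, map_one, one_mul, mul_one, inclU_ι,
    AlgHom.id_apply]

set_option maxHeartbeats 1600000 in
/-- At a regular point, the formula for the radial part evaluates to the Casimir element. -/
theorem radialEval_casimirFormula (hE : IsRegularPoint σ T c E X)
    (hEm : ∀ v ∈ mC σ c, homC E v = homC T v)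
    (hc : ∀ Y, σ Y = -Y → (∀ Z ∈ c, ⁅Z, Y⁆ = 0) → Y ∈ c)
    {R : Type*} [CommRing R] [Algebra ℂ R] (evx : R →ₐ[ℂ] ℂ)
    (coth csch cschHalfSq : (c →ₗ[ℝ] ℂ) → R)
    (h₁ : ∀ α ∈ roots c, evx (coth α) =
      (rootPower ε α X + rootPower ε (-α) X) / (rootPower ε α X - rootPower ε (-α) X))
    (h₂ : ∀ α ∈ roots c, evx (csch α) = 2 / (rootPower ε α X - rootPower ε (-α) X))
    (h₃ : ∀ α ∈ roots c, evx (cschHalfSq α) = 4 / (rootPower ε α X + rootPower ε (-α) X - 2)) :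
    radialEval hEm evx (casimirFormula h.involutive B c T (hφ.restrictPhi h.involutive)
      hφ.dualAction coth csch cschHalfSq) = casimir B := by
  have hfin := finite_roots c h.comm
  have hcas : casimir B = mulU L (canonicalTensor (formC B)) := rfl
  have hroot := fun α (hα : α ∈ hfin.toFinset) =>
    have hα' := (Set.Finite.mem_toFinset _).mp hα
    h.mulU_rootTensor_eq_radialEval hφ hE hEm hc evx hα' (coth α) (csch α) (cschHalfSq α)
      (h₁ α hα') (h₂ α hα') (h₃ α hα')
  -- the terms of `α` and `-α` cancel
  have hzero : ∑ α ∈ hfin.toFinset, (1 / 2 : ℂ) • (UniversalEnvelopingAlgebra.ι ℂ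
      ((Module.finrank ℂ (rootSpace c α) : ℂ) • (coroot B c α : Cx L)) : Ug L) = 0 := by
    rw [← Finset.smul_sum, ← map_sum, h.sum_coroot hc, map_zero, smul_zero]
  rw [casimirFormula]
  dsimp only
  rw [finsum_mem_eq_finite_toFinset_sum _ hfin, finsum_mem_eq_finite_toFinset_sum _ hfin,
    finsum_mem_eq_finite_toFinset_sum _ hfin, map_sub, map_add, map_add, map_add, map_sum, map_sum,
    map_sum, hcas, h.canonicalTensor_eq hc, map_add, map_add, map_sum, ← inclU_casimirC, ← inclU_casimirM,
    Finset.sum_congr rfl hroot, Finset.sum_add_distrib, hzero, add_zero, Finset.sum_sub_distrib,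
    Finset.sum_add_distrib]
  simp only [map_smul]
  rw [radialEval_term hEm evx 1 (casimirC B c), radialEval_term hEm evx 1 1, multiplyOut_tmul,
    multiplyOut_tmul]
  simp only [map_one, one_mul, mul_one, one_smul, AlgHom.id_apply]
  abel

end RadialData

end FormulaEvaluation

end

end CasimirRadial

namespace CasimirRadial

noncomputable section

attribute [local instance 100] LieRing.ofAssociativeRing

/-! ### Invariance of the Casimir element -/

section Invariance

variable {L : Type*} [LieRing L] [LieAlgebra ℝ L]

theorem mapU_mapU_of_leftInverse {f g : L →ₗ⁅ℝ⁆ L} (hfg : ∀ X, f (g X) = X) (u : Ug L) :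
    mapU f (mapU g u) = u := by
  have h : (mapU f).comp (mapU g) = AlgHom.id ℂ (Ug L) := by
    refine UniversalEnvelopingAlgebra.hom_ext ℂ (LieHom.ext fun x => ?_)
    change mapU f (mapU g (UniversalEnvelopingAlgebra.ι ℂ x)) = UniversalEnvelopingAlgebra.ι ℂ x
    rw [mapU_ι, mapU_ι]
    congr 1
    induction x using TensorProduct.induction_on with
    | zero => simp
    | tmul z Y => rw [homC_tmul, homC_tmul, hfg]
    | add x y hx hy => rw [map_add, map_add, hx, hy]
  exact AlgHom.congr_fun h u

/-- Automorphisms of `𝔤` that preserve `B` fix the Casimir element. -/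
theorem mapU_casimir [Module.Finite ℝ L] {B : LinearMap.BilinForm ℝ L} (hs : B.IsSymm)
    (hn : B.Nondegenerate) {f : L →ₗ⁅ℝ⁆ L} (hf : ∀ X Y, B (f X) (f Y) = B X Y) :
    mapU f (casimir B) = casimir B := by
  obtain ⟨e, he⟩ := exists_orthonormal_basis (formC B) ⟨fun x y => formC_symm hs x y⟩
    (formC_nondegenerate hs hn)
  have hinj : Function.Injective (homC f : Cx L →ₗ[ℂ] Cx L) := by
    refine (injective_iff_map_eq_zero _).mpr fun x hx => (formC_nondegenerate hs hn).1 x fun y => ?_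
    rw [← formC_homC hf, show homC f x = 0 from hx, map_zero, LinearMap.zero_apply]
  have he' := canonicalTensor_eq_sum (formC B) (e.map (LinearEquiv.ofInjectiveEndo _ hinj))
    fun i j => by
      rw [← he i j]
      exact formC_homC hf (e i) (e j)
  have h₁ : casimir B = mulU L (canonicalTensor (formC B)) := rfl
  conv_rhs => rw [h₁, he']
  rw [h₁, canonicalTensor_eq_sum (formC B) e he, map_sum, map_sum, map_sum]
  refine Finset.sum_congr rfl fun i _ => ?_
  rw [mulU_tmul, mulU_tmul, map_mul, mapU_ι]
  rfl

end Invariance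

/-! ### Radial parts with respect to both multiplication maps -/

section

variable {L : Type*} [LieRing L] [LieAlgebra ℝ L]

theorem evalRadial_inv {σ : L →ₗ⁅ℝ⁆ L} {c : LieSubalgebra ℝ L} {f g : L →ₗ⁅ℝ⁆ L}
    (hfg : ∀ X, f (g X) = X) {R : Type*} [CommRing R] [Algebra ℂ R] (evx : R →ₐ[ℂ] ℂ)
    (F : FreeRadial R σ c) :
    evalRadial σ c (mapU f) (AlgHom.id ℂ _) evx F =
      mapU f (evalRadial σ c (AlgHom.id ℂ _) (mapU g) evx F) := by
  have h : evalRadial σ c (mapU f) (AlgHom.id ℂ _) evx =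
      (mapU f).toLinearMap ∘ₗ evalRadial σ c (AlgHom.id ℂ _) (mapU g) evx := by
    refine TensorProduct.ext' fun r w => ?_
    induction w using TensorProduct.induction_on with
    | zero => simp
    | add x y hx hy => rw [TensorProduct.tmul_add, map_add, map_add, hx, hy]
    | tmul p w =>
      induction w using TensorProduct.induction_on with
      | zero => simp
      | add x y hx hy =>
        rw [TensorProduct.tmul_add, TensorProduct.tmul_add, map_add, map_add, hx, hy]
      | tmul u v =>
        rw [LinearMap.comp_apply, evalRadial_tmul, evalRadial_tmul, map_smul]
        change _ = _ • (mapU f) (_ * _)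
        rw [map_mul (mapU f) _ (mapU g _), mapU_mapU_of_leftInverse hfg]
        rfl
  exact LinearMap.congr_fun h F

end

section

variable {n : ℕ} {G : Type*} [TopologicalSpace G] [ChartedSpace (EuclideanSpace ℝ (Fin n)) G]
  [Group G] [LieGroup (𝓡 n) ∞ G] {K : Subgroup G} {θ : LieAlg n G →ₗ⁅ℝ⁆ LieAlg n G}
  {B : LinearMap.BilinForm ℝ (LieAlg n G)} {σ : LieAlg n G →ₗ⁅ℝ⁆ LieAlg n G}
  {t a : Submodule ℝ (LieAlg n G)} {c' : LieSubalgebra ℝ (LieAlg n G)} {t₀ : G}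

/-- The two radial parts of an `Ad(G)`-invariant element agree. -/
theorem isPi_iff_isPiTilde {q : Ug (LieAlg n G)} (hq : ∀ g : G, mapU (Ad n g) q = q)
    (F : RadialSpace σ c' t₀) : IsPi q F ↔ IsPiTilde q F := by
  have h₁ : ∀ (g : G) X, Ad n g⁻¹ (Ad n g X) = X := fun g X => by
    rw [← Ad_mul, inv_mul_cancel, Ad_one]
  have h₂ : ∀ (g : G) X, Ad n g (Ad n g⁻¹ X) = X := fun g X => by
    rw [← Ad_mul, mul_inv_cancel, Ad_one]
  refine forall_congr' fun F' => forall_congr' fun _ => forall_congr' fun x => ?_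
  rw [evalRadial_inv (h₁ x)]
  refine ⟨fun h => ?_, fun h => by rw [h, hq]⟩
  rw [← mapU_mapU_of_leftInverse (h₂ x) (evalRadial _ _ _ _ _ F'), h, hq]

/-! ### The coefficient functions -/

/-- A function of `X ∈ 𝔠'` that only depends on `exp(X) t₀` and is smooth where `exp(X) t₀` is
regular defines an element of `C^∞(C' ∩ G_rs)`. -/
theorem exists_smoothFunction (g : c' → ℂ)
    (hg : ∀ X X' : c', lieExp (X : LieAlg n G) * t₀ ∈ regularSemisimple σ →
      lieExp (X : LieAlg n G) * t₀ = lieExp (X' : LieAlg n G) * t₀ → g X = g X')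
    (hs : ContDiffOn ℝ ∞ (fun y => g (coordPoint c' y))
      {y | lieExp (coordPoint c' y : LieAlg n G) * t₀ ∈ regularSemisimple σ}) :
    ∃ f : smoothFunctions σ c' t₀, ∀ (X : c')
      (hX : lieExp (X : LieAlg n G) * t₀ ∈ regularSemisimple σ),
      f.1 ⟨_, mem_regularPart X hX⟩ = g X := by
  have hval : ∀ (X : c') (hX : lieExp (X : LieAlg n G) * t₀ ∈ regularSemisimple σ),
      g ⟨(mem_regularPart X hX).1.choose, (mem_regularPart X hX).1.choose_spec.1⟩ = g X :=
    fun X hX => (hg _ _ hX (mem_regularPart X hX).1.choose_spec.2.symm).symm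
  exact ⟨⟨fun x => g ⟨x.2.1.choose, x.2.1.choose_spec.1⟩, _, hs, fun y hy => (hval _ hy).symm⟩, hval⟩

theorem contDiff_rootPower (ε : (c' →ₗ[ℝ] ℂ) → ℂˣ) (α : c' →ₗ[ℝ] ℂ) :
    ContDiff ℝ ∞ fun y => rootPower ε α (coordPoint c' y) := by
  have h := (LinearMap.toContinuousLinearMap
    (α ∘ₗ (Module.finBasis ℝ c').equivFun.symm.toLinearMap)).contDiff (n := ∞)
  exact contDiff_const.mul h.cexp

/-- `x^α` is the eigenvalue of `Ad(x) φ` on `𝔤_α`, so it only depends on `x`. -/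
theorem rootPower_eq_of_lieExp_eq (h : RadialData σ (Ad n t₀) B c')
    {φ : Cx (LieAlg n G) →ₗ[ℂ] Cx (LieAlg n G)} {ε : (c' →ₗ[ℝ] ℂ) → ℂˣ}
    (hφ : TechnicalCondition σ B c' (Ad n t₀) φ ε)
    {α : c' →ₗ[ℝ] ℂ} (hα : rootSpace c' α ≠ ⊥) {X X' : c'}
    (hX : lieExp (X : LieAlg n G) * t₀ ∈ regularSemisimple σ)
    (hXX' : lieExp (X : LieAlg n G) * t₀ = lieExp (X' : LieAlg n G) * t₀) :
    rootPower ε α X = rootPower ε α X' := by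
  obtain ⟨v, hv, hv0⟩ := (Submodule.ne_bot_iff _).mp hα
  refine smul_left_injective ℂ hv0 ?_
  change rootPower ε α X • v = rootPower ε α X' • v
  rw [← h.point_phi hφ (isRegularPoint_of_mem X hX) hv,
    ← h.point_phi hφ (isRegularPoint_of_mem X' (hXX' ▸ hX)) hv, hXX']

/-- Smooth functions with prescribed values in terms of `x^α` and `x^{-α}`, for each root `α`. -/
theorem exists_rootFunctions (h : RadialData σ (Ad n t₀) B c')
    {φ : Cx (LieAlg n G) →ₗ[ℂ] Cx (LieAlg n G)} {ε : (c' →ₗ[ℝ] ℂ) → ℂˣ}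
    (hφ : TechnicalCondition σ B c' (Ad n t₀) φ ε) (N D : ℂ → ℂ → ℂ)
    (hN : ∀ f g : (Fin (Module.finrank ℝ c') → ℝ) → ℂ, ContDiff ℝ ∞ f → ContDiff ℝ ∞ g →
      ContDiff ℝ ∞ fun y => N (f y) (g y))
    (hD : ∀ f g : (Fin (Module.finrank ℝ c') → ℝ) → ℂ, ContDiff ℝ ∞ f → ContDiff ℝ ∞ g →
      ContDiff ℝ ∞ fun y => D (f y) (g y))
    (hD0 : ∀ y y', y * y' = 1 → y ≠ y' → D y y' ≠ 0) :
    ∃ f : (c' →ₗ[ℝ] ℂ) → smoothFunctions σ c' t₀, ∀ α ∈ roots c', ∀ (X : c')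
      (hX : lieExp (X : LieAlg n G) * t₀ ∈ regularSemisimple σ),
      (f α).1 ⟨_, mem_regularPart X hX⟩ =
        N (rootPower ε α X) (rootPower ε (-α) X) / D (rootPower ε α X) (rootPower ε (-α) X) := by
  have key : ∀ α : c' →ₗ[ℝ] ℂ, ∃ f : smoothFunctions σ c' t₀, α ∈ roots c' → ∀ (X : c')
      (hX : lieExp (X : LieAlg n G) * t₀ ∈ regularSemisimple σ),
      f.1 ⟨_, mem_regularPart X hX⟩ =
        N (rootPower ε α X) (rootPower ε (-α) X) / D (rootPower ε α X) (rootPower ε (-α) X) := by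
    intro α
    by_cases hα : α ∈ roots c'
    · have hs : ContDiffOn ℝ ∞ (fun y =>
          N (rootPower ε α (coordPoint c' y)) (rootPower ε (-α) (coordPoint c' y)) /
            D (rootPower ε α (coordPoint c' y)) (rootPower ε (-α) (coordPoint c' y)))
          {y | lieExp (coordPoint c' y : LieAlg n G) * t₀ ∈ regularSemisimple σ} := by
        simp only [div_eq_mul_inv]
        refine (hN _ _ (contDiff_rootPower ε α) (contDiff_rootPower ε (-α))).contDiffOn.mul
          ((hD _ _ (contDiff_rootPower ε α) (contDiff_rootPower ε (-α))).contDiffOn.inv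
            fun y hy => ?_)
        have hy' : lieExp (coordPoint c' y : LieAlg n G) * t₀ ∈ regularSemisimple σ := hy
        exact hD0 _ _ (h.rootPower_mul_rootPower_neg hφ hα.2 (coordPoint c' y))
          (h.rootPower_ne hφ (isRegularPoint_of_mem (coordPoint c' y) hy') hα)
      obtain ⟨f, hf⟩ := exists_smoothFunction (σ := σ) (t₀ := t₀) (fun X =>
        N (rootPower ε α X) (rootPower ε (-α) X) / D (rootPower ε α X) (rootPower ε (-α) X))
        (fun X X' hX hXX' => by
          rw [rootPower_eq_of_lieExp_eq h hφ hα.2 hX hXX',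
            rootPower_eq_of_lieExp_eq h hφ (h.rootSpace_neg_ne_bot hα.2) hX hXX']) hs
      exact ⟨f, fun _ => hf⟩
    · exact ⟨0, fun h' => absurd h' hα⟩
  choose f hf using key
  exact ⟨f, hf⟩

theorem homC_Ad_of_mem_mC (h : RadialData σ (Ad n t₀) B c')
    {φ : Cx (LieAlg n G) →ₗ[ℂ] Cx (LieAlg n G)} {ε : (c' →ₗ[ℝ] ℂ) → ℂˣ}
    (hφ : TechnicalCondition σ B c' (Ad n t₀) φ ε) (x : regularPart σ c' t₀) :
    ∀ v ∈ mC σ c', homC (Ad n (x : G)) v = homC (Ad n t₀) v := by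
  obtain ⟨x, ⟨X, hX, rfl⟩, hx⟩ := x
  exact fun v hv => h.point_of_mem_zero hφ (isRegularPoint_of_mem ⟨X, hX⟩ hx) (h.mem_mC_iff.mp hv).2

theorem isPiTilde_iff_radialEval
    (hEm : ∀ x : regularPart σ c' t₀, ∀ v ∈ mC σ c', homC (Ad n (x : G)) v = homC (Ad n t₀) v)
    (q : Ug (LieAlg n G)) (F : RadialSpace σ c' t₀) :
    IsPiTilde q F ↔ ∀ x, radialEval (hEm x) (evalAt x) F = q := by
  constructor
  · intro hF x
    obtain ⟨F', rfl⟩ := radialMk_surjective _ σ c' (Ad n t₀) F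
    rw [← evalRadial_eq_radialEval]
    exact hF F' rfl x
  · rintro hF F' rfl x
    rw [evalRadial_eq_radialEval (hEm x)]
    exact hF x

theorem radialEval_injective (h : CartanData θ σ B) (hR : RadialData σ (Ad n t₀) B c')
    {φ : Cx (LieAlg n G) →ₗ[ℂ] Cx (LieAlg n G)} {ε : (c' →ₗ[ℝ] ℂ) → ℂˣ}
    (hφ : TechnicalCondition σ B c' (Ad n t₀) φ ε)
    (hEm : ∀ x : regularPart σ c' t₀, ∀ v ∈ mC σ c', homC (Ad n (x : G)) v = homC (Ad n t₀) v)
    {F F' : RadialSpace σ c' t₀}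
    (hF : ∀ x, radialEval (hEm x) (evalAt x) F = radialEval (hEm x) (evalAt x) F') : F = F' := by
  have hev : ∀ f : smoothFunctions σ c' t₀,
      (∀ x : regularPart σ c' t₀, evalAt x f = 0) → f = 0 := fun f hf =>
    Subtype.ext (funext fun x => hf x)
  have hpoint : ∀ x : regularPart σ c' t₀,
      ∃ X : c', IsRegularPoint σ (Ad n t₀) c' (Ad n (x : G)) X := by
    rintro ⟨x, ⟨X, hX, rfl⟩, hx⟩
    exact ⟨⟨X, hX⟩, isRegularPoint_of_mem ⟨X, hX⟩ hx⟩
  choose X hreg using hpoint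
  have key : ∀ x, radialEval (hEm x) (evalAt x) (F - F') = 0 := fun x => by
    rw [map_sub, hF, sub_self]
  exact sub_eq_zero.mp (eq_zero_of_eval_eq_zero hR hφ h.eq_zero_of_central (fun x => evalAt x)
    hev (fun x => Ad n (x : G)) X hreg hEm (F - F') key)

/-- `coth_α`, `csch_α` and `csch²_{α/2}` in terms of `x^α` and `x^{-α}`. -/
structure IsRootFunctions (ε : (c' →ₗ[ℝ] ℂ) → ℂˣ)
    (coth csch cschHalfSq : (c' →ₗ[ℝ] ℂ) → smoothFunctions σ c' t₀) : Prop where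
  coth_apply : ∀ α ∈ roots c', ∀ (X : c')
    (hX : lieExp (X : LieAlg n G) * t₀ ∈ regularSemisimple σ),
    (coth α).1 ⟨_, mem_regularPart X hX⟩ =
      (rootPower ε α X + rootPower ε (-α) X) / (rootPower ε α X - rootPower ε (-α) X)
  csch_apply : ∀ α ∈ roots c', ∀ (X : c')
    (hX : lieExp (X : LieAlg n G) * t₀ ∈ regularSemisimple σ),
    (csch α).1 ⟨_, mem_regularPart X hX⟩ = 2 / (rootPower ε α X - rootPower ε (-α) X)
  cschHalfSq_apply : ∀ α ∈ roots c', ∀ (X : c')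
    (hX : lieExp (X : LieAlg n G) * t₀ ∈ regularSemisimple σ),
    (cschHalfSq α).1 ⟨_, mem_regularPart X hX⟩ =
      4 / (rootPower ε α X + rootPower ε (-α) X - 2)

/-- `coth_α`, `csch_α` and `csch²_{α/2}` are well defined and smooth. The last denominator does
not vanish since `(y + y⁻¹)² - 4 = (y - y⁻¹)²`. -/
theorem exists_isRootFunctions (h : RadialData σ (Ad n t₀) B c')
    {φ : Cx (LieAlg n G) →ₗ[ℂ] Cx (LieAlg n G)} {ε : (c' →ₗ[ℝ] ℂ) → ℂˣ}
    (hφ : TechnicalCondition σ B c' (Ad n t₀) φ ε) :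
    ∃ coth csch cschHalfSq : (c' →ₗ[ℝ] ℂ) → smoothFunctions σ c' t₀,
      IsRootFunctions ε coth csch cschHalfSq := by
  obtain ⟨f₁, h₁⟩ := exists_rootFunctions h hφ (fun y y' => y + y') (fun y y' => y - y')
    (fun f g hf hg => hf.add hg) (fun f g hf hg => hf.sub hg) (fun y y' _ hy => sub_ne_zero.mpr hy)
  obtain ⟨f₂, h₂⟩ := exists_rootFunctions h hφ (fun _ _ => 2) (fun y y' => y - y')
    (fun f g hf hg => contDiff_const) (fun f g hf hg => hf.sub hg)
    (fun y y' _ hy => sub_ne_zero.mpr hy)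
  obtain ⟨f₃, h₃⟩ := exists_rootFunctions h hφ (fun _ _ => 4) (fun y y' => y + y' - 2)
    (fun f g hf hg => contDiff_const) (fun f g hf hg => (hf.add hg).sub contDiff_const)
    (fun y y' hyy hy h0 => pow_ne_zero 2 (sub_ne_zero.mpr hy) (by
      linear_combination (y + y' + 2) * h0 - 4 * hyy))
  exact ⟨f₁, f₂, f₃, h₁, h₂, h₃⟩

theorem radialEval_casimirFormula_evalAt (h : CartanData θ σ B) (hG : IsReductiveLieGroup K θ B)
    (hC : IsFundamentalCartan θ σ t a) (hC' : IsStandardCartan θ σ t a c' t₀)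
    (hσ : ∀ X, σ (σ X) = X)
    {φ : Cx (LieAlg n G) →ₗ[ℂ] Cx (LieAlg n G)} {ε : (c' →ₗ[ℝ] ℂ) → ℂˣ}
    (hφ : TechnicalCondition σ B c' (Ad n t₀) φ ε)
    {coth csch cschHalfSq : (c' →ₗ[ℝ] ℂ) → smoothFunctions σ c' t₀}
    (hf : IsRootFunctions ε coth csch cschHalfSq) (x : regularPart σ c' t₀)
    (hEm : ∀ v ∈ mC σ c', homC (Ad n (x : G)) v = homC (Ad n t₀) v) :
    radialEval hEm (evalAt x) (casimirFormula hσ B c' (Ad n t₀)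
      (hφ.restrictPhi hσ) hφ.dualAction coth csch cschHalfSq) = casimir B := by
  have hR := radialData_of_isStandardCartan h hG hC hC'
  obtain ⟨x, ⟨X, hX, rfl⟩, hx⟩ := x
  exact hR.radialEval_casimirFormula hφ (isRegularPoint_of_mem ⟨X, hX⟩ hx) hEm
    (fun Y hY hYc => mem_of_centralizes h hG hC hC' hφ ⟨X, hX⟩ hx hY hYc) _
    coth csch cschHalfSq (fun α hα => hf.coth_apply α hα ⟨X, hX⟩ hx)
    (fun α hα => hf.csch_apply α hα ⟨X, hX⟩ hx) (fun α hα => hf.cschHalfSq_apply α hα ⟨X, hX⟩ hx)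

/-- The formula is the unique element that evaluates to the Casimir element at all points. -/
theorem isPiTilde_casimir_iff (h : CartanData θ σ B) (hG : IsReductiveLieGroup K θ B)
    (hC : IsFundamentalCartan θ σ t a) (hC' : IsStandardCartan θ σ t a c' t₀)
    (hσ : ∀ X, σ (σ X) = X)
    {φ : Cx (LieAlg n G) →ₗ[ℂ] Cx (LieAlg n G)} {ε : (c' →ₗ[ℝ] ℂ) → ℂˣ}
    (hφ : TechnicalCondition σ B c' (Ad n t₀) φ ε)
    {coth csch cschHalfSq : (c' →ₗ[ℝ] ℂ) → smoothFunctions σ c' t₀}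
    (hf : IsRootFunctions ε coth csch cschHalfSq) (F : RadialSpace σ c' t₀) :
    IsPiTilde (casimir B) F ↔ F = casimirFormula hσ B c' (Ad n t₀) (hφ.restrictPhi hσ)
      hφ.dualAction coth csch cschHalfSq := by
  have hR := radialData_of_isStandardCartan h hG hC hC'
  have hEm := homC_Ad_of_mem_mC hR hφ
  have hformula := fun x =>
    radialEval_casimirFormula_evalAt h hG hC hC' hσ hφ hf x (hEm x)
  rw [isPiTilde_iff_radialEval hEm]
  exact ⟨fun hF => radialEval_injective h hR hφ hEm fun x => (hF x).trans (hformula x).symm,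
    fun hF x => hF ▸ hformula x⟩

/-- The formula for both radial parts. -/
theorem isPi_and_isPiTilde_casimir_iff (h : CartanData θ σ B) (hG : IsReductiveLieGroup K θ B)
    (hC : IsFundamentalCartan θ σ t a) (hC' : IsStandardCartan θ σ t a c' t₀)
    (hσ : ∀ X, σ (σ X) = X)
    {φ : Cx (LieAlg n G) →ₗ[ℂ] Cx (LieAlg n G)} {ε : (c' →ₗ[ℝ] ℂ) → ℂˣ}
    (hφ : TechnicalCondition σ B c' (Ad n t₀) φ ε)
    {coth csch cschHalfSq : (c' →ₗ[ℝ] ℂ) → smoothFunctions σ c' t₀}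
    (hf : IsRootFunctions ε coth csch cschHalfSq) (F : RadialSpace σ c' t₀) :
    (IsPi (casimir B) F ↔ F = casimirFormula hσ B c' (Ad n t₀) (hφ.restrictPhi hσ)
      hφ.dualAction coth csch cschHalfSq) ∧
    (IsPiTilde (casimir B) F ↔ F = casimirFormula hσ B c' (Ad n t₀) (hφ.restrictPhi hσ)
      hφ.dualAction coth csch cschHalfSq) := by
  have key := isPiTilde_casimir_iff h hG hC hC' hσ hφ hf F
  exact ⟨(isPi_iff_isPiTilde (fun g => mapU_casimir hG.symm hG.nondegenerate (hG.ad_invariant g))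
    F).trans key, key⟩

end

/-! ### The case `Ad(t) = 1` -/

theorem technicalCondition_one {L : Type*} [LieRing L] [LieAlgebra ℝ L] {σ T : L →ₗ⁅ℝ⁆ L}
    (B : LinearMap.BilinForm ℝ L) (c : LieSubalgebra ℝ L) (hT : ∀ X, T X = X) :
    TechnicalCondition σ B c T LinearMap.id 1 where
  mapsTo X hX := by rwa [hT]
  involutive _ := rfl
  orthogonal _ _ := rfl
  commutes _ := rfl
  eq_smul α X hX := by
    clear hX
    rw [Pi.one_apply, Units.val_one, one_smul, LinearMap.id_apply]
    induction X using TensorProduct.induction_on with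
    | zero => simp
    | tmul z Y => rw [homC_tmul, hT]
    | add x y hx hy => rw [map_add, hx, hy]

theorem rootPower_one {L : Type*} [LieRing L] [LieAlgebra ℝ L] {c : LieSubalgebra ℝ L}
    (α : c →ₗ[ℝ] ℂ) (X : c) : rootPower 1 α X = Complex.exp (α X) := by
  rw [rootPower, Pi.one_apply, Units.val_one, one_mul]

theorem exp_add_exp_neg_sub_two (z : ℂ) :
    Complex.exp z + Complex.exp (-z) - 2 = 4 * Complex.sinh (z / 2) ^ 2 := by
  have h₁ : Complex.exp z = Complex.exp (z / 2) ^ 2 := by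
    rw [← Complex.exp_nat_mul]; congr 1; push_cast; ring
  have h₂ : Complex.exp (-z) = Complex.exp (-(z / 2)) ^ 2 := by
    rw [← Complex.exp_nat_mul]; congr 1; push_cast; ring
  have h₃ : Complex.exp (z / 2) * Complex.exp (-(z / 2)) = 1 := by
    rw [← Complex.exp_add, add_neg_cancel, Complex.exp_zero]
  rw [Complex.sinh, h₁, h₂]
  linear_combination (2 : ℂ) * h₃

end

end CasimirRadial

theorem mainTheorem1 {n : ℕ} {G : Type*} [TopologicalSpace G]
    [ChartedSpace (EuclideanSpace ℝ (Fin n)) G] [Group G] [LieGroup (𝓡 n) ∞ G]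
    (K : Subgroup G) (θ : LieAlg n G →ₗ⁅ℝ⁆ LieAlg n G) (B : LinearMap.BilinForm ℝ (LieAlg n G))
    (hG : IsReductiveLieGroup K θ B)
    (σ : SmoothAut n G) (H : Subgroup G) (hH : IsSymmetricPair σ H)
    (hθσ : ∀ X, θ (σ.differential X) = σ.differential (θ X))
    (hBσ : ∀ X Y, B (σ.differential X) (σ.differential Y) = B X Y)
    (t a : Submodule ℝ (LieAlg n G)) (hC : IsFundamentalCartan θ σ.differential t a)
    (c' : LieSubalgebra ℝ (LieAlg n G)) (t₀ : G)
    (hC' : IsStandardCartan θ σ.differential t a c' t₀) :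
    (∀ (φ : Cx (LieAlg n G) →ₗ[ℂ] Cx (LieAlg n G)) (ε : (c' →ₗ[ℝ] ℂ) → ℂˣ)
        (hφ : TechnicalCondition σ.differential B c' (Ad n t₀) φ ε),
      ∃ coth csch cschHalfSq : (c' →ₗ[ℝ] ℂ) → smoothFunctions σ.differential c' t₀,
        (∀ α ∈ roots c', ∀ (X : c')
            (hX : lieExp (X : LieAlg n G) * t₀ ∈ regularSemisimple σ.differential),
          rootPower ε α X ≠ rootPower ε (-α) X ∧
          (coth α).1 ⟨_, mem_regularPart X hX⟩ =
            (rootPower ε α X + rootPower ε (-α) X) / (rootPower ε α X - rootPower ε (-α) X) ∧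
          (csch α).1 ⟨_, mem_regularPart X hX⟩ =
            2 / (rootPower ε α X - rootPower ε (-α) X) ∧
          (cschHalfSq α).1 ⟨_, mem_regularPart X hX⟩ =
            4 / (rootPower ε α X + rootPower ε (-α) X - 2)) ∧
        ∀ F : RadialSpace σ.differential c' t₀,
          (IsPi (casimir B) F ↔
            F = casimirFormula hH.differential_involutive B c' (Ad n t₀) (hφ.restrictPhi hH.differential_involutive) hφ.dualAction
              coth csch cschHalfSq) ∧
          (IsPiTilde (casimir B) F ↔
            F = casimirFormula hH.differential_involutive B c' (Ad n t₀) (hφ.restrictPhi hH.differential_involutive) hφ.dualAction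
              coth csch cschHalfSq)) ∧
    ((∀ X, Ad n t₀ X = X) →
      ∃ coth csch cschHalfSq : (c' →ₗ[ℝ] ℂ) → smoothFunctions σ.differential c' t₀,
        (∀ α ∈ roots c', ∀ (X : c')
            (hX : lieExp (X : LieAlg n G) * t₀ ∈ regularSemisimple σ.differential),
          Complex.sinh (α X) ≠ 0 ∧
          (coth α).1 ⟨_, mem_regularPart X hX⟩ = Complex.cosh (α X) / Complex.sinh (α X) ∧
          (csch α).1 ⟨_, mem_regularPart X hX⟩ = 1 / Complex.sinh (α X) ∧
          (cschHalfSq α).1 ⟨_, mem_regularPart X hX⟩ = 1 / Complex.sinh (α X / 2) ^ 2) ∧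
        ∀ F : RadialSpace σ.differential c' t₀,
          (IsPi (casimir B) F ↔
            F = casimirFormula hH.differential_involutive B c' (Ad n t₀) LinearMap.id id coth csch cschHalfSq) ∧
          (IsPiTilde (casimir B) F ↔
            F = casimirFormula hH.differential_involutive B c' (Ad n t₀) LinearMap.id id coth csch cschHalfSq)) := by
  have h := hG.cartanData hH.differential_involutive hθσ hBσ
  have hR := radialData_of_isStandardCartan h hG hC hC'
  refine ⟨fun φ ε hφ => ?_, fun hT => ?_⟩
  · obtain ⟨coth, csch, cschHalfSq, hf⟩ := exists_isRootFunctions hR hφ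
    exact ⟨coth, csch, cschHalfSq, fun α hα X hX =>
      ⟨hR.rootPower_ne hφ (isRegularPoint_of_mem X hX) hα, hf.coth_apply α hα X hX,
        hf.csch_apply α hα X hX, hf.cschHalfSq_apply α hα X hX⟩,
      isPi_and_isPiTilde_casimir_iff h hG hC hC' hH.differential_involutive hφ hf⟩
  -- for `Ad(t) = 1` the technical condition holds with `φ = 1` and `ε = 1`
  · have hφ := technicalCondition_one (σ := σ.differential) B c' hT
    obtain ⟨coth, csch, cschHalfSq, hf⟩ := exists_isRootFunctions hR hφ
    have hφ₁ : hφ.restrictPhi hH.differential_involutive = LinearMap.id := rfl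
    have hφ₂ : hφ.dualAction = id :=
      funext fun α => LinearMap.ext fun X => congrArg α (Subtype.ext (hT X))
    refine ⟨coth, csch, cschHalfSq, fun α hα X hX => ?_, fun F => ?_⟩
    · have hne := hR.rootPower_ne hφ (isRegularPoint_of_mem X hX) hα
      have h₁ := hf.coth_apply α hα X hX
      have h₂ := hf.csch_apply α hα X hX
      have h₃ := hf.cschHalfSq_apply α hα X hX
      rw [rootPower_one, rootPower_one, LinearMap.neg_apply] at hne h₁ h₂ h₃
      have hs : Complex.exp (α X) - Complex.exp (-α X) = 2 * Complex.sinh (α X) := by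
        rw [Complex.sinh]; ring
      have hc : Complex.exp (α X) + Complex.exp (-α X) = 2 * Complex.cosh (α X) := by
        rw [Complex.cosh]; ring
      refine ⟨fun h0 => hne (sub_eq_zero.mp (by rw [hs, h0, mul_zero])), ?_, ?_, ?_⟩
      · rw [h₁, hs, hc, mul_div_mul_left _ _ two_ne_zero]
      · rw [h₂, hs, div_mul_eq_div_div, div_self two_ne_zero]
      · rw [h₃, exp_add_exp_neg_sub_two, div_mul_eq_div_div, div_self (by norm_num : (4 : ℂ) ≠ 0)]
    · have key := isPi_and_isPiTilde_casimir_iff h hG hC hC' hH.differential_involutive hφ hf F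
      rwa [hφ₁, hφ₂] at key
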